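/- Let $b$ be a prime, $m,s\in\mathbb N$, $N=b^m$, let $w_1\le w_2\le\dots\le w_s$ be non-negative integers, $Y_j=b^{w_j}$, let $\gamma_1,\dots,\gamma_s>0$ be product weights, and let $\alpha$ be a positive even integer. Put $\varphi_\alpha(x)=\sum_{h\in\mathbb Z\setminus\{0\}}|h|^{-\alpha}e^{2\pi i hx}$, let $s^*$ be the largest index $j$ with $w_j<m$ ($s^*=0$ if there is none), and $r=\min\{s,s^*\}$. For $w_d<m$ let $\mathcal Z_d=\{z\in\{1,\dots,b^{m-w_d}-1\}:\gcd(z,N)=1\}$. Denote $\eta_d(n)=\prod_{j=1}^{d}\bigl(1+\gamma_j\varphi_\alpha(\{nY_jz_j/N\})\bigr)$ and $T_d(z)=\sum_{n=0}^{N-1}\varphi_\alpha(\{nY_dz/N\})\,\eta_{d-1}(n)$. The reduced fast component-by-component algorithm for lattice rules tabulates $\varphi_\alpha(n/N)$ for $0\le n<N$, sets $z_1=1$ and computes $\eta_1$; then, for $d=2,\dots,r$, it adds up the $b^{w_d}$ consecutive blocks of length $b^{m-w_d}$ of $\eta_{d-1}$, computes from this sum $T_d(z)$ for all $z\in\mathcal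 Z_d$, chooses $z_d\in\mathcal Z_d$ minimizing $T_d$, and computes $\eta_d$; it sets $z_d=0$ for $r<d\le s$ and computes $-1+N^{-1}\sum_{n=0}^{N-1}\eta_r(n)$, which is the squared worst-case error if $s\le s^*$. Theorem. This algorithm can be carried out, with all the quantities just listed as output, by one program (the same for all $b,m,s,\alpha,(w_j),(\gamma_j)$) of a real random access machine with unit-cost integer arithmetic and comparisons, unit-cost real operations $+,-,\times,/,\sqrt{\ }$ and comparisons, the constant $\pi$, and memory that is initially zero except for the input, using at most $$C\Bigl(b^m+\min\{s,s^*\}\,b^m+\sum_{d=1}^{\min\{s,s^*\}}(m-w_d)\,b^{m-w_d}\Bigr)$$ operations, where the constant $C$ depends only on $b$ and $\alpha$. -/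

import Mathlib

/-! ## A real random access machine with a step count -/

namespace RealRAM

/-- Memory: natural-number registers and arrays (counters, indices, tables of integers) and real
registers and arrays. Registers and arrays are numbered; a program mentions finitely many. -/
structure State where
  natReg : ℕ → ℕ
  realReg : ℕ → ℝ
  natArr : ℕ → ℕ → ℕ
  realArr : ℕ → ℕ → ℝ

/-- Expressions of natural-number type. There is no operation from reals to natural numbers. -/
inductive NExp where
  | const (k : ℕ)
  | reg (i : ℕ)
  | arr (a : ℕ) (idx : NExp)
  | add (e f : NExp)
  | sub (e f : NExp)
  | mul (e f : NExp)
  | div (e f : NExp)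
  | mod (e f : NExp)

/-- Expressions of real type: the four arithmetic operations, the square root, the constant `π`,
and natural numbers regarded as reals. -/
inductive RExp where
  | ofNat (e : NExp)
  | pi
  | reg (i : ℕ)
  | arr (a : ℕ) (idx : NExp)
  | add (e f : RExp)
  | sub (e f : RExp)
  | mul (e f : RExp)
  | div (e f : RExp)
  | sqrt (e : RExp)

/-- Tests: comparisons of natural numbers or of reals, and their Boolean combinations. -/
inductive BExp where
  | natLe (e f : NExp)
  | realLe (e f : RExp)
  | not (c : BExp)
  | and (c d : BExp)

/-- Programs: assignments to a register or to an array cell, and structured control flow. -/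
inductive Cmd where
  | skip
  | setNat (i : ℕ) (e : NExp)
  | setReal (i : ℕ) (e : RExp)
  | storeNat (a : ℕ) (idx e : NExp)
  | storeReal (a : ℕ) (idx : NExp) (e : RExp)
  | seq (p q : Cmd)
  | ite (c : BExp) (p q : Cmd)
  | while (c : BExp) (p : Cmd)

/-- Value; subtraction is truncated at zero, `div` and `mod` are division with remainder. -/
def NExp.eval (σ : State) : NExp → ℕ
  | const k => k
  | reg i => σ.natReg i
  | arr a idx => σ.natArr a (idx.eval σ)
  | add e f => e.eval σ + f.eval σ
  | sub e f => e.eval σ - f.eval σ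
  | mul e f => e.eval σ * f.eval σ
  | div e f => e.eval σ / f.eval σ
  | mod e f => e.eval σ % f.eval σ

/-- Number of operations: one for each constant, memory access and arithmetic operation. -/
def NExp.cost : NExp → ℕ
  | const _ => 1
  | reg _ => 1
  | arr _ idx => idx.cost + 1
  | add e f => e.cost + f.cost + 1
  | sub e f => e.cost + f.cost + 1
  | mul e f => e.cost + f.cost + 1
  | div e f => e.cost + f.cost + 1
  | mod e f => e.cost + f.cost + 1

noncomputable def RExp.eval (σ : State) : RExp → ℝ
  | ofNat e => (e.eval σ : ℝ)
  | pi => Real.pi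
  | reg i => σ.realReg i
  | arr a idx => σ.realArr a (idx.eval σ)
  | add e f => e.eval σ + f.eval σ
  | sub e f => e.eval σ - f.eval σ
  | mul e f => e.eval σ * f.eval σ
  | div e f => e.eval σ / f.eval σ
  | sqrt e => Real.sqrt (e.eval σ)

def RExp.cost : RExp → ℕ
  | ofNat e => e.cost + 1
  | pi => 1
  | reg _ => 1
  | arr _ idx => idx.cost + 1
  | add e f => e.cost + f.cost + 1
  | sub e f => e.cost + f.cost + 1
  | mul e f => e.cost + f.cost + 1
  | div e f => e.cost + f.cost + 1
  | sqrt e => e.cost + 1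

def BExp.Holds (σ : State) : BExp → Prop
  | natLe e f => e.eval σ ≤ f.eval σ
  | realLe e f => e.eval σ ≤ f.eval σ
  | not c => ¬ c.Holds σ
  | and c d => c.Holds σ ∧ d.Holds σ

def BExp.cost : BExp → ℕ
  | natLe e f => e.cost + f.cost + 1
  | realLe e f => e.cost + f.cost + 1
  | not c => c.cost + 1
  | and c d => c.cost + d.cost + 1

def State.setNat (σ : State) (i v : ℕ) : State :=
  { σ with natReg := Function.update σ.natReg i v }

noncomputable def State.setReal (σ : State) (i : ℕ) (v : ℝ) : State :=
  { σ with realReg := Function.update σ.realReg i v }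

def State.storeNat (σ : State) (a k v : ℕ) : State :=
  { σ with natArr := Function.update σ.natArr a (Function.update (σ.natArr a) k v) }

noncomputable def State.storeReal (σ : State) (a k : ℕ) (v : ℝ) : State :=
  { σ with realArr := Function.update σ.realArr a (Function.update (σ.realArr a) k v) }

/-- `Exec p σ σ' t`: started in memory `σ`, the program `p` halts in memory `σ'` after exactly
`t` operations. Every evaluation of an expression or test and every assignment or branch is
charged. -/
inductive Exec : Cmd → State → State → ℕ → Prop
  | skip (σ : State) : Exec Cmd.skip σ σ 1
  | setNat (σ : State) (i : ℕ) (e : NExp) :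
      Exec (Cmd.setNat i e) σ (σ.setNat i (e.eval σ)) (e.cost + 1)
  | setReal (σ : State) (i : ℕ) (e : RExp) :
      Exec (Cmd.setReal i e) σ (σ.setReal i (e.eval σ)) (e.cost + 1)
  | storeNat (σ : State) (a : ℕ) (idx e : NExp) :
      Exec (Cmd.storeNat a idx e) σ (σ.storeNat a (idx.eval σ) (e.eval σ))
        (idx.cost + e.cost + 1)
  | storeReal (σ : State) (a : ℕ) (idx : NExp) (e : RExp) :
      Exec (Cmd.storeReal a idx e) σ (σ.storeReal a (idx.eval σ) (e.eval σ))
        (idx.cost + e.cost + 1)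
  | seq {p q : Cmd} {σ σ' σ'' : State} {t u : ℕ} (hp : Exec p σ σ' t) (hq : Exec q σ' σ'' u) :
      Exec (Cmd.seq p q) σ σ'' (t + u)
  | iteTrue {c : BExp} {p q : Cmd} {σ σ' : State} {t : ℕ} (hc : c.Holds σ)
      (hp : Exec p σ σ' t) : Exec (Cmd.ite c p q) σ σ' (c.cost + 1 + t)
  | iteFalse {c : BExp} {p q : Cmd} {σ σ' : State} {t : ℕ} (hc : ¬ c.Holds σ)
      (hq : Exec q σ σ' t) : Exec (Cmd.ite c p q) σ σ' (c.cost + 1 + t)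
  | whileTrue {c : BExp} {p : Cmd} {σ σ' σ'' : State} {t u : ℕ} (hc : c.Holds σ)
      (hp : Exec p σ σ' t) (hw : Exec (Cmd.while c p) σ' σ'' u) :
      Exec (Cmd.while c p) σ σ'' (c.cost + 1 + t + u)
  | whileFalse {c : BExp} {p : Cmd} {σ : State} (hc : ¬ c.Holds σ) :
      Exec (Cmd.while c p) σ σ (c.cost + 1)

end RealRAM

/-! ## The quantities of the reduced fast component-by-component construction -/

namespace ReducedCBC

/-- `φ_α(x) = ∑_{h ∈ ℤ, h ≠ 0} exp(2πi h x) / |h|^α` (a real number). -/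
noncomputable def phi (α : ℕ) (x : ℝ) : ℝ :=
  (∑' h : {h : ℤ // h ≠ 0},
    Complex.exp (2 * Real.pi * Complex.I * (h.1 : ℂ) * (x : ℂ)) / ((|h.1| : ℤ) : ℂ) ^ α).re

/-- `min {s, s*}`, where `s*` is the largest index `d ≥ 1` with `w_d < m` (`0` if there is none,
`∞` if all `w_d` are smaller than `m`), for nondecreasing `w`: the largest `d ∈ {1, …, s}` with
`w_d < m`, or `0`. -/
def activeDim (m s : ℕ) (w : ℕ → ℕ) : ℕ :=
  Nat.findGreatest (fun d => w d < m) s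

/-- The set `{z ∈ {1, …, b^(m-w) - 1} : gcd(z, b^m) = 1}` (used for `w < m`). -/
def searchSet (b m w : ℕ) : Finset ℕ :=
  (Finset.Icc 1 (b ^ (m - w) - 1)).filter (fun z => Nat.gcd z (b ^ m) = 1)

/-- `φ_α({n Y_j z_j / b^m})` with `Y_j = b^(w_j)`, for `n` and `z_j = z`, `w_j = w`. -/
noncomputable def phiAt (b m α w : ℕ) (z n : ℕ) : ℝ :=
  phi α (Int.fract (((n * b ^ w * z : ℕ) : ℝ) / ((b ^ m : ℕ) : ℝ)))

/-- `η_d(n) = ∏_{j=1}^d (1 + γ_j φ_α({n Y_j z_j / b^m}))`. -/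
noncomputable def eta (b m α : ℕ) (w : ℕ → ℕ) (γ : ℕ → ℝ) (z : ℕ → ℕ) (d n : ℕ) : ℝ :=
  ∏ j ∈ Finset.Icc 1 d, (1 + γ j * phiAt b m α (w j) (z j) n)

/-- Entry `i < b^(m - w_d)` of `η'`, the sum of the `b^(w_d)` consecutive blocks of length
`b^(m - w_d)` of the vector `η_{d-1}`. -/
noncomputable def foldedEta (b m α : ℕ) (w : ℕ → ℕ) (γ : ℕ → ℝ) (z : ℕ → ℕ) (d i : ℕ) : ℝ :=
  ∑ c ∈ Finset.range (b ^ w d), eta b m α w γ z (d - 1) (c * b ^ (m - w d) + i)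

/-- `T_d(y) = ∑_{n=0}^{b^m-1} φ_α({n Y_d y / b^m}) η_{d-1}(n)`, the quantity minimized over `y`
in step `d`. It depends on `z_1, …, z_{d-1}` only. -/
noncomputable def T (b m α : ℕ) (w : ℕ → ℕ) (γ : ℕ → ℝ) (z : ℕ → ℕ) (d y : ℕ) : ℝ :=
  ∑ n ∈ Finset.range (b ^ m), phiAt b m α (w d) y n * eta b m α w γ z (d - 1) n

open RealRAM in
/-- Initial memory: the parameters `b, m, s, α` in natural registers `0, 1, 2, 3`, the `w_j` in
natural array `0`, the `γ_j` in real array `0`; everything else is zero. -/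
noncomputable def initialState (b m s α : ℕ) (w : ℕ → ℕ) (γ : ℕ → ℝ) : State where
  natReg i := if i = 0 then b else if i = 1 then m else if i = 2 then s
    else if i = 3 then α else 0
  realReg _ := 0
  natArr a j := if a = 0 then w j else 0
  realArr a j := if a = 0 then γ j else 0

open RealRAM in
/-- The memory `σ` holds all results, also the intermediate ones, of the reduced fast
component-by-component algorithm. Natural array `1` holds the `z_d`; real array `1` holds the
table of `φ_α`; real arrays `2`, `3`, `4` hold `η_d(n)`, `η'(i)` and `T_d(y)` in row `d`,
where row `d` of an array starts at cell `d * b^m`. Real register `0` holds the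
final error value. -/
structure Computed (b m s α : ℕ) (w : ℕ → ℕ) (γ : ℕ → ℝ) (σ : State) : Prop where
  /-- The table of the values `φ_α(n / b^m)`. -/
  table : ∀ n < b ^ m, σ.realArr 1 n = phi α ((n : ℝ) / ((b ^ m : ℕ) : ℝ))
  /-- `z_1 = 1` (if `w_1 < m`). -/
  first : 1 ≤ activeDim m s w → σ.natArr 1 1 = 1
  /-- The folded vectors `η'`. -/
  folded : ∀ d ∈ Finset.Icc 2 (activeDim m s w), ∀ i < b ^ (m - w d),
    σ.realArr 3 (d * b ^ m + i) = foldedEta b m α w γ (σ.natArr 1) d i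
  /-- The matrix-vector products: all values of `T_d`. -/
  product : ∀ d ∈ Finset.Icc 2 (activeDim m s w), ∀ y ∈ searchSet b m (w d),
    σ.realArr 4 (d * b ^ m + y) = T b m α w γ (σ.natArr 1) d y
  /-- `z_d` is an element of the search set that minimizes `T_d`. -/
  argmin : ∀ d ∈ Finset.Icc 2 (activeDim m s w),
    σ.natArr 1 d ∈ searchSet b m (w d) ∧
      ∀ y ∈ searchSet b m (w d),
        T b m α w γ (σ.natArr 1) d (σ.natArr 1 d) ≤ T b m α w γ (σ.natArr 1) d y
  /-- The vectors `η_d`; `η_1` is computed in any case. -/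
  etas : ∀ d ∈ Finset.Icc 1 (max 1 (activeDim m s w)), ∀ n < b ^ m,
    σ.realArr 2 (d * b ^ m + n) = eta b m α w γ (σ.natArr 1) d n
  /-- The components with `w_d ≥ m` are zero. -/
  tail : ∀ d, activeDim m s w < d → d ≤ s → σ.natArr 1 d = 0
  /-- The error value `-1 + b^(-m) ∑ η_r(n)`, `r = min {s, s*}`; this is the squared worst-case
  error if `s ≤ s*`. (For `s > s*` the factors `1 + γ_j φ_α(0)`, `s* < j ≤ s`, are not multiplied
  in, since the number of operations allowed does not depend on `s` then.) -/
  error : σ.realReg 0 = -1 + (1 / ((b ^ m : ℕ) : ℝ)) *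
    ∑ n ∈ Finset.range (b ^ m), eta b m α w γ (σ.natArr 1) (activeDim m s w) n

/-- `b^m + min{s,s*} b^m + ∑_{d=1}^{min{s,s*}} (m - w_d) b^(m - w_d)`. -/
def costBound (b m s : ℕ) (w : ℕ → ℕ) : ℕ :=
  b ^ m + activeDim m s w * b ^ m +
    ∑ d ∈ Finset.Icc 1 (activeDim m s w), (m - w d) * b ^ (m - w d)

end ReducedCBC

/-! The expensive task is to find `T_d(y)` for all units `y`. The kernel φ_α({n Y_d y/N}) has period
M = b^(k+1) in n, where k + 1 = m - w_d, so `T_d` is a matrix-vector product of size M applied to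
the folded vector (`T_eq_sum_folded`). Put g = 1 + b². Apart from the b multiples of b^k, every
column index is b^j c g^a modulo M with j < k, c < b² prime to b and a < b^(k-1-j)
(`sum_range_prime_pow`), and every row index is y = c' g^a' (`exists_eq_mul_pow_mod`). For fixed j,
c, c' the kernel depends on a + a' only, and because of the factor b^j only on a' modulo L =
b^(k-1-j). Hence `T_d` is a sum of b direct terms and of correlations of length L, with b⁴ pairs (c,
c') on each level j (`T_eq_sum_correlations`). The element g is preferred to a primitive root
because its order modulo b^(n+2) is b^n for every prime, b = 2 included; the price is a factor that
depends on b only.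

A correlation ∑ F(a + a') G(a) is obtained from three discrete Fourier transforms whose length P =
2^l is the least power of two with P ≥ 2L; zero padding excludes wrap-around (`dft_correlation`).
The transforms use the radix-2 step `dftRow_step`, and exp(2πi/P) is reached from -1 by the
half-angle formulas, that is, by square roots. A correlation costs O((l + 1) P) operations. The
lengths decrease geometrically with j, so one dimension costs O((m - w_d) b^(m-w_d)) with a constant
depending on b (`blocks_cost_le`, `gather_cost_le`), besides O(b^m) for folding and for updating η.

For even α the function φ_α is a multiple of the Bernoulli polynomial on [0, 1]
(`phi_eq_bernoulliFun`). Its coefficients take O(α²) operations and each table entry O(α) by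
Horner's scheme.

On the machine side, `Spec` expresses total correctness with a time bound, and `Exec.agree` says
that whatever a program does not mention as a target is unchanged. Most bounds have the form program
size times X. The size depends on the program text only, so these factors are harmless constants
that need not be computed. `stepCmd_spec` gives the induction step over the dimensions and
`algorithm_spec` assembles everything. -/

namespace RealRAM

/-! ### Simplification rules for memory -/

@[simp] theorem State.setNat_natReg (σ : State) (i v j : ℕ) :
    (σ.setNat i v).natReg j = if j = i then v else σ.natReg j := by
  simp [State.setNat, Function.update_apply]

@[simp] theorem State.setNat_realReg (σ : State) (i v : ℕ) :
    (σ.setNat i v).realReg = σ.realReg := rfl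

@[simp] theorem State.setNat_natArr (σ : State) (i v : ℕ) :
    (σ.setNat i v).natArr = σ.natArr := rfl

@[simp] theorem State.setNat_realArr (σ : State) (i v : ℕ) :
    (σ.setNat i v).realArr = σ.realArr := rfl

@[simp] theorem State.setReal_realReg (σ : State) (i : ℕ) (v : ℝ) (j : ℕ) :
    (σ.setReal i v).realReg j = if j = i then v else σ.realReg j := by
  simp [State.setReal, Function.update_apply]

@[simp] theorem State.setReal_natReg (σ : State) (i : ℕ) (v : ℝ) :
    (σ.setReal i v).natReg = σ.natReg := rfl

@[simp] theorem State.setReal_natArr (σ : State) (i : ℕ) (v : ℝ) :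
    (σ.setReal i v).natArr = σ.natArr := rfl

@[simp] theorem State.setReal_realArr (σ : State) (i : ℕ) (v : ℝ) :
    (σ.setReal i v).realArr = σ.realArr := rfl

@[simp] theorem State.storeNat_natArr (σ : State) (a k v a' k' : ℕ) :
    (σ.storeNat a k v).natArr a' k' = if a' = a ∧ k' = k then v else σ.natArr a' k' := by
  by_cases h : a' = a
  · subst h; simp [State.storeNat, Function.update_apply]
  · simp [State.storeNat, h]

@[simp] theorem State.storeNat_natReg (σ : State) (a k v : ℕ) :
    (σ.storeNat a k v).natReg = σ.natReg := rfl

@[simp] theorem State.storeNat_realReg (σ : State) (a k v : ℕ) :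
    (σ.storeNat a k v).realReg = σ.realReg := rfl

@[simp] theorem State.storeNat_realArr (σ : State) (a k v : ℕ) :
    (σ.storeNat a k v).realArr = σ.realArr := rfl

@[simp] theorem State.storeReal_realArr (σ : State) (a k : ℕ) (v : ℝ) (a' k' : ℕ) :
    (σ.storeReal a k v).realArr a' k' = if a' = a ∧ k' = k then v else σ.realArr a' k' := by
  by_cases h : a' = a
  · subst h; simp [State.storeReal, Function.update_apply]
  · simp [State.storeReal, h]

@[simp] theorem State.storeReal_natReg (σ : State) (a k : ℕ) (v : ℝ) :
    (σ.storeReal a k v).natReg = σ.natReg := rfl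

@[simp] theorem State.storeReal_realReg (σ : State) (a k : ℕ) (v : ℝ) :
    (σ.storeReal a k v).realReg = σ.realReg := rfl

@[simp] theorem State.storeReal_natArr (σ : State) (a k : ℕ) (v : ℝ) :
    (σ.storeReal a k v).natArr = σ.natArr := rfl

/-! ### Operator notation for expressions -/

instance (n : ℕ) : OfNat NExp n := ⟨.const n⟩
instance : Add NExp := ⟨.add⟩
instance : Sub NExp := ⟨.sub⟩
instance : Mul NExp := ⟨.mul⟩
instance : Div NExp := ⟨.div⟩
instance : Mod NExp := ⟨.mod⟩
instance (n : ℕ) : OfNat RExp n := ⟨.ofNat (.const n)⟩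
instance : Add RExp := ⟨.add⟩
instance : Sub RExp := ⟨.sub⟩
instance : Mul RExp := ⟨.mul⟩
instance : Div RExp := ⟨.div⟩

@[simp] theorem NExp.eval_ofNat (σ : State) (n : ℕ) [n.AtLeastTwo] :
    (ofNat(n) : NExp).eval σ = ofNat(n) := rfl
@[simp] theorem NExp.eval_zero (σ : State) : (0 : NExp).eval σ = 0 := rfl
@[simp] theorem NExp.eval_one (σ : State) : (1 : NExp).eval σ = 1 := rfl
@[simp] theorem NExp.eval_reg (σ : State) (i : ℕ) : (NExp.reg i).eval σ = σ.natReg i := rfl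
@[simp] theorem NExp.eval_arr (σ : State) (a : ℕ) (e : NExp) :
    (NExp.arr a e).eval σ = σ.natArr a (e.eval σ) := rfl
@[simp] theorem NExp.eval_add (σ : State) (e f : NExp) :
    (e + f).eval σ = e.eval σ + f.eval σ := rfl
@[simp] theorem NExp.eval_sub (σ : State) (e f : NExp) :
    (e - f).eval σ = e.eval σ - f.eval σ := rfl
@[simp] theorem NExp.eval_mul (σ : State) (e f : NExp) :
    (e * f).eval σ = e.eval σ * f.eval σ := rfl
@[simp] theorem NExp.eval_div (σ : State) (e f : NExp) :
    (e / f).eval σ = e.eval σ / f.eval σ := rfl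
@[simp] theorem NExp.eval_mod (σ : State) (e f : NExp) :
    (e % f).eval σ = e.eval σ % f.eval σ := rfl
@[simp] theorem RExp.eval_ofNat (σ : State) (e : NExp) :
    (RExp.ofNat e).eval σ = (e.eval σ : ℝ) := rfl
@[simp] theorem RExp.eval_natLit (σ : State) (n : ℕ) [n.AtLeastTwo] :
    (ofNat(n) : RExp).eval σ = ofNat(n) := rfl
@[simp] theorem RExp.eval_zero (σ : State) : (0 : RExp).eval σ = 0 := Nat.cast_zero
@[simp] theorem RExp.eval_one (σ : State) : (1 : RExp).eval σ = 1 := Nat.cast_one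
@[simp] theorem RExp.eval_pi (σ : State) : RExp.pi.eval σ = Real.pi := rfl
@[simp] theorem RExp.eval_reg (σ : State) (i : ℕ) : (RExp.reg i).eval σ = σ.realReg i := rfl
@[simp] theorem RExp.eval_arr (σ : State) (a : ℕ) (e : NExp) :
    (RExp.arr a e).eval σ = σ.realArr a (e.eval σ) := rfl
@[simp] theorem RExp.eval_add (σ : State) (e f : RExp) :
    (e + f).eval σ = e.eval σ + f.eval σ := rfl
@[simp] theorem RExp.eval_sub (σ : State) (e f : RExp) :
    (e - f).eval σ = e.eval σ - f.eval σ := rfl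
@[simp] theorem RExp.eval_mul (σ : State) (e f : RExp) :
    (e * f).eval σ = e.eval σ * f.eval σ := rfl
@[simp] theorem RExp.eval_div (σ : State) (e f : RExp) :
    (e / f).eval σ = e.eval σ / f.eval σ := rfl
@[simp] theorem RExp.eval_sqrt (σ : State) (e : RExp) :
    (RExp.sqrt e).eval σ = Real.sqrt (e.eval σ) := rfl

/-! ### Syntactic size and syntactic frame -/

/-- Sum of the costs of all basic steps that occur in the text of a program. -/
def Cmd.size : Cmd → ℕ
  | skip => 1
  | setNat _ e => e.cost + 1
  | setReal _ e => e.cost + 1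
  | storeNat _ idx e => idx.cost + e.cost + 1
  | storeReal _ idx e => idx.cost + e.cost + 1
  | seq p q => p.size + q.size
  | ite c p q => c.cost + 1 + p.size + q.size
  | .while c p => c.cost + 1 + p.size

/-- An over-approximation read off the text; an array counts as written as a whole. With `Nat.beq`
the value at concrete numbers reduces, so side conditions are mostly closed by `rfl`. -/
def Cmd.writesNatReg : Cmd → ℕ → Bool
  | setNat i _, j => Nat.beq i j
  | seq p q, j => p.writesNatReg j || q.writesNatReg j
  | ite _ p q, j => p.writesNatReg j || q.writesNatReg j
  | .while _ p, j => p.writesNatReg j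
  | _, _ => false

def Cmd.writesRealReg : Cmd → ℕ → Bool
  | setReal i _, j => Nat.beq i j
  | seq p q, j => p.writesRealReg j || q.writesRealReg j
  | ite _ p q, j => p.writesRealReg j || q.writesRealReg j
  | .while _ p, j => p.writesRealReg j
  | _, _ => false

def Cmd.writesNatArr : Cmd → ℕ → Bool
  | storeNat i _ _, j => Nat.beq i j
  | seq p q, j => p.writesNatArr j || q.writesNatArr j
  | ite _ p q, j => p.writesNatArr j || q.writesNatArr j
  | .while _ p, j => p.writesNatArr j
  | _, _ => false

def Cmd.writesRealArr : Cmd → ℕ → Bool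
  | storeReal i _ _, j => Nat.beq i j
  | seq p q, j => p.writesRealArr j || q.writesRealArr j
  | ite _ p q, j => p.writesRealArr j || q.writesRealArr j
  | .while _ p, j => p.writesRealArr j
  | _, _ => false

theorem Cmd.beq_eq_false {i j : ℕ} (h : i ≠ j) : Nat.beq i j = false :=
  Bool.eq_false_iff.mpr fun h' => h (Nat.eq_of_beq_eq_true h')

/-- The memories `σ` and `σ'` differ at most in the registers and arrays to which `p` writes. -/
structure Agree (p : Cmd) (σ σ' : State) : Prop where
  natReg : ∀ i, p.writesNatReg i = false → σ'.natReg i = σ.natReg i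
  realReg : ∀ i, p.writesRealReg i = false → σ'.realReg i = σ.realReg i
  natArr : ∀ a, p.writesNatArr a = false → σ'.natArr a = σ.natArr a
  realArr : ∀ a, p.writesRealArr a = false → σ'.realArr a = σ.realArr a

theorem Agree.rfl' (p : Cmd) (σ : State) : Agree p σ σ :=
  ⟨fun _ _ => rfl, fun _ _ => rfl, fun _ _ => rfl, fun _ _ => rfl⟩

theorem Agree.trans {p : Cmd} {σ σ' σ'' : State} (h : Agree p σ σ') (h' : Agree p σ' σ'') :
    Agree p σ σ'' :=
  ⟨fun i hi => (h'.natReg i hi).trans (h.natReg i hi),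
   fun i hi => (h'.realReg i hi).trans (h.realReg i hi),
   fun i hi => (h'.natArr i hi).trans (h.natArr i hi),
   fun i hi => (h'.realArr i hi).trans (h.realArr i hi)⟩

theorem Cmd.size_pos (p : Cmd) : 0 < p.size := by
  induction p <;> simp only [Cmd.size] <;> omega

/-- `p` writes only where `q` writes. -/
structure Cmd.WritesLe (p q : Cmd) : Prop where
  natReg : ∀ i, q.writesNatReg i = false → p.writesNatReg i = false
  realReg : ∀ i, q.writesRealReg i = false → p.writesRealReg i = false
  natArr : ∀ i, q.writesNatArr i = false → p.writesNatArr i = false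
  realArr : ∀ i, q.writesRealArr i = false → p.writesRealArr i = false

theorem Agree.mono {p q : Cmd} {σ σ' : State} (h : Agree p σ σ') (hpq : p.WritesLe q) :
    Agree q σ σ' :=
  ⟨fun i hi => h.natReg i (hpq.natReg i hi), fun i hi => h.realReg i (hpq.realReg i hi),
   fun i hi => h.natArr i (hpq.natArr i hi), fun i hi => h.realArr i (hpq.realArr i hi)⟩

theorem Cmd.WritesLe.refl (p : Cmd) : p.WritesLe p :=
  ⟨fun _ h => h, fun _ h => h, fun _ h => h, fun _ h => h⟩

theorem Cmd.WritesLe.trans {p q r : Cmd} (h : p.WritesLe q) (h' : q.WritesLe r) : p.WritesLe r :=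
  ⟨fun i hi => h.natReg i (h'.natReg i hi), fun i hi => h.realReg i (h'.realReg i hi),
   fun i hi => h.natArr i (h'.natArr i hi), fun i hi => h.realArr i (h'.realArr i hi)⟩

theorem Cmd.WritesLe.seq_left (p q : Cmd) : p.WritesLe (.seq p q) := by
  constructor <;> intro i h <;>
    simp only [writesNatReg, writesRealReg, writesNatArr, writesRealArr, Bool.or_eq_false_iff] at h
      <;> exact h.1

theorem Cmd.WritesLe.seq_right (p q : Cmd) : q.WritesLe (.seq p q) := by
  constructor <;> intro i h <;>
    simp only [writesNatReg, writesRealReg, writesNatArr, writesRealArr, Bool.or_eq_false_iff] at h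
      <;> exact h.2

theorem Cmd.WritesLe.ite_left (c : BExp) (p q : Cmd) : p.WritesLe (.ite c p q) := by
  constructor <;> intro i h <;>
    simp only [writesNatReg, writesRealReg, writesNatArr, writesRealArr, Bool.or_eq_false_iff] at h
      <;> exact h.1

theorem Cmd.WritesLe.ite_right (c : BExp) (p q : Cmd) : q.WritesLe (.ite c p q) := by
  constructor <;> intro i h <;>
    simp only [writesNatReg, writesRealReg, writesNatArr, writesRealArr, Bool.or_eq_false_iff] at h
      <;> exact h.2

theorem Cmd.WritesLe.while_body (c : BExp) (p : Cmd) : p.WritesLe (.while c p) :=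
  ⟨fun _ h => h, fun _ h => h, fun _ h => h, fun _ h => h⟩

/-- The frame rule. It removes everything about untouched memory from the loop invariants below. -/
theorem Exec.agree {p : Cmd} {σ σ' : State} {t : ℕ} (h : Exec p σ σ' t) : Agree p σ σ' := by
  induction h with
  | skip σ => exact Agree.rfl' _ _
  | setNat σ i e =>
    refine ⟨fun j hj => ?_, fun _ _ => rfl, fun _ _ => rfl, fun _ _ => rfl⟩
    have : j ≠ i := by rintro rfl; simp [Cmd.writesNatReg] at hj
    simp [this]
  | setReal σ i e =>
    refine ⟨fun _ _ => rfl, fun j hj => ?_, fun _ _ => rfl, fun _ _ => rfl⟩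
    have : j ≠ i := by rintro rfl; simp [Cmd.writesRealReg] at hj
    simp [this]
  | storeNat σ a idx e =>
    refine ⟨fun _ _ => rfl, fun _ _ => rfl, fun j hj => ?_, fun _ _ => rfl⟩
    have : j ≠ a := by rintro rfl; simp [Cmd.writesNatArr] at hj
    funext k; simp [this]
  | storeReal σ a idx e =>
    refine ⟨fun _ _ => rfl, fun _ _ => rfl, fun _ _ => rfl, fun j hj => ?_⟩
    have : j ≠ a := by rintro rfl; simp [Cmd.writesRealArr] at hj
    funext k; simp [this]
  | seq _ _ ihp ihq =>
    exact (ihp.mono (.seq_left _ _)).trans (ihq.mono (.seq_right _ _))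
  | iteTrue _ _ ih => exact ih.mono (.ite_left _ _ _)
  | iteFalse _ _ ih => exact ih.mono (.ite_right _ _ _)
  | whileTrue _ _ _ ihp ihw => exact (ihp.mono (.while_body _ _)).trans ihw
  | whileFalse _ => exact Agree.rfl' _ _

/-! ### Total correctness with a time bound -/

/-- Started in `σ`, the program `p` halts within `T` operations in a memory satisfying `Q`. -/
def Spec (p : Cmd) (σ : State) (Q : State → Prop) (T : ℕ) : Prop :=
  ∃ σ' t, Exec p σ σ' t ∧ Q σ' ∧ t ≤ T

namespace Spec

variable {p q : Cmd} {σ : State} {Q R : State → Prop} {T U : ℕ}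

/-- The frame information is supplied along with the old postcondition, so a specification need only
mention what its program changes. -/
theorem conseq (h : Spec p σ R T) (hTU : T ≤ U) (hQ : ∀ σ', R σ' → Agree p σ σ' → Q σ') :
    Spec p σ Q U := by
  obtain ⟨σ', t, he, hR, ht⟩ := h
  exact ⟨σ', t, he, hQ σ' hR he.agree, ht.trans hTU⟩

theorem mono (h : Spec p σ Q T) (hTU : T ≤ U) : Spec p σ Q U :=
  h.conseq hTU fun _ hQ _ => hQ

theorem skip (h : Q σ) : Spec .skip σ Q (Cmd.size .skip) := ⟨_, _, .skip σ, h, le_rfl⟩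

theorem setNat {i : ℕ} {e : NExp} (h : Q (σ.setNat i (e.eval σ))) :
    Spec (.setNat i e) σ Q (Cmd.size (.setNat i e)) := ⟨_, _, .setNat σ i e, h, le_rfl⟩

theorem setReal {i : ℕ} {e : RExp} (h : Q (σ.setReal i (e.eval σ))) :
    Spec (.setReal i e) σ Q (Cmd.size (.setReal i e)) := ⟨_, _, .setReal σ i e, h, le_rfl⟩

theorem storeNat {a : ℕ} {idx e : NExp} (h : Q (σ.storeNat a (idx.eval σ) (e.eval σ))) :
    Spec (.storeNat a idx e) σ Q (Cmd.size (.storeNat a idx e)) :=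
  ⟨_, _, .storeNat σ a idx e, h, le_rfl⟩

theorem storeReal {a : ℕ} {idx : NExp} {e : RExp}
    (h : Q (σ.storeReal a (idx.eval σ) (e.eval σ))) :
    Spec (.storeReal a idx e) σ Q (Cmd.size (.storeReal a idx e)) :=
  ⟨_, _, .storeReal σ a idx e, h, le_rfl⟩

theorem seq (hp : Spec p σ R T) (hq : ∀ σ', R σ' → Agree p σ σ' → Spec q σ' Q U) :
    Spec (.seq p q) σ Q (T + U) := by
  obtain ⟨σ', t, he, hR, ht⟩ := hp
  obtain ⟨σ'', u, he', hQ, hu⟩ := hq σ' hR he.agree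
  exact ⟨σ'', t + u, .seq he he', hQ, by omega⟩

/-- Sizes add under sequencing, so bounds with a common factor X combine without any bookkeeping of
constants. -/
theorem seqSize {X : ℕ} (hp : Spec p σ R (p.size * X))
    (hq : ∀ σ', R σ' → Agree p σ σ' → Spec q σ' Q (q.size * X)) :
    Spec (.seq p q) σ Q ((Cmd.seq p q).size * X) :=
  (seq hp hq).mono (by rw [Cmd.size, add_mul])

theorem ite {c : BExp} (ht : c.Holds σ → Spec p σ Q T) (hf : ¬ c.Holds σ → Spec q σ Q T) :
    Spec (.ite c p q) σ Q (c.cost + 1 + T) := by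
  by_cases hc : c.Holds σ
  · obtain ⟨σ', t, he, hQ, h⟩ := ht hc
    exact ⟨σ', _, .iteTrue hc he, hQ, by omega⟩
  · obtain ⟨σ', t, he, hQ, h⟩ := hf hc
    exact ⟨σ', _, .iteFalse hc he, hQ, by omega⟩

theorem iteSize {c : BExp} {X : ℕ} (hX : 1 ≤ X) (ht : c.Holds σ → Spec p σ Q (p.size * X))
    (hf : ¬ c.Holds σ → Spec q σ Q (q.size * X)) :
    Spec (.ite c p q) σ Q ((Cmd.ite c p q).size * X) := by
  refine (ite (fun h => (ht h).mono (Nat.le_add_right _ (q.size * X)))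
    (fun h => (hf h).mono (Nat.le_add_left _ (p.size * X)))).mono ?_
  rw [Cmd.size, add_mul, add_mul]
  have := Nat.le_mul_of_pos_right (c.cost + 1) hX
  omega

/-- A loop that is known to be executed exactly `n` times. -/
theorem whileLoop {c : BExp} (n : ℕ) (I : ℕ → State → Prop) (K : ℕ → ℕ) (h0 : I 0 σ)
    (hstep : ∀ k < n, ∀ σ', I k σ' → Agree (.while c p) σ σ' →
      c.Holds σ' ∧ Spec p σ' (I (k + 1)) (K k))
    (hend : ∀ σ', I n σ' → Agree (.while c p) σ σ' → ¬ c.Holds σ') :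
    Spec (.while c p) σ (I n)
      (∑ k ∈ Finset.range n, (K k + c.cost + 1) + (c.cost + 1)) := by
  induction n generalizing σ I K with
  | zero => exact ⟨σ, _, .whileFalse (hend σ h0 (Agree.rfl' _ _)), h0, by simp⟩
  | succ n ih =>
    obtain ⟨hc, σ₁, t, he, hI, ht⟩ := hstep 0 n.succ_pos σ h0 (Agree.rfl' _ _)
    have hA : Agree (.while c p) σ σ₁ := he.agree.mono (.while_body _ _)
    -- The remaining rounds start in `σ₁`, with invariant and costs shifted by one.
    obtain ⟨σ₂, u, he', hI', hu⟩ := ih (σ := σ₁) (fun k => I (k + 1)) (fun k => K (k + 1)) hI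
      (fun k hk σ' hI' hA' => hstep (k + 1) (by omega) σ' hI' (hA.trans hA'))
      (fun σ' hI' hA' => hend σ' hI' (hA.trans hA'))
    refine ⟨σ₂, _, .whileTrue hc he he', hI', ?_⟩
    rw [Finset.sum_range_succ']
    omega

end Spec

/-! ### Counting loops -/

/-- `for i := 0, …, e - 1 do p` -/
def forNat (i : ℕ) (e : NExp) (p : Cmd) : Cmd :=
  .seq (.setNat i 0) (.while (.not (.natLe e (.reg i))) (.seq p (.setNat i (.reg i + 1))))

theorem Cmd.forNat_writesRealArr (i : ℕ) (e : NExp) (p : Cmd) (a : ℕ) :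
    (forNat i e p).writesRealArr a = p.writesRealArr a := by
  simp [forNat, writesRealArr]

theorem Cmd.WritesLe.forNat_body (i : ℕ) (e : NExp) (p : Cmd) : p.WritesLe (forNat i e p) :=
  ((Cmd.WritesLe.seq_left _ _).trans (.while_body _ _)).trans (.seq_right _ _)

/-- The bound `e` is evaluated anew in each round, hence it must have the value `n` in every memory
the loop can produce. Test and increment of a round are charged with the size of the whole loop. -/
theorem Spec.forNat {i : ℕ} {e : NExp} {p : Cmd} {σ : State} (n : ℕ) (I : ℕ → State → Prop)
    (K : ℕ → ℕ) (hi : p.writesNatReg i = false)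
    (hn : ∀ σ', Agree (forNat i e p) σ σ' → e.eval σ' = n)
    (h0 : I 0 (σ.setNat i 0))
    (hstep : ∀ k < n, ∀ σ', I k σ' → Agree (forNat i e p) σ σ' → σ'.natReg i = k →
      Spec p σ' (fun σ'' => I (k + 1) (σ''.setNat i (k + 1))) (K k)) :
    Spec (forNat i e p) σ (fun σ' => I n σ' ∧ σ'.natReg i = n)
      (∑ k ∈ Finset.range n, (K k + (RealRAM.forNat i e p).size)
        + (RealRAM.forNat i e p).size) := by
  have hw : Agree (RealRAM.forNat i e p) σ (σ.setNat i 0) :=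
    (Exec.setNat σ i 0).agree.mono (.seq_left _ _)
  refine (Spec.seq (R := fun σ' => σ' = σ.setNat i 0) (Spec.setNat (by simp))
    (fun σ' hσ' _ => ?_) (Q := fun σ' => I n σ' ∧ σ'.natReg i = n)
    (U := ∑ k ∈ Finset.range n, ((K k + (Cmd.setNat i (.reg i + 1)).size)
      + (BExp.not (.natLe e (.reg i))).cost + 1) + ((BExp.not (.natLe e (.reg i))).cost + 1))).mono
      ?_
  · subst hσ'
    refine Spec.whileLoop n (fun k σ' => I k σ' ∧ σ'.natReg i = k) _ ⟨h0, by simp⟩ ?_ ?_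
    · rintro k hk σ' ⟨hI, hik⟩ hA
      have hA' := hw.trans (hA.mono (.seq_right _ _))
      refine ⟨?_, ?_⟩
      · have := hn σ' hA'
        simp [BExp.Holds, this, hik, hk]
      · refine Spec.seq (hstep k hk σ' hI hA' hik) fun σ'' hI' hAp => Spec.setNat ?_
        have : σ''.natReg i = k := by rw [hAp.natReg i hi, hik]
        simpa [this] using hI'
    · rintro σ' ⟨_, hik⟩ hA
      have := hn σ' (hw.trans (hA.mono (.seq_right _ _)))
      simp [BExp.Holds, this, hik]
  · have h1 : ∀ k, K k + (Cmd.setNat i (.reg i + 1)).size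
        + (BExp.not (.natLe e (.reg i))).cost + 1 ≤ K k + (RealRAM.forNat i e p).size := by
      intro k; simp only [RealRAM.forNat, Cmd.size]; omega
    have h2 : (Cmd.setNat i 0).size + ((BExp.not (.natLe e (.reg i))).cost + 1)
        ≤ (RealRAM.forNat i e p).size := by
      simp only [RealRAM.forNat, Cmd.size]; omega
    have := Finset.sum_le_sum (fun k (_ : k ∈ Finset.range n) => h1 k)
    omega

/-- A loop that computes a real number by recursion. -/
def recLoop (acc i : ℕ) (e : NExp) (init ex : RExp) : Cmd :=
  .seq (.setReal acc init) (forNat i e (.setReal acc ex))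

theorem Spec.recLoop {acc i : ℕ} {e : NExp} {init ex : RExp} {σ : State} (n : ℕ) (v : ℕ → ℝ)
    (h0 : init.eval σ = v 0)
    (h : ∀ σ', Agree (recLoop acc i e init ex) σ σ' → e.eval σ' = n ∧
      ∀ k < n, σ'.natReg i = k → σ'.realReg acc = v k → ex.eval σ' = v (k + 1)) :
    Spec (recLoop acc i e init ex) σ (fun σ' => σ'.realReg acc = v n)
      ((n + 1) * (2 * (RealRAM.recLoop acc i e init ex).size)) := by
  refine (Spec.seq (R := fun σ' => σ' = σ.setReal acc (v 0)) (Spec.setReal (by simp [h0]))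
    fun σ' hσ' hA => Spec.conseq (Spec.forNat n (fun k σ' => σ'.realReg acc = v k)
      (fun _ => (Cmd.setReal acc ex).size) rfl ?_ ?_ ?_) le_rfl fun _ h _ => h.1).mono ?_
  · intro σ'' hA'
    exact (h σ'' ((hA.mono (.seq_left _ _)).trans (hA'.mono (.seq_right _ _)))).1
  · simp [hσ']
  · intro k hk σ'' hI hA' hik
    have := (h σ'' ((hA.mono (.seq_left _ _)).trans (hA'.mono (.seq_right _ _)))).2 k hk hik hI
    exact Spec.setReal (by simp [this])
  · simp only [Finset.sum_const, Finset.card_range, smul_eq_mul, RealRAM.recLoop, Cmd.size,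
      RealRAM.forNat]
    ring_nf
    nlinarith

/-- A loop that fills cells of a real array; `pre` prepares the computation of each entry. -/
def mapLoop (i : ℕ) (e : NExp) (pre : Cmd) (a : ℕ) (idx : NExp) (ex : RExp) : Cmd :=
  forNat i e (.seq pre (.storeReal a idx ex))

/-- Addresses may repeat as long as the values agree: `gatherCmd` can meet the same y several times.
The second conjunct is the frame inside the array `a`, which `Agree` cannot see. -/
theorem Spec.mapLoop {i : ℕ} {e : NExp} {pre : Cmd} {a : ℕ} {idx : NExp} {ex : RExp} {σ : State}
    (n : ℕ) (adr : ℕ → ℕ) (v : ℕ → ℝ) (K : ℕ)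
    (hi : pre.writesNatReg i = false) (ha : pre.writesRealArr a = false)
    (hadr : ∀ k < n, ∀ k' < n, adr k = adr k' → v k = v k')
    (hn : ∀ σ', Agree (mapLoop i e pre a idx ex) σ σ' → e.eval σ' = n)
    (h : ∀ k < n, ∀ σ', Agree (mapLoop i e pre a idx ex) σ σ' → σ'.natReg i = k →
      (∀ k' < k, σ'.realArr a (adr k') = v k') →
      (∀ c, (∀ k' < n, adr k' ≠ c) → σ'.realArr a c = σ.realArr a c) →
      Spec pre σ' (fun σ'' => idx.eval σ'' = adr k ∧ ex.eval σ'' = v k) K) :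
    Spec (mapLoop i e pre a idx ex) σ
      (fun σ' => (∀ k < n, σ'.realArr a (adr k) = v k) ∧
        ∀ c, (∀ k < n, adr k ≠ c) → σ'.realArr a c = σ.realArr a c)
      ((n + 1) * (K + 2 * (RealRAM.mapLoop i e pre a idx ex).size)) := by
  refine (Spec.conseq (Spec.forNat n (fun j σ' => (∀ k < j, σ'.realArr a (adr k) = v k) ∧
        ∀ c, (∀ k < n, adr k ≠ c) → σ'.realArr a c = σ.realArr a c)
      (fun _ => K + (Cmd.storeReal a idx ex).size) (by simp [Cmd.writesNatReg, hi]) hn ?_ ?_)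
      le_rfl fun _ h _ => h.1).mono ?_
  · simp
  · rintro k hk σ' ⟨hI, hI'⟩ hA hik
    refine Spec.seq (h k hk σ' hA hik hI hI') fun σ'' hσ'' hA' => Spec.storeReal ?_
    rw [hσ''.1, hσ''.2]
    have hr := hA'.realArr a ha
    constructor
    · intro k' hk'
      by_cases hkk : adr k' = adr k
      · simp [hkk, hadr k' (by omega) k hk hkk]
      · have : k' < k := by
          rcases Nat.lt_succ_iff_lt_or_eq.mp hk' with h | h
          · exact h
          · exact absurd (by rw [h]) hkk
        simp [hkk, hr, hI k' this]
    · intro c hc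
      simp [Ne.symm (hc k hk), hr, hI' c hc]
  · simp only [Finset.sum_const, Finset.card_range, smul_eq_mul, RealRAM.mapLoop, Cmd.size,
      RealRAM.forNat]
    ring_nf
    nlinarith

/-- A loop that fills the cells `off, off + 1, …` of an array of natural numbers by recursion. -/
def natLoop (i : ℕ) (e : NExp) (a : ℕ) (idx ex : NExp) : Cmd :=
  forNat i e (.storeNat a idx ex)

theorem Spec.natLoop {i : ℕ} {e : NExp} {a : ℕ} {idx ex : NExp} {σ : State}
    (n : ℕ) (v : ℕ → ℕ) (hv : σ.natArr a 0 = v 0)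
    (h : ∀ σ', Agree (natLoop i e a idx ex) σ σ' → e.eval σ' = n ∧
      ∀ k < n, σ'.natReg i = k → σ'.natArr a k = v k →
      idx.eval σ' = k + 1 ∧ ex.eval σ' = v (k + 1)) :
    Spec (natLoop i e a idx ex) σ (fun σ' => ∀ k ≤ n, σ'.natArr a k = v k)
      ((n + 1) * (2 * (RealRAM.natLoop i e a idx ex).size)) := by
  refine (Spec.conseq (Spec.forNat n (fun j σ' => ∀ k ≤ j, σ'.natArr a k = v k)
      (fun _ => (Cmd.storeNat a idx ex).size) rfl (fun σ' hA => (h σ' hA).1) ?_ ?_)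
      le_rfl fun _ h _ => h.1).mono ?_
  · simpa using hv
  · intro k hk σ' hI hA hik
    obtain ⟨h1, h2⟩ := (h σ' hA).2 k hk hik (hI k le_rfl)
    refine Spec.storeNat fun k' hk' => ?_
    rw [h1, h2]
    by_cases hkk : k' = k + 1
    · simp [hkk]
    · simp [hkk, hI k' (by omega)]
  · simp only [Finset.sum_const, Finset.card_range, smul_eq_mul, RealRAM.natLoop, Cmd.size,
      RealRAM.forNat]
    ring_nf
    nlinarith

/-- The complex number whose parts are in cell `k` of the real arrays `x` and `x + 1`. -/
def State.cx (σ : State) (x k : ℕ) : ℂ := ⟨σ.realArr x k, σ.realArr (x + 1) k⟩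

/-- A loop that fills the cells `off, off + 1, …` of a complex array. -/
def cmapLoop (i : ℕ) (e : NExp) (x : ℕ) (idx : NExp) (re im : RExp) : Cmd :=
  forNat i e (.seq (.storeReal x idx re) (.storeReal (x + 1) idx im))

theorem Cmd.cmapLoop_writesRealArr {i : ℕ} {e : NExp} {x : ℕ} {idx : NExp} {re im : RExp} {a : ℕ}
    (h : a < x) : (cmapLoop i e x idx re im).writesRealArr a = false := by
  simp only [cmapLoop, forNat_writesRealArr, writesRealArr, Bool.or_eq_false_iff]
  exact ⟨beq_eq_false (by omega), beq_eq_false (by omega)⟩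

theorem Spec.cmapLoop {i : ℕ} {e : NExp} {x : ℕ} {idx : NExp} {re im : RExp} {σ : State}
    (n off : ℕ) (v : ℕ → ℂ)
    (h : ∀ σ', Agree (cmapLoop i e x idx re im) σ σ' → e.eval σ' = n ∧
      ∀ k < n, σ'.natReg i = k →
      (∀ k' < k, σ'.cx x (off + k') = v k') →
      (∀ c < off, σ'.cx x c = σ.cx x c) →
      idx.eval σ' = off + k ∧ re.eval σ' = (v k).re ∧ im.eval σ' = (v k).im) :
    Spec (cmapLoop i e x idx re im) σ
      (fun σ' => (∀ k < n, σ'.cx x (off + k) = v k) ∧ ∀ c < off, σ'.cx x c = σ.cx x c)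
      ((n + 1) * (2 * (RealRAM.cmapLoop i e x idx re im).size)) := by
  refine (Spec.conseq (Spec.forNat n (fun j σ' => (∀ k < j, σ'.cx x (off + k) = v k) ∧
        ∀ c < off, σ'.cx x c = σ.cx x c)
      (fun _ => (Cmd.storeReal x idx re).size + (Cmd.storeReal (x + 1) idx im).size) rfl
      (fun σ' hA => (h σ' hA).1) ?_ ?_) le_rfl fun _ h _ => h.1).mono ?_
  · simp [State.cx]
  · rintro k hk σ' ⟨hI, hI'⟩ hA hik
    obtain ⟨h1, h2, h3⟩ := (h σ' hA).2 k hk hik hI hI'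
    refine Spec.seq (R := fun σ'' => σ'' = σ'.storeReal x (off + k) (v k).re)
      (Spec.storeReal (by rw [h1, h2])) fun σ'' hσ'' hA' => Spec.storeReal ?_
    have hcx : ∀ c, c ≠ off + k → σ''.cx x c = σ'.cx x c := by
      intro c hc; simp [hσ'', State.cx, hc]
    -- The imaginary part is evaluated after the real part has been stored. Only cell `off + k` has
    -- changed, and the hypothesis speaks of smaller cells, so it applies once more.
    obtain ⟨h4, -, h5⟩ := (h σ'' (hA.trans
        (hA'.mono ((Cmd.WritesLe.seq_left _ _).trans (.forNat_body _ _ _))))).2 k hk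
      (by simp [hσ'', hik])
      (fun k' hk' => by rw [hcx _ (by omega), hI k' hk'])
      (fun c hc => by rw [hcx _ (by omega), hI' c hc])
    rw [h4, h5]
    constructor
    · intro k' hk'
      by_cases hkk : k' = k
      · subst hkk
        apply Complex.ext <;> simp [State.cx, hσ'']
      · rw [← hI k' (by omega)]
        simp [State.cx, hσ'', hkk]
    · intro c hc
      have : c ≠ off + k := by omega
      rw [← hI' c hc]
      simp [State.cx, hσ'', this]
  · simp only [Finset.sum_const, Finset.card_range, smul_eq_mul, RealRAM.cmapLoop, Cmd.size,
      RealRAM.forNat]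
    ring_nf
    nlinarith

end RealRAM

open Finset

/-! ### Units modulo a prime power -/

section PrimePower

/-- The order of 1 + b² modulo b^(n+2) is exactly b^n. The square is there for b = 2: modulo 8 the
order of 1 + 2 is 2 and not 4. -/
theorem pow_one_add_sq_modEq_one {b : ℕ} (hb : b.Prime) (n d : ℕ) :
    (1 + b ^ 2) ^ (b ^ n * d) ≡ 1 [MOD b ^ (n + 2)] := by
  rw [← ZMod.natCast_eq_natCast_iff]
  have h := ZMod.orderOf_one_add_mul_prime_pow hb 2 two_ne_zero
    (by have := hb.two_le; omega) 1
    (by intro h; exact hb.one_lt.ne' (by simpa using Int.eq_one_of_dvd_one (by positivity) h)) n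
  push_cast
  rw [pow_mul, ← h]
  have := pow_orderOf_eq_one (1 + (b : ZMod (b ^ (n + 2))) ^ 2 * ((1 : ℤ) : ZMod (b ^ (n + 2))))
  simp only [Int.cast_one, mul_one] at this ⊢
  rw [this, one_pow]

theorem pow_one_add_sq_inj {b : ℕ} (hb : b.Prime) {n a a' : ℕ} (ha : a < b ^ n) (ha' : a' < b ^ n)
    (h : (1 + b ^ 2) ^ a ≡ (1 + b ^ 2) ^ a' [MOD b ^ (n + 2)]) : a = a' := by
  have ho := ZMod.orderOf_one_add_mul_prime_pow hb 2 two_ne_zero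
    (by have := hb.two_le; omega) 1
    (by intro h; exact hb.one_lt.ne' (by simpa using Int.eq_one_of_dvd_one (by positivity) h)) n
  rw [← ZMod.natCast_eq_natCast_iff] at h
  push_cast at h
  simp only [Int.cast_one, mul_one] at ho
  refine pow_injOn_Iio_orderOf ?_ ?_ h <;> simpa [ho]

theorem one_add_sq_pow_mod (b a : ℕ) : (1 + b ^ 2) ^ a ≡ 1 [MOD b ^ 2] := by
  have : 1 + b ^ 2 ≡ 1 [MOD b ^ 2] := by simp [Nat.ModEq]
  simpa using this.pow a

/-- Every unit modulo `b ^ (n + 2)` is `c (1 + b²)^a` for unique `c < b²`, `a < b ^ n`. -/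
theorem sum_units_prime_pow {M : Type*} [AddCommMonoid M] {b : ℕ} (hb : b.Prime) (n : ℕ)
    (f : ℕ → M) :
    ∑ i ∈ (range (b ^ (n + 2))).filter (fun i => ¬ b ∣ i), f i =
      ∑ x ∈ (range (b ^ 2)).filter (fun c => ¬ b ∣ c) ×ˢ range (b ^ n),
        f ((x.1 * (1 + b ^ 2) ^ x.2) % b ^ (n + 2)) := by
  have hpos : 0 < b ^ (n + 2) := pow_pos hb.pos _
  have hcount : ∀ k, ((range (b ^ (k + 1))).filter (fun i => ¬ b ∣ i)).card = b ^ k * (b - 1) := by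
    intro k
    have := Nat.totient_prime_pow_succ hb k
    rw [Nat.totient_eq_card_coprime] at this
    rw [← this]
    congr 1
    ext i
    simp only [mem_filter, mem_range, and_congr_right_iff]
    intro _
    rw [Nat.coprime_pow_left_iff (Nat.succ_pos k), ← hb.coprime_iff_not_dvd]
  have hmaps : ∀ x ∈ (range (b ^ 2)).filter (fun c => ¬ b ∣ c) ×ˢ range (b ^ n),
      (x.1 * (1 + b ^ 2) ^ x.2) % b ^ (n + 2) ∈
        (range (b ^ (n + 2))).filter (fun i => ¬ b ∣ i) := by
    rintro ⟨c, a⟩ hx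
    simp only [mem_product, mem_filter, mem_range] at hx ⊢
    refine ⟨Nat.mod_lt _ hpos, ?_⟩
    rw [Nat.dvd_mod_iff (dvd_pow_self b (by omega))]
    intro hd
    rcases hb.dvd_mul.mp hd with h | h
    · exact hx.1.2 h
    · have h' := hb.dvd_of_dvd_pow h
      have := (Nat.dvd_add_left (dvd_pow_self b two_ne_zero)).mp h'
      exact hb.one_lt.ne' (Nat.dvd_one.mp this)
  -- Reduction modulo b² kills the power and determines c; after cancelling the unit c, the order of
  -- 1 + b² determines a.
  have hinj : Set.InjOn (fun x : ℕ × ℕ => (x.1 * (1 + b ^ 2) ^ x.2) % b ^ (n + 2))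
      ((range (b ^ 2)).filter (fun c => ¬ b ∣ c) ×ˢ range (b ^ n) : Finset (ℕ × ℕ)) := by
    rintro ⟨c, a⟩ hx ⟨c', a'⟩ hx' h
    simp only [coe_product, Set.mem_prod, mem_coe, mem_filter, mem_range] at hx hx'
    change c * (1 + b ^ 2) ^ a ≡ c' * (1 + b ^ 2) ^ a' [MOD b ^ (n + 2)] at h
    have h2 : c ≡ c' [MOD b ^ 2] := by
      have h2 := h.of_dvd (pow_dvd_pow b (by omega : 2 ≤ n + 2))
      have h3 := ((one_add_sq_pow_mod b a).mul_left c).symm.trans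
        (h2.trans ((one_add_sq_pow_mod b a').mul_left c'))
      simpa using h3
    obtain rfl : c = c' := Nat.ModEq.eq_of_lt_of_lt h2 hx.1.1 hx'.1.1
    have hc : Nat.gcd (b ^ (n + 2)) c = 1 :=
      Nat.Coprime.pow_left _ ((hb.coprime_iff_not_dvd).mpr hx.1.2)
    obtain rfl := pow_one_add_sq_inj hb hx.2 hx'.2 (h.cancel_left_of_coprime hc)
    rfl
  -- Surjectivity by counting: both sets have b^(n+1) (b - 1) elements.
  have himg : ((range (b ^ 2)).filter (fun c => ¬ b ∣ c) ×ˢ range (b ^ n)).image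
      (fun x : ℕ × ℕ => (x.1 * (1 + b ^ 2) ^ x.2) % b ^ (n + 2)) =
        (range (b ^ (n + 2))).filter (fun i => ¬ b ∣ i) := by
    apply Finset.eq_of_subset_of_card_le
    · intro i hi
      obtain ⟨x, hx, rfl⟩ := mem_image.mp hi
      exact hmaps x hx
    · rw [card_image_of_injOn hinj, card_product, hcount (n + 1), hcount 1, card_range]
      apply le_of_eq; ring
  rw [← himg, sum_image hinj]

/-- Every unit modulo `b ^ k`, `k ≥ 1`, is `c (1 + b²)^a` for some `c < b²`, `a < b ^ (k - 2)`. -/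
theorem exists_eq_mul_pow_mod {b : ℕ} (hb : b.Prime) {k : ℕ} (hk : 1 ≤ k) {y : ℕ} (hy : y < b ^ k)
    (hby : ¬ b ∣ y) : ∃ c < b ^ 2, ∃ a < b ^ (k - 2), y = (c * (1 + b ^ 2) ^ a) % b ^ k := by
  obtain rfl | ⟨n, rfl⟩ : k = 1 ∨ ∃ n, k = n + 2 := by
    rcases Nat.lt_or_ge k 2 with h | h
    · left; omega
    · right; exact ⟨k - 2, by omega⟩
  · refine ⟨y, hy.trans_le (Nat.pow_le_pow_right hb.pos (by omega)), 0, by simp, ?_⟩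
    simp only [pow_zero, mul_one]
    exact (Nat.mod_eq_of_lt hy).symm
  · by_contra! hcon
    -- Summing the indicator of y gives 1 over the units, but 0 over the pairs (c, a) if y is not
    -- represented.
    have h := sum_units_prime_pow hb n (fun i => if i = y then 1 else 0)
    rw [Finset.sum_ite_eq' _ y, if_pos (by simp [hy, hby])] at h
    rw [Finset.sum_eq_zero] at h
    · exact one_ne_zero h
    · rintro ⟨c, a⟩ hx
      simp only [mem_product, mem_filter, mem_range] at hx
      exact if_neg (Ne.symm (hcon c hx.1.1 a (by simpa using hx.2)))

theorem sum_range_mul_add {M : Type*} [AddCommMonoid M] (f : ℕ → M) (m n : ℕ) :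
    ∑ i ∈ range (m * n), f i = ∑ c ∈ range m, ∑ i ∈ range n, f (c * n + i) := by
  induction m with
  | zero => simp
  | succ m ih => rw [Nat.succ_mul, sum_range_add, ih, sum_range_succ]

/-- The sum over the residues modulo `b ^ k`, arranged by the power of `b` they contain. -/
theorem sum_range_prime_pow {b : ℕ} (hb : b.Prime) (k : ℕ) (f : ℕ → ℝ) :
    ∑ i ∈ range (b ^ (k + 1)), f i = ∑ t ∈ range b, f (t * b ^ k) +
      ∑ j ∈ range k, ∑ c ∈ range (b ^ 2), ((1 - (1 - c % b) : ℕ) : ℝ) *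
        ∑ a ∈ range (b ^ (k - 1 - j)), f ((b ^ j * c * (1 + b ^ 2) ^ a) % b ^ (k + 1)) := by
  induction k generalizing f with
  | zero => simp
  | succ n ih =>
    have hsplit : ∑ i ∈ range (b ^ (n + 2)), f i = ∑ i ∈ range (b ^ (n + 1)), f (b * i) +
        ∑ i ∈ (range (b ^ (n + 2))).filter (fun i => ¬ b ∣ i), f i := by
      rw [← sum_filter_add_sum_filter_not (range (b ^ (n + 2))) (fun i => b ∣ i)]
      congr 1
      symm
      refine sum_nbij (fun i => b * i) ?_ ?_ ?_ fun _ _ => rfl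
      · intro i hi
        simp only [mem_range, mem_filter, dvd_mul_right, and_true] at hi ⊢
        calc b * i < b * b ^ (n + 1) := Nat.mul_lt_mul_of_pos_left hi hb.pos
          _ = b ^ (n + 2) := by ring
      · intro i _ i' _ h
        exact Nat.eq_of_mul_eq_mul_left hb.pos h
      · rintro _ hi
        simp only [coe_filter, mem_range, Set.mem_ofPred_eq] at hi
        obtain ⟨hi, i, rfl⟩ := hi
        refine ⟨i, ?_, rfl⟩
        simp only [coe_range, Set.mem_Iio]
        have : b * i < b * b ^ (n + 1) := by rw [← pow_succ']; exact hi
        exact Nat.lt_of_mul_lt_mul_left this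
    -- The multiples of b fall under the induction hypothesis for f(b·), whose level j becomes level
    -- j + 1; the non-multiples form level 0.
    rw [show n + 1 + 1 = n + 2 from rfl, hsplit, ih (fun i => f (b * i)), sum_range_succ' _ n,
      sum_units_prime_pow hb n f, add_assoc]
    congr 1
    · exact sum_congr rfl fun t _ => by ring_nf
    congr 1
    · refine sum_congr rfl fun j _ => sum_congr rfl fun c _ => ?_
      rw [show n + 1 - 1 - (j + 1) = n - 1 - j by omega]
      refine congrArg _ (sum_congr rfl fun a _ => ?_)
      rw [← Nat.mul_mod_mul_left]
      ring_nf
    · rw [sum_product, sum_filter]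
      refine sum_congr rfl fun c _ => ?_
      by_cases h : b ∣ c
      · have : c % b = 0 := Nat.mod_eq_zero_of_dvd h
        simp [h, this]
      · have : 1 ≤ c % b := Nat.one_le_iff_ne_zero.mpr fun h0 => h (Nat.dvd_of_mod_eq_zero h0)
        -- With truncated subtraction this weight is the indicator of b ∤ c, in a form that the
        -- machine can evaluate.
        rw [show 1 - (1 - c % b) = 1 by omega]
        simp [h]

end PrimePower

/-! ### Values of `φ_α` -/

namespace ReducedCBC

/-- This is the Fourier expansion of the Bernoulli polynomial. Evenness gives |h|^α = h^α and makes
(2πi)^α the real number (-4π²)^(α/2). -/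
theorem phi_eq_bernoulliFun {α : ℕ} (h0 : 0 < α) (hα : Even α) {x : ℝ} (hx : x ∈ Set.Icc (0 : ℝ) 1) :
    phi α x = -(-(4 * Real.pi ^ 2)) ^ (α / 2) / (α.factorial : ℝ) * bernoulliFun α x := by
  obtain ⟨k, rfl⟩ := hα
  have h := hasSum_one_div_pow_mul_fourier_mul_bernoulliFun (k := k + k) (by omega) hx
  have hfun : ∀ n : ℤ, 1 / (n : ℂ) ^ (k + k) * fourier n (x : UnitAddCircle) =
      Complex.exp (2 * Real.pi * Complex.I * (n : ℂ) * (x : ℂ)) / ((|n| : ℤ) : ℂ) ^ (k + k) := by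
    intro n
    rw [fourier_coe_apply]
    have : ((|n| : ℤ) : ℂ) ^ (k + k) = (n : ℂ) ^ (k + k) := by
      have : (|n| : ℤ) ^ (k + k) = n ^ (k + k) := Even.pow_abs ⟨k, rfl⟩ n
      exact_mod_cast this
    rw [this]
    simp
    ring
  have hs : HasSum (fun h : {h : ℤ // h ≠ 0} =>
      Complex.exp (2 * Real.pi * Complex.I * (h.1 : ℂ) * (x : ℂ)) / ((|h.1| : ℤ) : ℂ) ^ (k + k))
      (-(2 * Real.pi * Complex.I) ^ (k + k) / (k + k).factorial * bernoulliFun (k + k) x) := by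
    simp only [hfun] at h
    -- The series over all integers has the term 1/0^α at h = 0, which is 0 by convention.
    refine (hasSum_subtype_iff_of_support_subset (s := {h : ℤ | h ≠ 0}) ?_).mpr h
    intro n hn
    by_contra hn0
    apply hn
    obtain rfl : n = 0 := not_not.mp hn0
    simp
    omega
  rw [phi, hs.tsum_eq]
  have : (-(2 * Real.pi * Complex.I) ^ (k + k) / (k + k).factorial * bernoulliFun (k + k) x : ℂ) =
      ((-(-(4 * Real.pi ^ 2)) ^ ((k + k) / 2) / ((k + k).factorial : ℝ) *
        bernoulliFun (k + k) x : ℝ) : ℂ) := by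
    push_cast
    rw [show (k + k) / 2 = k by omega, ← two_mul, pow_mul]
    congr 3
    congr 1
    rw [mul_pow, mul_pow, Complex.I_sq]
    ring
  rw [this, Complex.ofReal_re]

/-- `B_i / i!` -/
noncomputable def bernoulliCoeff (i : ℕ) : ℝ := (bernoulli i : ℝ) / (i.factorial : ℝ)

/-- The usual recursion for the Bernoulli numbers divided by (n + 1)!. The truncated 1 - n is 1 for
n = 0 and 0 otherwise. -/
theorem bernoulliCoeff_rec (n : ℕ) :
    bernoulliCoeff n = ((1 - n : ℕ) : ℝ) -
      ∑ k ∈ range n, bernoulliCoeff k * (1 / ((n + 1 - k).factorial : ℝ)) := by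
  have h := congrArg (fun q : ℚ => (q : ℝ)) (sum_bernoulli (n + 1))
  simp only [Rat.cast_sum, Rat.cast_mul, Rat.cast_natCast] at h
  have hterm : ∀ k ∈ range (n + 1), (((n + 1).choose k : ℕ) : ℝ) * (bernoulli k : ℝ) =
      ((n + 1).factorial : ℝ) * (bernoulliCoeff k * (1 / ((n + 1 - k).factorial : ℝ))) := by
    intro k hk
    have hk' : k ≤ n + 1 := by have := mem_range.mp hk; omega
    rw [Nat.cast_choose ℝ hk', bernoulliCoeff]
    have := Nat.factorial_ne_zero k
    have := Nat.factorial_ne_zero (n + 1 - k)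
    field_simp
  rw [sum_congr rfl hterm, ← mul_sum, sum_range_succ, show n + 1 - n = 1 by omega] at h
  have hf : ((n + 1).factorial : ℝ) ≠ 0 := by positivity
  rcases Nat.eq_zero_or_pos n with rfl | hn
  · simpa using h
  · rw [show 1 - n = 0 by omega]
    rw [if_neg (by omega)] at h
    simp only [Nat.factorial_one, Nat.cast_one, div_one, mul_one, Rat.cast_zero,
      mul_eq_zero, hf, false_or] at h
    push_cast
    linarith

/-- Division by α! cancels the numerator of the binomial coefficients, so each coefficient is a
product of entries of the two tables B_i/i! and 1/i!. -/
theorem bernoulliFun_div_factorial (α : ℕ) (x : ℝ) :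
    bernoulliFun α x / (α.factorial : ℝ) = ∑ i ∈ range (α + 1),
      bernoulliCoeff i * (1 / ((α - i).factorial : ℝ)) * x ^ (α - i) := by
  rw [bernoulliFun, Polynomial.bernoulli, Polynomial.map_sum, Polynomial.eval_finsetSum, sum_div]
  refine sum_congr rfl fun i hi => ?_
  have hi' : i ≤ α := by have := mem_range.mp hi; omega
  rw [Polynomial.map_monomial, Polynomial.eval_monomial, bernoulliCoeff]
  simp only [eq_ratCast, Rat.cast_mul, Rat.cast_natCast]
  rw [Nat.cast_choose ℝ hi']
  have := Nat.factorial_ne_zero i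
  have := Nat.factorial_ne_zero (α - i)
  have := Nat.factorial_ne_zero α
  field_simp

/-! ### Folding and the reduction of `T_d` to correlations -/

/-- The periodic extension of the table of `φ_α`. -/
noncomputable def phiTab (N α i : ℕ) : ℝ := phi α (((i % N : ℕ) : ℝ) / (N : ℝ))

theorem phiTab_congr {N α i j : ℕ} (h : i ≡ j [MOD N]) : phiTab N α i = phiTab N α j := by
  rw [phiTab, phiTab, h]

theorem phiAt_eq_phiTab (b m α w z n : ℕ) :
    phiAt b m α w z n = phiTab (b ^ m) α (n * b ^ w * z) := by
  rw [phiAt, phiTab, Int.fract_div_natCast_eq_div_natCast_mod]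

/-- Folding: `T_d(y)` in terms of the sum of the blocks of `η_{d-1}`. -/
theorem T_eq_sum_folded (b m α : ℕ) (w : ℕ → ℕ) (γ : ℕ → ℝ) (z : ℕ → ℕ) (d y : ℕ)
    (hw : w d ≤ m) :
    T b m α w γ z d y = ∑ i ∈ range (b ^ (m - w d)),
      phiTab (b ^ m) α (b ^ w d * i * y) * foldedEta b m α w γ z d i := by
  have hN : b ^ w d * b ^ (m - w d) = b ^ m := by rw [← pow_add]; congr 1; omega
  rw [T, ← hN, sum_range_mul_add, sum_comm]
  refine sum_congr rfl fun i _ => ?_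
  rw [foldedEta, mul_sum, hN]
  refine sum_congr rfl fun c _ => ?_
  rw [phiAt_eq_phiTab]
  congr 1
  -- The index c b^(m-w_d) + i is multiplied by b^(w_d), so the block number c contributes a
  -- multiple of b^m.
  apply phiTab_congr
  rw [show (c * b ^ (m - w d) + i) * b ^ w d * y =
    b ^ m * (c * y) + b ^ w d * i * y by rw [← hN]; ring]
  simp [Nat.ModEq]

/-- This and the next two lemmas transfer results to the memory in which a further component of z
has been stored. -/
theorem eta_congr {b m α : ℕ} {w : ℕ → ℕ} {γ : ℕ → ℝ} {z z' : ℕ → ℕ} {d : ℕ}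
    (h : ∀ j, 1 ≤ j → j ≤ d → z j = z' j) (n : ℕ) :
    eta b m α w γ z d n = eta b m α w γ z' d n := by
  refine prod_congr rfl fun j hj => ?_
  rw [h j (mem_Icc.mp hj).1 (mem_Icc.mp hj).2]

theorem foldedEta_congr {b m α : ℕ} {w : ℕ → ℕ} {γ : ℕ → ℝ} {z z' : ℕ → ℕ} {d : ℕ}
    (h : ∀ j, 1 ≤ j → j < d → z j = z' j) (i : ℕ) :
    foldedEta b m α w γ z d i = foldedEta b m α w γ z' d i :=
  sum_congr rfl fun _ _ => eta_congr (fun j h1 h2 => h j h1 (by omega)) _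

theorem T_congr {b m α : ℕ} {w : ℕ → ℕ} {γ : ℕ → ℝ} {z z' : ℕ → ℕ} {d : ℕ}
    (h : ∀ j, 1 ≤ j → j < d → z j = z' j) (y : ℕ) :
    T b m α w γ z d y = T b m α w γ z' d y :=
  sum_congr rfl fun _ _ => by rw [eta_congr (fun j h1 h2 => h j h1 (by omega))]

theorem eta_succ (b m α : ℕ) (w : ℕ → ℕ) (γ : ℕ → ℝ) (z : ℕ → ℕ) (d n : ℕ) :
    eta b m α w γ z (d + 1) n = eta b m α w γ z d n *
      (1 + γ (d + 1) * phiTab (b ^ m) α (n * b ^ w (d + 1) * z (d + 1))) := by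
  rw [eta, eta, prod_Icc_succ_top (by omega), phiAt_eq_phiTab]

theorem mem_searchSet {b m w y : ℕ} (hb : b.Prime) (hm : m ≠ 0) :
    y ∈ searchSet b m w ↔ y < b ^ (m - w) ∧ ¬ b ∣ y := by
  have hpos : 0 < b ^ (m - w) := pow_pos hb.pos _
  rw [searchSet, mem_filter, mem_Icc]
  have : Nat.gcd y (b ^ m) = 1 ↔ ¬ b ∣ y := by
    rw [← hb.coprime_iff_not_dvd]
    exact (Nat.coprime_pow_right_iff (Nat.pos_of_ne_zero hm) _ _).trans (Nat.coprime_comm)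
  rw [this]
  constructor
  · rintro ⟨⟨_, h⟩, h'⟩; exact ⟨by omega, h'⟩
  · rintro ⟨h, h'⟩
    have : y ≠ 0 := by rintro rfl; exact h' (dvd_zero b)
    exact ⟨⟨by omega, by omega⟩, h'⟩

/-- `T_d` at `y = c' (1 + b²)^a'`, as a sum of correlations over the group generated by
`1 + b²`. -/
theorem T_eq_sum_correlations {b m α : ℕ} (hb : b.Prime) {w : ℕ → ℕ} {γ : ℕ → ℝ} {z : ℕ → ℕ}
    {d k : ℕ} (hk : m - w d = k + 1) (c' a' : ℕ) :
    T b m α w γ z d ((c' * (1 + b ^ 2) ^ a') % b ^ (k + 1)) =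
      ∑ t ∈ range b, phiTab (b ^ m) α (b ^ w d * (t * b ^ k) *
          ((c' * (1 + b ^ 2) ^ a') % b ^ (k + 1))) * foldedEta b m α w γ z d (t * b ^ k) +
      ∑ j ∈ range k, ∑ c ∈ range (b ^ 2), ((1 - (1 - c % b) : ℕ) : ℝ) *
        ∑ a ∈ range (b ^ (k - 1 - j)),
          phiTab (b ^ m) α (b ^ w d * b ^ j * c * c' *
            (1 + b ^ 2) ^ (a + a' % b ^ (k - 1 - j))) *
          foldedEta b m α w γ z d ((b ^ j * c * (1 + b ^ 2) ^ a) % b ^ (k + 1)) := by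
  rw [T_eq_sum_folded _ _ _ _ _ _ _ _ (by omega), hk, sum_range_prime_pow hb]
  congr 1
  refine sum_congr rfl fun j hj => sum_congr rfl fun c _ => ?_
  have hj' := mem_range.mp hj
  refine congrArg _ (sum_congr rfl fun a _ => ?_)
  congr 1
  apply phiTab_congr
  have hN : b ^ m = b ^ w d * b ^ (k + 1) := by rw [← pow_add]; congr 1; omega
  rw [hN, mul_assoc (b ^ w d), mul_assoc (b ^ w d), mul_assoc (b ^ w d), mul_assoc (b ^ w d)]
  apply Nat.ModEq.mul_left'
  have hj2 : b ^ (k + 1) = b ^ j * b ^ (k - 1 - j + 2) := by rw [← pow_add]; congr 1; omega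
  have h1 : (b ^ j * c * (1 + b ^ 2) ^ a) % b ^ (k + 1) *
      ((c' * (1 + b ^ 2) ^ a') % b ^ (k + 1)) ≡
      b ^ j * c * (1 + b ^ 2) ^ a * (c' * (1 + b ^ 2) ^ a') [MOD b ^ (k + 1)] :=
    (Nat.mod_modEq _ _).mul (Nat.mod_modEq _ _)
  refine h1.trans ?_
  rw [hj2]
  -- The factor b^j leaves the modulus b^(k-1-j+2), for which 1 + b² has order b^(k-1-j); so the
  -- shift a' may be reduced below the length of the correlation.
  have h2 : (1 + b ^ 2) ^ a' ≡ (1 + b ^ 2) ^ (a' % b ^ (k - 1 - j)) [MOD b ^ (k - 1 - j + 2)] := by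
    conv_lhs => rw [← Nat.mod_add_div a' (b ^ (k - 1 - j)), pow_add]
    simpa using (pow_one_add_sq_modEq_one hb (k - 1 - j) (a' / b ^ (k - 1 - j))).mul_left
      ((1 + b ^ 2) ^ (a' % b ^ (k - 1 - j)))
  have h3 := (h2.mul_left (c * c' * (1 + b ^ 2) ^ a)).mul_left' (b ^ j)
  convert h3 using 1 <;> ring

end ReducedCBC

/-! ### Discrete Fourier transform -/

section Fourier

/-- Entry `u` of the discrete Fourier transform of length `P`. -/
def dft (P : ℕ) (ω : ℂ) (x : ℕ → ℂ) (u : ℕ) : ℂ := ∑ q ∈ range P, x q * ω ^ (q * u)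

/-- The transforms of the subsequences of step `R`: entry `e = u R + r` with `r < R` belongs to
residue `r` and frequency `u`. -/
def dftRow (P R : ℕ) (ω : ℂ) (x : ℕ → ℂ) (e : ℕ) : ℂ :=
  ∑ q ∈ range (P / R), x (e % R + q * R) * ω ^ (q * (e - e % R))

theorem dftRow_self {P : ℕ} (ω : ℂ) (x : ℕ → ℂ) {e : ℕ} (he : e < P) : dftRow P P ω x e = x e := by
  simp [dftRow, Nat.div_self (by omega : 0 < P), Nat.mod_eq_of_lt he]

theorem dftRow_one (P : ℕ) (ω : ℂ) (x : ℕ → ℂ) (e : ℕ) : dftRow P 1 ω x e = dft P ω x e := by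
  simp [dftRow, dft, Nat.mod_one]

theorem pow_mod_of_pow_eq_one {P : ℕ} {ω : ℂ} (h : ω ^ P = 1) (n : ℕ) : ω ^ (n % P) = ω ^ n := by
  conv_rhs => rw [← Nat.mod_add_div n P, pow_add, pow_mul, h, one_pow, mul_one]

/-- The radix-2 step: even and odd q split the subsequence of residue r and step R into those of
residues r and r + R and step 2R. If e = uR + r, frequency u of the shorter transforms sits at 2uR
modulo P plus the residue. With this indexing no bit reversal occurs. -/
theorem dftRow_step {P R S : ℕ} {ω : ℂ} (x : ℕ → ℂ) {e : ℕ} (hR : 0 < R) (hP : P = S * 2 * R)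
    (hω : ω ^ P = 1) :
    dftRow P R ω x e = dftRow P (2 * R) ω x ((2 * (e - e % R)) % P + e % R) +
      ω ^ (e - e % R) * dftRow P (2 * R) ω x ((2 * (e - e % R)) % P + e % R + R) := by
  have hr : e % R < R := Nat.mod_lt _ hR
  have hE : (2 * R) ∣ (2 * (e - e % R)) % P := by
    rw [Nat.dvd_mod_iff ⟨S, by rw [hP]; ring⟩]
    exact Nat.mul_dvd_mul_left 2 (Nat.dvd_sub_mod e)
  set r := e % R
  set E := e - r
  obtain ⟨f, hf⟩ := hE
  have h1 : P / R = S * 2 := by rw [hP]; exact Nat.mul_div_cancel _ hR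
  have h2 : P / (2 * R) = S := by
    rw [hP, mul_assoc]; exact Nat.mul_div_cancel _ (by omega)
  have h3 : ((2 * E) % P + r) % (2 * R) = r := by
    rw [hf, Nat.mul_add_mod, Nat.mod_eq_of_lt (by omega)]
  have h4 : ((2 * E) % P + r + R) % (2 * R) = r + R := by
    rw [hf, add_assoc, Nat.mul_add_mod, Nat.mod_eq_of_lt (by omega)]
  have h5 : ∀ q, ω ^ (q * ((2 * E) % P)) = ω ^ (q * (2 * E)) := by
    intro q
    rw [mul_comm, pow_mul, pow_mod_of_pow_eq_one hω, ← pow_mul, mul_comm]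
  rw [dftRow, dftRow, dftRow]
  simp only [show e % R = r from rfl, show e - r = E from rfl]
  rw [h1, h2, h3, h4, sum_range_mul_add, mul_sum, ← sum_add_distrib]
  refine sum_congr rfl fun q _ => ?_
  rw [sum_range_succ, sum_range_one]
  rw [show (2 * E) % P + r - r = (2 * E) % P by omega,
    show (2 * E) % P + r + R - (r + R) = (2 * E) % P by omega, h5,
    show r + (q * 2 + 0) * R = r + q * (2 * R) by ring,
    show r + (q * 2 + 1) * R = r + R + q * (2 * R) by ring]
  ring_nf

theorem sum_pow_eq_ite {P : ℕ} {ω : ℂ} (hω : IsPrimitiveRoot ω P) (n : ℕ) :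
    ∑ u ∈ range P, (ω ^ n) ^ u = if P ∣ n then (P : ℂ) else 0 := by
  split_ifs with h
  · simp [(hω.pow_eq_one_iff_dvd n).mpr h]
  · have h1 : ω ^ n ≠ 1 := fun h' => h ((hω.pow_eq_one_iff_dvd n).mp h')
    rw [geom_sum_eq h1, ← pow_mul, mul_comm, pow_mul, hω.pow_eq_one, one_pow, sub_self, zero_div]

/-- Correlation by means of three transforms. -/
theorem dft_correlation {P L : ℕ} {ω : ℂ} (hω : IsPrimitiveRoot ω P) (hLP : 2 * L ≤ P)
    {F G : ℕ → ℂ} (hF : ∀ t, 2 * L ≤ t → F t = 0) (hG : ∀ a, L ≤ a → G a = 0) {a' : ℕ}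
    (ha' : a' < L) :
    dft P ω (fun u => dft P ω F u * dft P ω G ((P - u) % P)) ((P - a') % P) =
      P * ∑ a ∈ range L, F (a + a') * G a := by
  have hone := hω.pow_eq_one
  have hu : ∀ u ∈ range P, dft P ω F u * dft P ω G ((P - u) % P) * ω ^ (u * ((P - a') % P)) =
      ∑ t ∈ range P, ∑ a ∈ range P, F t * G a * (ω ^ (t + (P - a) + (P - a'))) ^ u := by
    intro u hu
    have hu' := mem_range.mp hu
    have h1 : ω ^ (u * ((P - a') % P)) = ω ^ ((P - a') * u) := by
      rw [mul_comm, pow_mul, pow_mod_of_pow_eq_one hone, ← pow_mul]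
    rw [dft, dft, sum_mul_sum, sum_mul, h1]
    refine sum_congr rfl fun t _ => ?_
    rw [sum_mul]
    refine sum_congr rfl fun a ha => ?_
    have ha' := mem_range.mp ha
    have h2 : ω ^ (a * ((P - u) % P)) = ω ^ ((P - a) * u) := by
      rw [mul_comm, pow_mul, pow_mod_of_pow_eq_one hone, ← pow_mul]
      -- Negative exponents are written as complements to P; the added multiples of P do not change
      -- powers of ω.
      have h3 : (P - u) * a + P * u = (P - a) * u + P * a := by
        zify [hu'.le, ha'.le]; ring
      calc ω ^ ((P - u) * a) = ω ^ ((P - u) * a + P * u) := by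
            rw [pow_add, pow_mul ω P, hone, one_pow, mul_one]
        _ = ω ^ ((P - a) * u) := by rw [h3, pow_add, pow_mul ω P, hone, one_pow, mul_one]
    rw [h2, ← pow_mul, add_mul, add_mul, pow_add, pow_add]
    ring
  rw [dft, sum_congr rfl hu, sum_comm, sum_congr rfl (fun t _ => sum_comm), sum_comm]
  simp_rw [← mul_sum, sum_pow_eq_ite hω]
  rw [mul_sum]
  have hsub : range L ⊆ range P := range_subset_range.mpr (by omega)
  rw [← sum_subset (M := ℂ) hsub]
  · refine sum_congr rfl fun a ha => ?_
    have ha := mem_range.mp ha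
    rw [sum_eq_single (a + a')]
    · rw [if_pos]
      · ring
      · exact ⟨2, by omega⟩
    · intro t ht hne
      have ht := mem_range.mp ht
      rcases Nat.lt_or_ge t (2 * L) with h | h
      · rw [if_neg, mul_zero]
        rintro ⟨c, hc⟩
        -- As t < 2L ≤ P and a, a' < L, the exponent t + (P - a) + (P - a') lies strictly between P
        -- and 3P. Its only possible multiple of P is 2P, which means t = a + a'.
        have hc1 : c = 2 := by
          have h1 : P * c < P * 3 := by omega
          have h2 : P * 1 < P * c := by omega
          have := Nat.lt_of_mul_lt_mul_left h1
          have := Nat.lt_of_mul_lt_mul_left h2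
          omega
        subst hc1
        omega
      · rw [hF t h]; ring
    · intro h
      exact absurd (mem_range.mpr (by omega)) h
  · intro a _ ha
    rw [hG a (by simpa using ha)]
    simp

/-! ### Roots of unity by repeated halving of the angle -/

/-- `exp (2πi / 2^l)` -/
noncomputable def rootOfUnity (l : ℕ) : ℂ := Complex.exp ((2 * Real.pi / 2 ^ l : ℝ) * Complex.I)

theorem rootOfUnity_isPrimitiveRoot (l : ℕ) : IsPrimitiveRoot (rootOfUnity l) (2 ^ l) := by
  have := Complex.isPrimitiveRoot_exp (2 ^ l) (by positivity)
  convert this using 1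
  rw [rootOfUnity]
  push_cast
  ring_nf

theorem rootOfUnity_one : rootOfUnity 1 = -1 := by
  rw [rootOfUnity, pow_one, mul_div_cancel_left₀ _ two_ne_zero, Complex.exp_pi_mul_I]

/-- Half-angle formula. For l ≥ 1 the angle is at most π, so the nonnegative square root is the
right one, here and for the imaginary part. -/
theorem rootOfUnity_re_succ {l : ℕ} (hl : 1 ≤ l) :
    (rootOfUnity (l + 1)).re = Real.sqrt ((1 + (rootOfUnity l).re) / 2) := by
  have h2 : (2 : ℝ) ≤ 2 ^ l := by simpa using pow_le_pow_right₀ (one_le_two (α := ℝ)) hl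
  have hpi := Real.pi_pos
  have : 2 * Real.pi / 2 ^ l ≤ Real.pi := by
    rw [div_le_iff₀ (by positivity)]; nlinarith
  have h0 : 0 ≤ 2 * Real.pi / 2 ^ l := by positivity
  rw [rootOfUnity, rootOfUnity, Complex.exp_ofReal_mul_I_re, Complex.exp_ofReal_mul_I_re,
    ← Real.cos_half (by linarith) this]
  congr 1; rw [pow_succ]; ring

theorem rootOfUnity_im_succ {l : ℕ} (hl : 1 ≤ l) :
    (rootOfUnity (l + 1)).im = Real.sqrt ((1 - (rootOfUnity l).re) / 2) := by
  have h2 : (2 : ℝ) ≤ 2 ^ l := by simpa using pow_le_pow_right₀ (one_le_two (α := ℝ)) hl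
  have hpi := Real.pi_pos
  have : 2 * Real.pi / 2 ^ l ≤ Real.pi := by
    rw [div_le_iff₀ (by positivity)]; nlinarith
  have h0 : 0 ≤ 2 * Real.pi / 2 ^ l := by positivity
  rw [rootOfUnity, rootOfUnity, Complex.exp_ofReal_mul_I_im, Complex.exp_ofReal_mul_I_re,
    ← Real.sin_half_eq_sqrt h0 (by linarith)]
  congr 1; rw [pow_succ]; ring

end Fourier

namespace RealRAM

/-! ### Fast correlation -/

/-- Finds the least `l ≥ 1` with `2 L ≤ 2^l` and computes `exp (2πi / 2^l)`. -/
def rootCmd : Cmd :=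
  .seq (.setNat 21 2) <| .seq (.setNat 22 1) <| .seq (.setReal 10 (0 - 1)) <|
  .seq (.setReal 11 0) <| .while (.not (.natLe (2 * .reg 20) (.reg 21))) <|
    .seq (.setReal 11 (.sqrt ((1 - .reg 10) / 2))) <|
    .seq (.setReal 10 (.sqrt ((1 + .reg 10) / 2))) <|
    .seq (.setNat 21 (.reg 21 * 2)) <| .setNat 22 (.reg 22 + 1)

theorem rootCmd_spec {σ : State} {L : ℕ} (hL : 1 ≤ L) (h20 : σ.natReg 20 = L) :
    Spec rootCmd σ (fun σ' => σ'.natReg 22 = Nat.clog 2 (2 * L) ∧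
      σ'.natReg 21 = 2 ^ Nat.clog 2 (2 * L) ∧
      σ'.realReg 10 = (rootOfUnity (Nat.clog 2 (2 * L))).re ∧
      σ'.realReg 11 = (rootOfUnity (Nat.clog 2 (2 * L))).im)
      ((Nat.clog 2 (2 * L) + 1) * (2 * rootCmd.size)) := by
  set l := Nat.clog 2 (2 * L) with hl
  have hl1 : 1 ≤ l := Nat.clog_pos one_lt_two (by omega)
  refine (Spec.seq (Spec.setNat (Q := fun σ' => σ' = σ.setNat 21 2) rfl) fun σ₁ h₁ _ =>
    Spec.seq (Spec.setNat (Q := fun σ' => σ' = (σ.setNat 21 2).setNat 22 1) (by rw [h₁]; rfl))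
      fun σ₂ h₂ _ =>
    Spec.seq (Spec.setReal (Q := fun σ' => σ' = ((σ.setNat 21 2).setNat 22 1).setReal 10 (-1))
      (by simp [h₂])) fun σ₃ h₃ _ =>
    Spec.seq (Spec.setReal
      (Q := fun σ' => σ' = (((σ.setNat 21 2).setNat 22 1).setReal 10 (-1)).setReal 11 0)
      (by simp [h₃])) fun σ₄ h₄ _ =>
    Spec.conseq (Spec.whileLoop (l - 1) (fun k σ' => σ'.natReg 22 = k + 1 ∧
      σ'.natReg 21 = 2 ^ (k + 1) ∧ σ'.realReg 10 = (rootOfUnity (k + 1)).re ∧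
      σ'.realReg 11 = (rootOfUnity (k + 1)).im) (fun _ => Cmd.size (
        .seq (.setReal 11 (.sqrt ((1 - .reg 10) / 2))) <|
        .seq (.setReal 10 (.sqrt ((1 + .reg 10) / 2))) <|
        .seq (.setNat 21 (.reg 21 * 2)) <| .setNat 22 (.reg 22 + 1))) ?_ ?_ ?_) le_rfl ?_).mono ?_
  · simp [h₄, rootOfUnity_one]
  · rintro k hk σ' ⟨h22, h21, h10, h11⟩ hA
    constructor
    · have : σ'.natReg 20 = L := by rw [hA.natReg 20 rfl, h₄]; simpa using h20
      have hlt : 2 ^ (k + 1) < 2 * L := by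
        have : k + 1 < l := by omega
        rwa [hl, Nat.lt_clog_iff_pow_lt one_lt_two] at this
      simp [BExp.Holds, this, h21, hlt]
    -- The imaginary part is updated first, since both formulas need the old real part.
    · refine Spec.seq (Spec.setReal (Q := fun σ'' => σ'' =
        σ'.setReal 11 (rootOfUnity (k + 2)).im)
        (by simp [h10, rootOfUnity_im_succ (Nat.succ_pos k)])) fun σ₅ h₅ _ =>
        Spec.seq (Spec.setReal (Q := fun σ'' => σ'' = (σ'.setReal 11
          (rootOfUnity (k + 2)).im).setReal 10 (rootOfUnity (k + 2)).re)
          (by simp [h₅, h10, rootOfUnity_re_succ (Nat.succ_pos k)])) fun σ₆ h₆ _ =>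
        Spec.seq (Spec.setNat (Q := fun σ'' => σ'' = ((σ'.setReal 11
          (rootOfUnity (k + 2)).im).setReal 10 (rootOfUnity (k + 2)).re).setNat 21 (2 ^ (k + 2)))
          (by simp [h₆, h21, pow_succ])) fun σ₇ h₇ _ => Spec.setNat ?_
      simp [h₇, h22]
  · rintro σ' ⟨h22, h21, -⟩ hA
    have h20' : σ'.natReg 20 = L := by rw [hA.natReg 20 rfl, h₄]; simpa using h20
    have hle : 2 * L ≤ 2 ^ (l - 1 + 1) := by
      rw [Nat.sub_add_cancel hl1, hl]; exact Nat.le_pow_clog one_lt_two _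
    simp only [BExp.Holds, NExp.eval_mul, NExp.eval_ofNat, NExp.eval_reg, h20', h21, not_not]
    exact hle
  · rw [Nat.sub_add_cancel hl1]
    intro σ' h _
    exact h
  · simp only [sum_const, card_range, smul_eq_mul, rootCmd, Cmd.size]
    obtain ⟨n, hn⟩ : ∃ n, l = n + 1 := ⟨l - 1, by omega⟩
    rw [hn, Nat.add_sub_cancel]
    ring_nf
    nlinarith

/-- Tabulates the powers of the root of unity. -/
def twiddleCmd : Cmd :=
  .seq (.storeReal 8 0 1) <| .seq (.storeReal 9 0 0) <|
  cmapLoop 25 (.reg 21) 8 (1 + .reg 25)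
    (.arr 8 (.reg 25) * .reg 10 - .arr 9 (.reg 25) * .reg 11)
    (.arr 8 (.reg 25) * .reg 11 + .arr 9 (.reg 25) * .reg 10)

theorem twiddleCmd_spec {σ : State} {P : ℕ} {ω : ℂ} (h21 : σ.natReg 21 = P)
    (h10 : σ.realReg 10 = ω.re) (h11 : σ.realReg 11 = ω.im) :
    Spec twiddleCmd σ (fun σ' => ∀ j < P, σ'.cx 8 j = ω ^ j)
      ((P + 1) * (2 * twiddleCmd.size)) := by
  refine (Spec.seq (Spec.storeReal (Q := fun σ' => σ' = σ.storeReal 8 0 1) (by simp))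
    fun σ₁ h₁ _ => Spec.seq (Spec.storeReal
      (Q := fun σ' => σ' = (σ.storeReal 8 0 1).storeReal 9 0 0) (by simp [h₁]))
    fun σ₂ h₂ _ => Spec.conseq (Spec.cmapLoop P 1 (fun k => ω ^ (k + 1)) ?_) le_rfl ?_).mono ?_
  · intro σ' hA
    have h21' : σ'.natReg 21 = P := by rw [hA.natReg 21 rfl, h₂]; exact h21
    have h10' : σ'.realReg 10 = ω.re := by rw [hA.realReg 10 rfl, h₂]; exact h10
    have h11' : σ'.realReg 11 = ω.im := by rw [hA.realReg 11 rfl, h₂]; exact h11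
    refine ⟨h21', fun k hk h25 hprev hbelow => ?_⟩
    have hc : σ'.cx 8 k = ω ^ k := by
      cases k with
      | zero =>
        rw [hbelow 0 one_pos, h₂, pow_zero]
        apply Complex.ext <;> simp [State.cx]
      | succ k => rw [add_comm k 1, hprev k (by omega), add_comm]
    have hre : σ'.realArr 8 k = (ω ^ k).re := congrArg Complex.re hc
    have him : σ'.realArr 9 k = (ω ^ k).im := congrArg Complex.im hc
    simp [h25, hre, him, h10', h11', pow_succ]
  · rintro σ' ⟨h, h0⟩ _ j hj
    cases j with
    | zero =>
      rw [h0 0 one_pos, h₂, pow_zero]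
      apply Complex.ext <;> simp [State.cx]
    | succ j => rw [add_comm j 1, h j (by omega), add_comm]
  · simp only [twiddleCmd, Cmd.size]
    ring_nf
    nlinarith

/-- Transform of the complex array `x`: stage `s` is kept in row `s`, the result in row `l`. -/
def fftCmd (x : ℕ) : Cmd :=
  .seq (.setNat 24 (.reg 21)) <| forNat 23 (.reg 22) <| .seq (.setNat 24 (.reg 24 / 2)) <|
  cmapLoop 25 (.reg 21) x ((.reg 23 + 1) * .reg 21 + .reg 25)
    (.arr x (.reg 23 * .reg 21 + ((2 * (.reg 25 - .reg 25 % .reg 24)) % .reg 21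
        + .reg 25 % .reg 24)) +
      (.arr 8 (.reg 25 - .reg 25 % .reg 24) * .arr x (.reg 23 * .reg 21 +
          ((2 * (.reg 25 - .reg 25 % .reg 24)) % .reg 21 + .reg 25 % .reg 24 + .reg 24)) -
        .arr 9 (.reg 25 - .reg 25 % .reg 24) * .arr (x + 1) (.reg 23 * .reg 21 +
          ((2 * (.reg 25 - .reg 25 % .reg 24)) % .reg 21 + .reg 25 % .reg 24 + .reg 24))))
    (.arr (x + 1) (.reg 23 * .reg 21 + ((2 * (.reg 25 - .reg 25 % .reg 24)) % .reg 21
        + .reg 25 % .reg 24)) +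
      (.arr 8 (.reg 25 - .reg 25 % .reg 24) * .arr (x + 1) (.reg 23 * .reg 21 +
          ((2 * (.reg 25 - .reg 25 % .reg 24)) % .reg 21 + .reg 25 % .reg 24 + .reg 24)) +
        .arr 9 (.reg 25 - .reg 25 % .reg 24) * .arr x (.reg 23 * .reg 21 +
          ((2 * (.reg 25 - .reg 25 % .reg 24)) % .reg 21 + .reg 25 % .reg 24 + .reg 24))))

theorem fftCmd_spec {σ : State} {x l : ℕ} {ω : ℂ} {f : ℕ → ℂ} (hx : 10 ≤ x)
    (hω : ω ^ 2 ^ l = 1) (h21 : σ.natReg 21 = 2 ^ l) (h22 : σ.natReg 22 = l)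
    (h8 : ∀ j < 2 ^ l, σ.cx 8 j = ω ^ j) (hf : ∀ j < 2 ^ l, σ.cx x j = f j) :
    Spec (fftCmd x) σ (fun σ' => ∀ u < 2 ^ l, σ'.cx x (l * 2 ^ l + u) = dft (2 ^ l) ω f u)
      ((l + 1) * ((2 ^ l + 1) * (4 * (fftCmd x).size))) := by
  set P := 2 ^ l with hP
  have hPpos : 0 < P := by positivity
  have hw8 : (fftCmd x).writesRealArr 8 = false := by
    simp only [fftCmd, Cmd.writesRealArr, Cmd.forNat_writesRealArr,
      Cmd.cmapLoop_writesRealArr (show 8 < x by omega), Bool.or_false]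
  have hw9 : (fftCmd x).writesRealArr 9 = false := by
    simp only [fftCmd, Cmd.writesRealArr, Cmd.forNat_writesRealArr,
      Cmd.cmapLoop_writesRealArr (show 9 < x by omega), Bool.or_false]
  -- After s stages, row s holds the transforms of the subsequences of step 2^(l-s): the input
  -- itself for s = 0, the full transform for s = l.
  refine (Spec.seq (Spec.setNat (Q := fun σ' => σ' = σ.setNat 24 P) (by simp [h21]))
    fun σ₁ h₁ hA₁ => Spec.conseq (Spec.forNat l (fun s σ' => σ'.natReg 24 = 2 ^ (l - s) ∧
      ∀ e < P, σ'.cx x (s * P + e) = dftRow P (2 ^ (l - s)) ω f e)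
      (fun _ => Cmd.size (.setNat 24 (.reg 24 / 2)) + (P + 1) * (2 * (fftCmd x).size))
      rfl ?_ ?_ ?_) le_rfl ?_).mono ?_
  · intro σ' hA
    rw [NExp.eval_reg, hA.natReg 22 rfl, h₁]
    simpa using h22
  · rw [h₁]
    refine ⟨by simp [hP], fun e he => ?_⟩
    simp only [Nat.sub_zero, zero_mul, zero_add]
    rw [dftRow_self _ _ he, ← hf e he]
    rfl
  · rintro s hs σ' ⟨h24, hI⟩ hA h23
    have hAA : Agree (fftCmd x) σ σ' :=
      (hA₁.mono (.seq_left _ _)).trans (hA.mono (.seq_right _ _))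
    have h21' : σ'.natReg 21 = P := by rw [hAA.natReg 21 rfl, h21]
    have h8' : ∀ j < P, σ'.cx 8 j = ω ^ j := by
      intro j hj
      rw [← h8 j hj, State.cx, State.cx, hAA.realArr 8 hw8, hAA.realArr 9 hw9]
    set R := 2 ^ (l - (s + 1)) with hR
    have hR0 : 0 < R := by positivity
    have h2R : 2 ^ (l - s) = 2 * R := by
      rw [hR, ← pow_succ']; congr 1; omega
    have hPR : P = 2 ^ s * 2 * R := by
      rw [hP, hR, mul_assoc, ← pow_succ', ← pow_add]; congr 1; omega
    refine Spec.seq (Spec.setNat (Q := fun σ'' => σ'' = σ'.setNat 24 R)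
      (by simp [h24, h2R])) fun σ₂ h₂ _ => Spec.conseq
      (Spec.cmapLoop P ((s + 1) * P) (fun e => dftRow P R ω f e) ?_)
      (Nat.mul_le_mul_left _ ?_) ?_
    · intro σ₃ hA₃
      have g21 : σ₃.natReg 21 = P := by rw [hA₃.natReg 21 rfl, h₂]; simpa using h21'
      have g23 : σ₃.natReg 23 = s := by rw [hA₃.natReg 23 rfl, h₂]; simpa using h23
      have g24 : σ₃.natReg 24 = R := by rw [hA₃.natReg 24 rfl, h₂]; simp
      refine ⟨g21, fun e he g25 _ hbelow => ⟨by simp [g21, g23, g25], ?_⟩⟩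
      have hc8 : ∀ j < P, σ₃.realArr 8 j = (ω ^ j).re ∧ σ₃.realArr 9 j = (ω ^ j).im := by
        intro j hj
        have hb8 : σ₃.realArr 8 = σ'.realArr 8 := by
          rw [hA₃.realArr 8 (Cmd.cmapLoop_writesRealArr (by omega)), h₂]; rfl
        have hb9 : σ₃.realArr 9 = σ'.realArr 9 := by
          rw [hA₃.realArr 9 (Cmd.cmapLoop_writesRealArr (by omega)), h₂]; rfl
        rw [hb8, hb9, ← h8' j hj]
        exact ⟨rfl, rfl⟩
      have hrow : ∀ e < P, σ₃.realArr x (s * P + e) = (dftRow P (2 * R) ω f e).re ∧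
          σ₃.realArr (x + 1) (s * P + e) = (dftRow P (2 * R) ω f e).im := by
        intro e he
        have hlt : s * P + e < (s + 1) * P := by rw [Nat.succ_mul]; omega
        have := hbelow _ hlt
        rw [h₂] at this
        rw [← h2R, ← hI e he]
        exact ⟨congrArg Complex.re this, congrArg Complex.im this⟩
      have hr : e % R < R := Nat.mod_lt _ hR0
      have hE : e - e % R < P := by omega
      -- Both cells that are read lie in the current row: this remainder and P are multiples of 2R,
      -- and the remainder is smaller.
      have hi : (2 * (e - e % R)) % P + 2 * R ≤ P := by
        have hd : (2 * R) ∣ (2 * (e - e % R)) % P := by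
          rw [Nat.dvd_mod_iff ⟨2 ^ s, by rw [hPR]; ring⟩]
          exact Nat.mul_dvd_mul_left 2 (Nat.dvd_sub_mod e)
        have hd' : (2 * R) ∣ P := ⟨2 ^ s, by rw [hPR]; ring⟩
        have hlt : (2 * (e - e % R)) % P < P := Nat.mod_lt _ hPpos
        obtain ⟨c, hc⟩ := hd
        obtain ⟨c', hc'⟩ := hd'
        rw [hc] at hlt ⊢
        rw [hc'] at hlt ⊢
        have := Nat.lt_of_mul_lt_mul_left hlt
        calc 2 * R * c + 2 * R = 2 * R * (c + 1) := by ring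
          _ ≤ 2 * R * c' := Nat.mul_le_mul_left _ this
      obtain ⟨a1, a2⟩ := hrow _ (by omega : (2 * (e - e % R)) % P + e % R < P)
      obtain ⟨a3, a4⟩ := hrow _ (by omega : (2 * (e - e % R)) % P + e % R + R < P)
      obtain ⟨a5, a6⟩ := hc8 _ hE
      rw [dftRow_step f hR0 hPR hω]
      constructor
      · simp [g21, g23, g24, g25, a1, a3, a4, a5, a6]
      · simp [g21, g23, g24, g25, a2, a3, a4, a5, a6]
    · simp only [fftCmd, Cmd.size, forNat]; omega
    · rintro σ₃ ⟨h3, -⟩ hA₃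
      refine ⟨?_, fun e he => ?_⟩
      · have : σ₃.natReg 24 = R := by rw [hA₃.natReg 24 rfl, h₂]; simp
        simpa using this
      · exact h3 e he
  · rintro σ' ⟨⟨-, h⟩, -⟩ _ u hu
    rw [h u hu, Nat.sub_self, pow_zero, dftRow_one]
  · simp only [sum_const, card_range, smul_eq_mul]
    have e1 : Cmd.size (.setNat 24 (.reg 24 / 2)) ≤ (fftCmd x).size := by
      simp only [fftCmd, Cmd.size, forNat]; omega
    have e2 : ∀ p, Cmd.size (.setNat 24 (.reg 21)) + (forNat 23 (.reg 22) p).size =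
      Cmd.size (.seq (.setNat 24 (.reg 21)) (forNat 23 (.reg 22) p)) := fun _ => rfl
    have e3 : ∀ {a c y U S : ℕ}, a + c = S → y ≤ S →
        a + (l * (y + U * (2 * S) + c) + c) ≤ (l + 1) * (U * (2 * S) + 2 * S) := by
      intro a c y U S h1 h2
      have : l * (y + U * (2 * S) + c) ≤ l * (U * (2 * S) + 2 * S) :=
        Nat.mul_le_mul_left _ (by omega)
      rw [add_mul l 1, one_mul]
      omega
    refine (e3 (e2 _) e1).trans (Nat.mul_le_mul_left _ ?_)
    change (P + 1) * (2 * (fftCmd x).size) + 2 * (fftCmd x).size ≤ _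
    generalize (fftCmd x).size = S
    nlinarith

/-- Stores in array `5`, from the cell in register `27` on, the numbers `∑ a < L, F (a + a') G a`,
`a' < L`, where `L` is in register `20` and `fe`, `ge` are the entries of `F` and `G` whose index
is in register `25`. -/
def corrCmd (fe ge : RExp) : Cmd :=
  .seq rootCmd <| .seq twiddleCmd <|
  .seq (cmapLoop 25 (.reg 21) 10 (0 + .reg 25)
    (.ofNat (1 - (.reg 25 + 1 - 2 * .reg 20)) * fe) 0) <|
  .seq (cmapLoop 25 (.reg 21) 12 (0 + .reg 25) (.ofNat (1 - (.reg 25 + 1 - .reg 20)) * ge) 0) <|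
  .seq (fftCmd 10) <| .seq (fftCmd 12) <|
  .seq (cmapLoop 25 (.reg 21) 14 (0 + .reg 25)
    (.arr 10 (.reg 22 * .reg 21 + .reg 25) *
        .arr 12 (.reg 22 * .reg 21 + (.reg 21 - .reg 25) % .reg 21) -
      .arr 11 (.reg 22 * .reg 21 + .reg 25) *
        .arr 13 (.reg 22 * .reg 21 + (.reg 21 - .reg 25) % .reg 21))
    (.arr 10 (.reg 22 * .reg 21 + .reg 25) *
        .arr 13 (.reg 22 * .reg 21 + (.reg 21 - .reg 25) % .reg 21) +
      .arr 11 (.reg 22 * .reg 21 + .reg 25) *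
        .arr 12 (.reg 22 * .reg 21 + (.reg 21 - .reg 25) % .reg 21))) <|
  .seq (fftCmd 14) <|
  mapLoop 25 (.reg 20) .skip 5 (.reg 27 + .reg 25)
    (.arr 14 (.reg 22 * .reg 21 + (.reg 21 - .reg 25) % .reg 21) / .ofNat (.reg 21))

/-- Nothing is assumed on `fe` and `ge` beyond the indices 2L and L, where they may read arbitrary
cells; the padding factor 0 makes this harmless. -/
theorem corrCmd_spec {σ : State} {fe ge : RExp} {L base : ℕ} {F G : ℕ → ℝ} (hL : 1 ≤ L)
    (h20 : σ.natReg 20 = L) (h27 : σ.natReg 27 = base)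
    (hF : ∀ σ', Agree (corrCmd fe ge) σ σ' → ∀ t < 2 * L, σ'.natReg 25 = t → fe.eval σ' = F t)
    (hG : ∀ σ', Agree (corrCmd fe ge) σ σ' → ∀ t < L, σ'.natReg 25 = t → ge.eval σ' = G t) :
    Spec (corrCmd fe ge) σ (fun σ' =>
      (∀ a' < L, σ'.realArr 5 (base + a') = ∑ a ∈ range L, F (a + a') * G a) ∧
      ∀ c, (∀ a' < L, base + a' ≠ c) → σ'.realArr 5 c = σ.realArr 5 c)
      ((corrCmd fe ge).size * (4 * ((Nat.clog 2 (2 * L) + 1) * (2 ^ Nat.clog 2 (2 * L) + 1)))) := by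
  obtain ⟨l, hl⟩ : ∃ l, l = Nat.clog 2 (2 * L) := ⟨_, rfl⟩
  have hLP : 2 * L ≤ 2 ^ l := by rw [hl]; exact Nat.le_pow_clog one_lt_two _
  obtain ⟨P, hP⟩ : ∃ P, P = 2 ^ l := ⟨_, rfl⟩
  have hω := rootOfUnity_isPrimitiveRoot l
  obtain ⟨ω, hωl⟩ : ∃ ω, ω = rootOfUnity l := ⟨_, rfl⟩
  have hroot := rootCmd_spec hL h20
  rw [← hl, ← hωl, ← hP] at hroot
  rw [← hl, ← hP]
  rw [← hωl, ← hP] at hω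
  rw [← hP] at hLP
  have hPpos : 0 < P := by omega
  -- These inclusions for the tails of the program turn each intermediate agreement into agreement
  -- for the whole, as the hypotheses on `fe` and `ge` require.
  have w1 := Cmd.WritesLe.refl (corrCmd fe ge)
  have w2 := (Cmd.WritesLe.seq_right _ _).trans w1
  have w3 := (Cmd.WritesLe.seq_right _ _).trans w2
  have w4 := (Cmd.WritesLe.seq_right _ _).trans w3
  have w5 := (Cmd.WritesLe.seq_right _ _).trans w4
  have w6 := (Cmd.WritesLe.seq_right _ _).trans w5
  have w7 := (Cmd.WritesLe.seq_right _ _).trans w6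
  have w8 := (Cmd.WritesLe.seq_right _ _).trans w7
  have w9 := (Cmd.WritesLe.seq_right _ _).trans w8
  have hcost : ∀ q : Cmd, (P + 1) * (3 * q.size) ≤ q.size * (4 * ((l + 1) * (P + 1))) := by
    intro q
    generalize q.size = S
    nlinarith [Nat.zero_le (l * (P + 1) * S), Nat.zero_le ((P + 1) * S)]
  refine Spec.seqSize (hroot.mono ?_) fun σ₁ h₁ hA₁ => ?_
  · generalize rootCmd.size = S
    nlinarith [Nat.zero_le (l * P * S), Nat.zero_le (P * S), Nat.zero_le (l * S)]
  · have hcost' : ∀ q : Cmd, (P + 1) * (2 * q.size) ≤ q.size * (4 * ((l + 1) * (P + 1))) := fun q =>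
      (Nat.mul_le_mul_left _ (by omega)).trans (hcost q)
    have hfft : ∀ x, (l + 1) * ((2 ^ l + 1) * (4 * (fftCmd x).size)) ≤
        (fftCmd x).size * (4 * ((l + 1) * (P + 1))) := fun x => by rw [hP]; apply le_of_eq; ring
    obtain ⟨b22, b21, b10, b11⟩ := h₁
    have B₁ : Agree (corrCmd fe ge) σ σ₁ := hA₁.mono ((Cmd.WritesLe.seq_left _ _).trans w1)
    refine Spec.seqSize ((twiddleCmd_spec b21 b10 b11).mono (hcost' _)) fun σ₂ h₂ hA₂ => ?_
    have B₂ := B₁.trans (hA₂.mono ((Cmd.WritesLe.seq_left _ _).trans w2))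
    have c21 : σ₂.natReg 21 = P := by rw [hA₂.natReg 21 rfl, b21]
    have c22 : σ₂.natReg 22 = l := by rw [hA₂.natReg 22 rfl, b22]
    refine Spec.seqSize ((Spec.cmapLoop P 0 (fun t => if t < 2 * L then (F t : ℂ) else 0) ?_).mono
      (hcost' _))
      fun σ₃ h₃ hA₃ => ?_
    · intro σ' hA
      have d21 : σ'.natReg 21 = P := by rw [hA.natReg 21 rfl, c21]
      have hB := B₂.trans (hA.mono ((Cmd.WritesLe.seq_left _ _).trans w3))
      have d20 : σ'.natReg 20 = L := by rw [hB.natReg 20 rfl, h20]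
      refine ⟨d21, fun t _ d25 _ _ => ⟨by simp [d25], ?_, ?_⟩⟩
      -- By truncation, 1 - (t + 1 - 2L) is 1 for t < 2L and 0 for larger t.
      · by_cases ht : t < 2 * L
        · simp [d25, d20, ht, hF σ' hB t ht d25, show t + 1 - 2 * L = 0 by omega]
        · simp [d25, d20, ht, show 1 - (t + 1 - 2 * L) = 0 by omega]
      · by_cases ht : t < 2 * L <;> simp [ht]
    have B₃ := B₂.trans (hA₃.mono ((Cmd.WritesLe.seq_left _ _).trans w3))
    refine Spec.seqSize ((Spec.cmapLoop P 0 (fun t => if t < L then (G t : ℂ) else 0) ?_).mono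
      (hcost' _))
      fun σ₄ h₄ hA₄ => ?_
    · intro σ' hA
      have d21 : σ'.natReg 21 = P := by rw [hA.natReg 21 rfl, hA₃.natReg 21 rfl, c21]
      have hB := B₃.trans (hA.mono ((Cmd.WritesLe.seq_left _ _).trans w4))
      have d20 : σ'.natReg 20 = L := by rw [hB.natReg 20 rfl, h20]
      refine ⟨d21, fun t _ d25 _ _ => ⟨by simp [d25], ?_, ?_⟩⟩
      · by_cases ht : t < L
        · simp [d25, d20, ht, hG σ' hB t ht d25, show t + 1 - L = 0 by omega]
        · simp [d25, d20, ht, show 1 - (t + 1 - L) = 0 by omega]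
      · by_cases ht : t < L <;> simp [ht]
    have B₄ := B₃.trans (hA₄.mono ((Cmd.WritesLe.seq_left _ _).trans w4))
    simp only [zero_add] at h₃ h₄
    have e21 : σ₄.natReg 21 = P := by rw [hA₄.natReg 21 rfl, hA₃.natReg 21 rfl, c21]
    have e22 : σ₄.natReg 22 = l := by rw [hA₄.natReg 22 rfl, hA₃.natReg 22 rfl, c22]
    have e8 : ∀ j < 2 ^ l, σ₄.cx 8 j = ω ^ j := by
      intro j hj
      rw [← h₂ j (hP ▸ hj), State.cx, State.cx, hA₄.realArr 8 rfl, hA₄.realArr 9 rfl,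
        hA₃.realArr 8 rfl, hA₃.realArr 9 rfl]
    have hω1 : ω ^ 2 ^ l = 1 := by rw [← hP, hω.pow_eq_one]
    refine Spec.seqSize ((fftCmd_spec (f := fun t => if t < 2 * L then (F t : ℂ) else 0) (by norm_num)
      hω1 (hP ▸ e21) e22 e8 fun j hj => ?_).mono (hfft _)) fun σ₅ h₅ hA₅ => ?_
    · rw [← h₃.1 j (hP ▸ hj), State.cx, State.cx, hA₄.realArr 10 rfl, hA₄.realArr 11 rfl]
    have B₅ := B₄.trans (hA₅.mono ((Cmd.WritesLe.seq_left _ _).trans w5))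
    have f21 : σ₅.natReg 21 = P := by rw [hA₅.natReg 21 rfl, e21]
    have f22 : σ₅.natReg 22 = l := by rw [hA₅.natReg 22 rfl, e22]
    have f8 : ∀ j < 2 ^ l, σ₅.cx 8 j = ω ^ j := by
      intro j hj
      rw [← e8 j hj, State.cx, State.cx, hA₅.realArr 8 rfl, hA₅.realArr 9 rfl]
    refine Spec.seqSize ((fftCmd_spec (f := fun t => if t < L then (G t : ℂ) else 0) (by norm_num)
      hω1 (hP ▸ f21) f22 f8 fun j hj => ?_).mono (hfft _)) fun σ₆ h₆ hA₆ => ?_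
    · rw [← h₄.1 j (hP ▸ hj), State.cx, State.cx, hA₅.realArr 12 rfl, hA₅.realArr 13 rfl]
    have B₆ := B₅.trans (hA₆.mono ((Cmd.WritesLe.seq_left _ _).trans w6))
    have g21 : σ₆.natReg 21 = P := by rw [hA₆.natReg 21 rfl, f21]
    have g22 : σ₆.natReg 22 = l := by rw [hA₆.natReg 22 rfl, f22]
    rw [← hP] at h₅ h₆
    have g10 : ∀ u < P, σ₆.cx 10 (l * P + u) =
        dft P ω (fun t => if t < 2 * L then (F t : ℂ) else 0) u := by
      intro u hu
      rw [← h₅ u hu, State.cx, State.cx, hA₆.realArr 10 rfl, hA₆.realArr 11 rfl]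
    refine Spec.seqSize ((Spec.cmapLoop P 0 (fun u =>
      dft P ω (fun t => if t < 2 * L then (F t : ℂ) else 0) u *
      dft P ω (fun t => if t < L then (G t : ℂ) else 0) ((P - u) % P)) ?_).mono (hcost' _))
      fun σ₇ h₇ hA₇ => ?_
    · intro σ' hA
      have d21 : σ'.natReg 21 = P := by rw [hA.natReg 21 rfl, g21]
      have d22 : σ'.natReg 22 = l := by rw [hA.natReg 22 rfl, g22]
      refine ⟨d21, fun u hu d25 _ _ => ?_⟩
      have hu' : (P - u) % P < P := Nat.mod_lt _ hPpos
      have r1 : σ'.realArr 10 = σ₆.realArr 10 := hA.realArr 10 rfl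
      have r2 : σ'.realArr 11 = σ₆.realArr 11 := hA.realArr 11 rfl
      have r3 : σ'.realArr 12 = σ₆.realArr 12 := hA.realArr 12 rfl
      have r4 : σ'.realArr 13 = σ₆.realArr 13 := hA.realArr 13 rfl
      rw [← g10 u hu, ← h₆ _ hu']
      simp [d25, d21, d22, State.cx, r1, r2, r3, r4]
    have B₇ := B₆.trans (hA₇.mono ((Cmd.WritesLe.seq_left _ _).trans w7))
    simp only [zero_add] at h₇
    have k21 : σ₇.natReg 21 = P := by rw [hA₇.natReg 21 rfl, g21]
    have k22 : σ₇.natReg 22 = l := by rw [hA₇.natReg 22 rfl, g22]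
    have k8 : ∀ j < 2 ^ l, σ₇.cx 8 j = ω ^ j := by
      intro j hj
      rw [← f8 j hj, State.cx, State.cx, hA₇.realArr 8 rfl, hA₇.realArr 9 rfl,
        hA₆.realArr 8 rfl, hA₆.realArr 9 rfl]
    refine Spec.seqSize ((fftCmd_spec (by norm_num) hω1 (hP ▸ k21) k22 k8
      fun j hj => h₇.1 j (hP ▸ hj)).mono (hfft _)) fun σ₈ h₈ hA₈ => ?_
    rw [← hP] at h₈
    have B₈ := B₇.trans (hA₈.mono ((Cmd.WritesLe.seq_left _ _).trans w8))
    refine Spec.conseq (Spec.mapLoop L (fun a' => base + a')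
      (fun a' => ∑ a ∈ range L, F (a + a') * G a) (Cmd.size .skip) rfl rfl ?_ ?_ ?_) ?_ ?_
    · intro k _ k' _ h
      rw [Nat.add_left_cancel h]
    · intro σ' hA
      rw [NExp.eval_reg, hA.natReg 20 rfl, B₈.natReg 20 rfl, h20]
    · intro a' ha' σ' hA d25 _ _
      have d21 : σ'.natReg 21 = P := by rw [hA.natReg 21 rfl, hA₈.natReg 21 rfl, k21]
      have d22 : σ'.natReg 22 = l := by rw [hA.natReg 22 rfl, hA₈.natReg 22 rfl, k22]
      have d27 : σ'.natReg 27 = base := by rw [hA.natReg 27 rfl, B₈.natReg 27 rfl, h27]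
      refine Spec.skip ⟨by simp [d27, d25], ?_⟩
      have hu' : (P - a') % P < P := Nat.mod_lt _ hPpos
      have hd := (h₈ _ hu').trans (dft_correlation hω hLP
        (F := fun t => if t < 2 * L then (F t : ℂ) else 0)
        (G := fun t => if t < L then (G t : ℂ) else 0)
        (fun t ht => if_neg (by omega)) (fun t ht => if_neg (by omega)) ha')
      have hre : σ'.realArr 14 (l * P + (P - a') % P) =
          P * ∑ a ∈ range L, F (a + a') * G a := by
        have hsum : ∑ a ∈ range L, (if a + a' < 2 * L then (F (a + a') : ℂ) else 0) *
            (if a < L then (G a : ℂ) else 0) =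
            ((∑ a ∈ range L, F (a + a') * G a : ℝ) : ℂ) := by
          push_cast
          refine sum_congr rfl fun a ha => ?_
          have := mem_range.mp ha
          rw [if_pos (by omega), if_pos this]
        rw [hsum] at hd
        have h := congrArg Complex.re hd
        rw [hA.realArr 14 rfl]
        simpa [State.cx] using h
      have hP0 : (P : ℝ) ≠ 0 := by positivity
      simp only [RExp.eval_div, RExp.eval_arr, NExp.eval_add, NExp.eval_mul, NExp.eval_reg,
        NExp.eval_mod, NExp.eval_sub, RExp.eval_ofNat, d21, d22, d25, hre]
      exact mul_div_cancel_left₀ _ hP0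
    · refine (Nat.mul_le_mul (by omega : L + 1 ≤ P + 1) ?_).trans (hcost _)
      have := Cmd.size_pos (mapLoop 25 (.reg 20) .skip 5 (.reg 27 + .reg 25)
        (.arr 14 (.reg 22 * .reg 21 + (.reg 21 - .reg 25) % .reg 21) / .ofNat (.reg 21)))
      rw [Cmd.size]
      omega
    · rintro σ' ⟨h, h'⟩ _
      refine ⟨h, fun c hc => ?_⟩
      rw [h' c hc, hA₈.realArr 5 rfl, hA₇.realArr 5 rfl, hA₆.realArr 5 rfl, hA₅.realArr 5 rfl,
        hA₄.realArr 5 rfl, hA₃.realArr 5 rfl, hA₂.realArr 5 rfl, hA₁.realArr 5 rfl]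

end RealRAM

namespace ReducedCBC

open RealRAM

/-! ### One step of the component-by-component construction -/

/-- The global quantities: parameters, powers of `b`, powers of `1 + b²`, table of `φ_α`. -/
structure Env (b m s α : ℕ) (w : ℕ → ℕ) (γ : ℕ → ℝ) (σ : State) : Prop where
  base : σ.natReg 0 = b
  expo : σ.natReg 1 = m
  dim : σ.natReg 2 = s
  size : σ.natReg 4 = b ^ m
  sq : σ.natReg 9 = b ^ 2
  weight : ∀ j, σ.natArr 0 j = w j
  gamma : ∀ j, σ.realArr 0 j = γ j
  pow : ∀ j ≤ m, σ.natArr 2 j = b ^ j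
  gen : ∀ a ≤ b ^ m, σ.natArr 3 a = (1 + b ^ 2) ^ a % b ^ m
  table : ∀ n < b ^ m, σ.realArr 1 n = phiTab (b ^ m) α n

/-- `p` leaves the global quantities alone. -/
def keepsEnv (p : Cmd) : Bool :=
  !(p.writesNatReg 0 || p.writesNatReg 1 || p.writesNatReg 2 || p.writesNatReg 4 ||
    p.writesNatReg 9 || p.writesNatArr 0 || p.writesNatArr 2 || p.writesNatArr 3 ||
    p.writesRealArr 0 || p.writesRealArr 1)

/-- The condition on p is a Boolean computation on its text, so `rfl` discharges it wherever the
lemma is applied. -/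
theorem Env.of_agree {b m s α : ℕ} {w : ℕ → ℕ} {γ : ℕ → ℝ} {σ σ' : State} {p : Cmd}
    (h : Env b m s α w γ σ) (hA : Agree p σ σ') (hp : keepsEnv p = true) :
    Env b m s α w γ σ' := by
  simp only [keepsEnv, Bool.not_eq_true', Bool.or_eq_false_iff] at hp
  obtain ⟨⟨⟨⟨⟨⟨⟨⟨⟨h0, h1⟩, h2⟩, h4⟩, h9⟩, a0⟩, a2⟩, a3⟩, r0⟩, r1⟩ := hp
  constructor
  · rw [hA.natReg 0 h0, h.base]
  · rw [hA.natReg 1 h1, h.expo]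
  · rw [hA.natReg 2 h2, h.dim]
  · rw [hA.natReg 4 h4, h.size]
  · rw [hA.natReg 9 h9, h.sq]
  · rw [hA.natArr 0 a0]; exact h.weight
  · rw [hA.realArr 0 r0]; exact h.gamma
  · rw [hA.natArr 2 a2]; exact h.pow
  · rw [hA.natArr 3 a3]; exact h.gen
  · rw [hA.realArr 1 r1]; exact h.table

/-- The quantities of dimension `d`, where `w_d = m - k - 1`. -/
structure DimEnv (b m s α : ℕ) (w : ℕ → ℕ) (γ : ℕ → ℝ) (d k : ℕ) (σ : State) : Prop
    extends Env b m s α w γ σ where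
  index : σ.natReg 5 = d
  rank : σ.natReg 6 = k + 1
  modulus : σ.natReg 7 = b ^ (k + 1)
  step : σ.natReg 8 = b ^ w d

def keepsDim (p : Cmd) : Bool :=
  keepsEnv p && !(p.writesNatReg 5 || p.writesNatReg 6 || p.writesNatReg 7 || p.writesNatReg 8)

theorem DimEnv.of_agree {b m s α : ℕ} {w : ℕ → ℕ} {γ : ℕ → ℝ} {d k : ℕ} {σ σ' : State} {p : Cmd}
    (h : DimEnv b m s α w γ d k σ) (hA : Agree p σ σ') (hp : keepsDim p = true) :
    DimEnv b m s α w γ d k σ' := by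
  simp only [keepsDim, Bool.not_eq_true', Bool.or_eq_false_iff, Bool.and_eq_true] at hp
  obtain ⟨he, ⟨⟨h5, h6⟩, h7⟩, h8⟩ := hp
  refine ⟨h.toEnv.of_agree hA he, ?_, ?_, ?_, ?_⟩
  · rw [hA.natReg 5 h5, h.index]
  · rw [hA.natReg 6 h6, h.rank]
  · rw [hA.natReg 7 h7, h.modulus]
  · rw [hA.natReg 8 h8, h.step]

/-- Adds up the blocks of `η_{d-1}`. -/
def foldCmd : Cmd :=
  mapLoop 30 (.reg 7)
    (recLoop 1 31 (.reg 8) 0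
      (.reg 1 + .arr 2 ((.reg 5 - 1) * .reg 4 + (.reg 31 * .reg 7 + .reg 30))))
    3 (.reg 5 * .reg 4 + .reg 30) (.reg 1)

section

variable {b m s α : ℕ} {w : ℕ → ℕ} {γ : ℕ → ℝ} {d k : ℕ} {σ : State}

theorem foldCmd_spec (h : DimEnv b m s α w γ d k σ) (hk : m - w d = k + 1) {e : ℕ → ℝ}
    (he : ∀ n < b ^ m, σ.realArr 2 ((d - 1) * b ^ m + n) = e n) :
    Spec foldCmd σ (fun σ' =>
      (∀ i < b ^ (k + 1), σ'.realArr 3 (d * b ^ m + i) =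
        ∑ c ∈ range (b ^ w d), e (c * b ^ (k + 1) + i)) ∧
      ∀ c, (∀ i < b ^ (k + 1), d * b ^ m + i ≠ c) → σ'.realArr 3 c = σ.realArr 3 c)
      (foldCmd.size * (4 * ((b ^ (k + 1) + 1) * (b ^ w d + 1)))) := by
  have hN : b ^ m = b ^ w d * b ^ (k + 1) := by rw [← pow_add]; congr 1; omega
  refine (Spec.mapLoop (b ^ (k + 1)) (fun i => d * b ^ m + i)
    (fun i => ∑ c ∈ range (b ^ w d), e (c * b ^ (k + 1) + i))
    ((b ^ w d + 1) * (2 * (recLoop 1 31 (.reg 8) 0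
      (.reg 1 + .arr 2 ((.reg 5 - 1) * .reg 4 + (.reg 31 * .reg 7 + .reg 30)))).size))
    rfl rfl ?_ ?_ ?_).mono ?_
  · intro i _ i' _ h; rw [Nat.add_left_cancel h]
  · intro σ' hA
    exact (h.of_agree hA rfl).modulus
  · intro i hi σ' hA h30 _ _
    have h' := h.of_agree hA rfl
    refine Spec.conseq (Spec.recLoop (b ^ w d)
      (fun n => ∑ c ∈ range n, e (c * b ^ (k + 1) + i)) (by simp) ?_) le_rfl ?_
    · intro σ'' hA'
      have h'' := h'.of_agree hA' rfl
      refine ⟨h''.step, fun c hc h31 h1 => ?_⟩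
      have h30' : σ''.natReg 30 = i := by rw [hA'.natReg 30 rfl, h30]
      have hlt : c * b ^ (k + 1) + i < b ^ m := by
        rw [hN]
        calc c * b ^ (k + 1) + i < (c + 1) * b ^ (k + 1) := by rw [add_mul c 1, one_mul]; omega
          _ ≤ _ := Nat.mul_le_mul_right _ hc
      have := he _ hlt
      rw [sum_range_succ, ← this, ← hA.realArr 2 rfl, ← hA'.realArr 2 rfl]
      simp [h31, h1, h30', h''.index, h''.size, h''.modulus]
    · intro σ'' h1 hA'
      have h'' := h'.of_agree hA' rfl
      have h30' : σ''.natReg 30 = i := by rw [hA'.natReg 30 rfl, h30]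
      simp [h1, h30', h''.index, h''.size]
  · have hs : (recLoop 1 31 (.reg 8) 0
        (.reg 1 + .arr 2 ((.reg 5 - 1) * .reg 4 + (.reg 31 * .reg 7 + .reg 30)))).size ≤
        foldCmd.size := by
      simp only [foldCmd, mapLoop, forNat, Cmd.size]; omega
    change _ * (_ + 2 * foldCmd.size) ≤ _
    calc _ ≤ (b ^ (k + 1) + 1) * ((b ^ w d + 1) * (2 * foldCmd.size) + 2 * foldCmd.size) := by
          gcongr
      _ ≤ _ := by
          generalize foldCmd.size = S
          nlinarith [Nat.zero_le ((b ^ (k + 1) + 1) * S * b ^ w d)]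

/-! ### The correlations of one dimension and the values of `T_d` -/

/-- The correlation number `B`, for level `B / b⁴` and cosets `(B / b²) % b²` and `B % b²`. -/
noncomputable def blockValue (b m α Y k : ℕ) (g : ℕ → ℝ) (B a' : ℕ) : ℝ :=
  ∑ a ∈ range (b ^ (k - 1 - B / (b ^ 2 * b ^ 2))),
    phiTab (b ^ m) α (Y * b ^ (B / (b ^ 2 * b ^ 2)) * (B / b ^ 2 % b ^ 2) * (B % b ^ 2) *
      (1 + b ^ 2) ^ (a + a')) *
    g ((b ^ (B / (b ^ 2 * b ^ 2)) * (B / b ^ 2 % b ^ 2) * (1 + b ^ 2) ^ a) % b ^ (k + 1))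

/-- All correlations of the current dimension. -/
def blocksCmd : Cmd :=
  forNat 29 ((.reg 6 - 1) * (.reg 9 * .reg 9)) <|
    .seq (.setNat 20 (.arr 2 (.reg 6 - 2 - .reg 29 / (.reg 9 * .reg 9)))) <|
    .seq (.setNat 27 (.reg 29 * .reg 4)) <|
    corrCmd
      (.arr 1 ((.reg 8 * .arr 2 (.reg 29 / (.reg 9 * .reg 9)) * (.reg 29 / .reg 9 % .reg 9) *
        (.reg 29 % .reg 9) * .arr 3 (.reg 25)) % .reg 4))
      (.arr 3 (.reg 5 * .reg 4 + (.arr 2 (.reg 29 / (.reg 9 * .reg 9)) *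
        (.reg 29 / .reg 9 % .reg 9) * .arr 3 (.reg 25)) % .reg 7))

theorem blocksCmd_spec (hb : b.Prime) (h : DimEnv b m s α w γ d k σ) (hk : m - w d = k + 1)
    {g : ℕ → ℝ} (hg : ∀ i < b ^ (k + 1), σ.realArr 3 (d * b ^ m + i) = g i) :
    Spec blocksCmd σ (fun σ' => ∀ B < k * (b ^ 2 * b ^ 2),
        ∀ a' < b ^ (k - 1 - B / (b ^ 2 * b ^ 2)),
        σ'.realArr 5 (B * b ^ m + a') = blockValue b m α (b ^ w d) k g B a')
      (blocksCmd.size * (∑ B ∈ range (k * (b ^ 2 * b ^ 2)),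
        (4 * ((Nat.clog 2 (2 * b ^ (k - 1 - B / (b ^ 2 * b ^ 2))) + 1) *
          (2 ^ Nat.clog 2 (2 * b ^ (k - 1 - B / (b ^ 2 * b ^ 2))) + 1)) + 1) + 1)) := by
  have hbpos := hb.pos
  have hNpos : 0 < b ^ m := pow_pos hbpos _
  have hMN : b ^ (k + 1) ∣ b ^ m := pow_dvd_pow b (by omega)
  refine Spec.conseq (Spec.forNat (k * (b ^ 2 * b ^ 2)) (fun n σ' => ∀ B < n,
      ∀ a' < b ^ (k - 1 - B / (b ^ 2 * b ^ 2)),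
      σ'.realArr 5 (B * b ^ m + a') = blockValue b m α (b ^ w d) k g B a')
      (fun B => (Cmd.size (.seq (.setNat 20 (.arr 2 (.reg 6 - 2 - .reg 29 / (.reg 9 * .reg 9)))) <|
    .seq (.setNat 27 (.reg 29 * .reg 4)) <|
    corrCmd
      (.arr 1 ((.reg 8 * .arr 2 (.reg 29 / (.reg 9 * .reg 9)) * (.reg 29 / .reg 9 % .reg 9) *
        (.reg 29 % .reg 9) * .arr 3 (.reg 25)) % .reg 4))
      (.arr 3 (.reg 5 * .reg 4 + (.arr 2 (.reg 29 / (.reg 9 * .reg 9)) *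
        (.reg 29 / .reg 9 % .reg 9) * .arr 3 (.reg 25)) % .reg 7)))) *
        (4 * ((Nat.clog 2 (2 * b ^ (k - 1 - B / (b ^ 2 * b ^ 2))) + 1) *
          (2 ^ Nat.clog 2 (2 * b ^ (k - 1 - B / (b ^ 2 * b ^ 2))) + 1))))
      rfl ?_ ?_ ?_) ?_ fun σ' hQ _ => hQ.1
  · intro σ' hA
    have h' := h.of_agree hA rfl
    simp [h'.rank, h'.sq]
  · simp
  · intro B hB σ' hI hA h29
    have h' := h.of_agree hA rfl
    have hj : B / (b ^ 2 * b ^ 2) < k := Nat.div_lt_of_lt_mul (by rwa [mul_comm])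
    obtain ⟨j, hjdef⟩ : ∃ j, j = B / (b ^ 2 * b ^ 2) := ⟨_, rfl⟩
    rw [← hjdef] at hj ⊢
    obtain ⟨L, hL⟩ : ∃ L, L = b ^ (k - 1 - j) := ⟨_, rfl⟩
    rw [← hL]
    have hLpos : 1 ≤ L := by rw [hL]; exact Nat.one_le_pow _ _ hbpos
    -- The exponents a + a' < 2L stay within the table of powers of 1 + b².
    have h2L : 2 * L ≤ b ^ m := by
      calc 2 * L ≤ b * b ^ (k - 1 - j) := by rw [hL]; exact Nat.mul_le_mul_right _ hb.two_le
        _ = b ^ (k - 1 - j + 1) := by rw [pow_succ']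
        _ ≤ b ^ m := Nat.pow_le_pow_right hbpos (by omega)
    set X := 4 * ((Nat.clog 2 (2 * L) + 1) * (2 ^ Nat.clog 2 (2 * L) + 1)) with hX
    have hX1 : 1 ≤ X := by rw [hX]; have : 0 < 2 ^ Nat.clog 2 (2 * L) := by positivity
                           nlinarith
    have hpowj : ∀ σ'' : State, DimEnv b m s α w γ d k σ'' → σ''.natArr 2 j = b ^ j :=
      fun σ'' h'' => h''.pow j (by omega)
    refine Spec.seqSize (R := fun σ'' => σ'' = σ'.setNat 20 L)
      ((Spec.setNat ?_).mono (Nat.le_mul_of_pos_right _ hX1)) fun σ₁ h₁ hA₁ => ?_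
    · simp only [NExp.eval_arr, NExp.eval_sub, NExp.eval_reg, NExp.eval_ofNat, NExp.eval_div,
        NExp.eval_mul, h29, h'.rank, h'.sq, ← hjdef]
      rw [show k + 1 - 2 - j = k - 1 - j by omega, h'.pow (k - 1 - j) (by omega), hL]
    have h₁' := h'.of_agree hA₁ rfl
    have h29₁ : σ₁.natReg 29 = B := by rw [hA₁.natReg 29 rfl, h29]
    refine Spec.seqSize (R := fun σ'' => σ'' = σ₁.setNat 27 (B * b ^ m))
      ((Spec.setNat ?_).mono (Nat.le_mul_of_pos_right _ hX1)) fun σ₂ h₂ hA₂ => ?_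
    · simp [h29₁, h₁'.size]
    have h₂' := h₁'.of_agree hA₂ rfl
    have h29₂ : σ₂.natReg 29 = B := by rw [hA₂.natReg 29 rfl, h29₁]
    have r3 : σ₂.realArr 3 = σ.realArr 3 := by
      rw [hA₂.realArr 3 rfl, hA₁.realArr 3 rfl, hA.realArr 3 rfl]
    have r5 : σ₂.realArr 5 = σ'.realArr 5 := by rw [hA₂.realArr 5 rfl, hA₁.realArr 5 rfl]
    refine Spec.conseq (corrCmd_spec (L := L) (base := B * b ^ m)
      (F := fun t => phiTab (b ^ m) α (b ^ w d * b ^ j * (B / b ^ 2 % b ^ 2) * (B % b ^ 2) *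
        (1 + b ^ 2) ^ t))
      (G := fun a => g ((b ^ j * (B / b ^ 2 % b ^ 2) * (1 + b ^ 2) ^ a) % b ^ (k + 1)))
      hLpos ?_ ?_ ?_ ?_) le_rfl ?_
    · simp [h₂, h₁]
    · simp [h₂]
    · intro σ₃ hA₃ t ht h25
      have h₃ := h₂'.of_agree hA₃ rfl
      have h29₃ : σ₃.natReg 29 = B := by rw [hA₃.natReg 29 rfl, h29₂]
      have hgen := h₃.gen t (by omega)
      simp only [RExp.eval_arr, NExp.eval_mod, NExp.eval_mul, NExp.eval_reg, NExp.eval_arr,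
        NExp.eval_div, h25, h29₃, h₃.step, h₃.sq, h₃.size, hgen, ← hjdef, hpowj _ h₃]
      rw [h₃.table _ (Nat.mod_lt _ hNpos)]
      apply phiTab_congr
      exact (Nat.mod_modEq _ _).trans ((Nat.mod_modEq _ _).mul_left _)
    · intro σ₃ hA₃ a ha h25
      have h₃ := h₂'.of_agree hA₃ rfl
      have h29₃ : σ₃.natReg 29 = B := by rw [hA₃.natReg 29 rfl, h29₂]
      have hgen := h₃.gen a (by omega)
      have hmod : (b ^ j * (B / b ^ 2 % b ^ 2) * ((1 + b ^ 2) ^ a % b ^ m)) % b ^ (k + 1) =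
          (b ^ j * (B / b ^ 2 % b ^ 2) * (1 + b ^ 2) ^ a) % b ^ (k + 1) :=
        Nat.ModEq.mul_left _ ((Nat.mod_modEq _ _).of_dvd hMN)
      simp only [RExp.eval_arr, NExp.eval_mod, NExp.eval_mul, NExp.eval_reg, NExp.eval_arr,
        NExp.eval_div, NExp.eval_add, h25, h29₃, h₃.index, h₃.sq, h₃.size, h₃.modulus, hgen,
        ← hjdef, hpowj _ h₃, hmod]
      rw [hA₃.realArr 3 rfl, r3]
      exact hg _ (Nat.mod_lt _ (pow_pos hbpos _))
    · rintro σ₃ ⟨hnew, hold⟩ hA₃ B' hB' a' ha'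
      simp only [State.setNat_realArr]
      rcases Nat.lt_succ_iff_lt_or_eq.mp hB' with hlt | rfl
      · rw [← hI B' hlt a' ha', hold, r5]
        intro a _ heq
        -- Blocks are stored at distance b^m, which exceeds or equals every correlation length, so
        -- earlier blocks are not overwritten.
        have hle : b ^ (k - 1 - B' / (b ^ 2 * b ^ 2)) ≤ b ^ m :=
          Nat.pow_le_pow_right hbpos
            ((Nat.sub_le _ _).trans ((Nat.sub_le _ _).trans (by omega)))
        have : (B' + 1) * b ^ m ≤ B * b ^ m := Nat.mul_le_mul_right _ hlt
        rw [add_mul, one_mul] at this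
        omega
      · rw [hnew a' (by rw [hL, hjdef]; exact ha'), blockValue, ← hjdef, ← hL]
  · rw [mul_add, mul_one, mul_sum]
    refine Nat.add_le_add_right (sum_le_sum fun B _ => ?_) _
    rw [mul_add, mul_one]
    refine Nat.add_le_add_right (Nat.mul_le_mul_right _ ?_) _
    simp only [blocksCmd, forNat, Cmd.size]
    omega

end

/-- The part of `T_d` that comes from the multiples of `b^(m - w_d - 1)`. -/
def directCmd : Cmd :=
  recLoop 1 31 (.reg 0) 0
    (.reg 1 + .arr 1 ((.reg 8 * (.reg 31 * .arr 2 (.reg 6 - 1)) * .reg 32) % .reg 4) *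
      .arr 3 (.reg 5 * .reg 4 + .reg 31 * .arr 2 (.reg 6 - 1)))

/-- The part of `T_d` that comes from the correlations. -/
def correlationSumCmd : Cmd :=
  recLoop 2 31 ((.reg 6 - 1) * .reg 9) 0
    (.reg 2 + .ofNat (1 - (1 - (.reg 31 % .reg 9) % .reg 0)) *
      .arr 5 ((.reg 31 * .reg 9 + .reg 30 / .arr 2 (.reg 6 - 2)) * .reg 4 +
        (.reg 30 % .arr 2 (.reg 6 - 2)) % .arr 2 (.reg 6 - 2 - .reg 31 / .reg 9)))

/-- Computes all values of `T_d`. -/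
def gatherCmd : Cmd :=
  mapLoop 30 (.reg 9 * .arr 2 (.reg 6 - 2))
    (.seq (.setNat 32 ((.reg 30 / .arr 2 (.reg 6 - 2) * .arr 3 (.reg 30 % .arr 2 (.reg 6 - 2))) %
        .reg 7)) <| .seq directCmd correlationSumCmd)
    4 (.reg 5 * .reg 4 + .reg 32) (.reg 1 + .reg 2)

section

variable {b m s α : ℕ} {w : ℕ → ℕ} {γ : ℕ → ℝ} {d k : ℕ} {σ : State}

theorem directCmd_spec (hb : b.Prime) (h : DimEnv b m s α w γ d k σ) (hk : m - w d = k + 1)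
    {g : ℕ → ℝ} (hg : ∀ i < b ^ (k + 1), σ.realArr 3 (d * b ^ m + i) = g i) {y : ℕ}
    (h32 : σ.natReg 32 = y) :
    Spec directCmd σ (fun σ' => σ'.realReg 1 = ∑ t ∈ range b,
      phiTab (b ^ m) α (b ^ w d * (t * b ^ k) * y) * g (t * b ^ k))
      ((b + 1) * (2 * directCmd.size)) := by
  refine Spec.recLoop b (fun n => ∑ t ∈ range n,
      phiTab (b ^ m) α (b ^ w d * (t * b ^ k) * y) * g (t * b ^ k)) (by simp) fun σ' hA => ?_
  have h' := h.of_agree hA rfl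
  refine ⟨h'.base, fun t ht h31 h1 => ?_⟩
  have h32' : σ'.natReg 32 = y := by rw [hA.natReg 32 rfl, h32]
  have hlt : t * b ^ k < b ^ (k + 1) := by
    rw [pow_succ']; exact Nat.mul_lt_mul_of_pos_right ht (pow_pos hb.pos _)
  have hg' := hg _ hlt
  rw [← hA.realArr 3 rfl] at hg'
  have htab := h'.table _ (Nat.mod_lt (b ^ w d * (t * b ^ k) * y) (pow_pos hb.pos m))
  rw [phiTab_congr (Nat.mod_modEq _ _)] at htab
  rw [sum_range_succ]
  simp [h1, h31, h'.rank, h'.size, h'.step, h'.index, h32', h'.pow k (by omega), hg', htab]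

/-- Encoding: e = j b² + c and x = c' b^(k-1) + a', so the correlation of level j and cosets c, c'
has number e b² + c'. -/
theorem correlationSumCmd_spec (hb : b.Prime) (h : DimEnv b m s α w γ d k σ)
    (hk : m - w d = k + 1) {v : ℕ → ℕ → ℝ}
    (hv : ∀ B < k * (b ^ 2 * b ^ 2), ∀ a' < b ^ (k - 1 - B / (b ^ 2 * b ^ 2)),
        σ.realArr 5 (B * b ^ m + a') = v B a') {x : ℕ} (h30 : σ.natReg 30 = x)
    (hx : x < b ^ 2 * b ^ (k - 1)) :
    Spec correlationSumCmd σ (fun σ' => σ'.realReg 2 = ∑ e ∈ range (k * b ^ 2),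
      ((1 - (1 - e % b ^ 2 % b) : ℕ) : ℝ) * v (e * b ^ 2 + x / b ^ (k - 1))
        (x % b ^ (k - 1) % b ^ (k - 1 - e / b ^ 2)))
      ((k * b ^ 2 + 1) * (2 * correlationSumCmd.size)) := by
  refine Spec.recLoop (k * b ^ 2) (fun n => ∑ e ∈ range n,
      ((1 - (1 - e % b ^ 2 % b) : ℕ) : ℝ) * v (e * b ^ 2 + x / b ^ (k - 1))
        (x % b ^ (k - 1) % b ^ (k - 1 - e / b ^ 2))) (by simp) fun σ' hA => ?_
  have h' := h.of_agree hA rfl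
  refine ⟨by simp [h'.rank, h'.sq], fun e he h31 h2 => ?_⟩
  have h30' : σ'.natReg 30 = x := by rw [hA.natReg 30 rfl, h30]
  have hq : x / b ^ (k - 1) < b ^ 2 := Nat.div_lt_of_lt_mul (by rwa [mul_comm])
  have hB : e * b ^ 2 + x / b ^ (k - 1) < k * (b ^ 2 * b ^ 2) := by
    calc _ < (e + 1) * b ^ 2 := by rw [add_mul e 1, one_mul]; omega
      _ ≤ (k * b ^ 2) * b ^ 2 := Nat.mul_le_mul_right _ he
      _ = _ := by ring
  have hdiv : (e * b ^ 2 + x / b ^ (k - 1)) / (b ^ 2 * b ^ 2) = e / b ^ 2 := by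
    have hb2 : 0 < b ^ 2 := pow_pos hb.pos _
    rw [← Nat.div_div_eq_div_mul, mul_comm e, Nat.mul_add_div hb2, Nat.div_eq_of_lt hq, add_zero]
  have hval := hv _ hB (x % b ^ (k - 1) % b ^ (k - 1 - e / b ^ 2))
    (by rw [hdiv]; exact Nat.mod_lt _ (pow_pos hb.pos _))
  rw [← hA.realArr 5 rfl] at hval
  have p1 : σ'.natArr 2 (k - 1) = b ^ (k - 1) := h'.pow _ (by omega)
  have p2 : σ'.natArr 2 (k - 1 - e / b ^ 2) = b ^ (k - 1 - e / b ^ 2) :=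
    h'.pow _ ((Nat.sub_le _ _).trans (by omega))
  rw [sum_range_succ]
  simp only [RExp.eval_add, RExp.eval_reg, h2, RExp.eval_mul, RExp.eval_ofNat, NExp.eval_sub,
    NExp.eval_one, NExp.eval_mod, NExp.eval_reg, h31, h'.sq, h'.base, RExp.eval_arr,
    NExp.eval_add, NExp.eval_mul, NExp.eval_div, NExp.eval_arr, h30', h'.rank, h'.size,
    NExp.eval_ofNat, show k + 1 - 2 = k - 1 by omega, p1, p2, hval]

/-- Running through the pairs (c', a') instead of y avoids discrete logarithms. Pairs with b | c'
are superfluous but harmless, because the correlation formula does not need c' to be a unit. -/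
theorem gatherCmd_spec (hb : b.Prime) (h : DimEnv b m s α w γ d k σ) (hk : m - w d = k + 1)
    {z : ℕ → ℕ} (hg : ∀ i < b ^ (k + 1),
      σ.realArr 3 (d * b ^ m + i) = foldedEta b m α w γ z d i)
    (hv : ∀ B < k * (b ^ 2 * b ^ 2), ∀ a' < b ^ (k - 1 - B / (b ^ 2 * b ^ 2)),
        σ.realArr 5 (B * b ^ m + a') =
          blockValue b m α (b ^ w d) k (foldedEta b m α w γ z d) B a') :
    Spec gatherCmd σ (fun σ' =>
      (∀ y ∈ searchSet b m (w d), σ'.realArr 4 (d * b ^ m + y) = T b m α w γ z d y) ∧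
      ∀ c, (∀ i < b ^ m, d * b ^ m + i ≠ c) → σ'.realArr 4 c = σ.realArr 4 c)
      (gatherCmd.size * ((b ^ 2 * b ^ (k - 1) + 1) * (4 * (b + 1) + 4 * (k * b ^ 2 + 1)))) := by
  have hbpos := hb.pos
  have hMpos : 0 < b ^ (k + 1) := pow_pos hbpos _
  have hMN : b ^ (k + 1) ∣ b ^ m := pow_dvd_pow b (by omega)
  have hLpos : 0 < b ^ (k - 1) := pow_pos hbpos _
  set yOf : ℕ → ℕ := fun x =>
    (x / b ^ (k - 1) * (1 + b ^ 2) ^ (x % b ^ (k - 1))) % b ^ (k + 1) with hyOf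
  refine Spec.conseq (Spec.mapLoop (b ^ 2 * b ^ (k - 1)) (fun x => d * b ^ m + yOf x)
    (fun x => T b m α w γ z d (yOf x))
    ((Cmd.setNat 32 ((.reg 30 / .arr 2 (.reg 6 - 2) * .arr 3 (.reg 30 % .arr 2 (.reg 6 - 2))) %
        .reg 7)).size + ((b + 1) * (2 * directCmd.size) +
          (k * b ^ 2 + 1) * (2 * correlationSumCmd.size))) rfl rfl ?_ ?_ ?_) ?_ ?_
  · intro x _ x' _ hxx
    rw [Nat.add_left_cancel hxx]
  · intro σ' hA
    have h' := h.of_agree hA rfl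
    simp [h'.sq, h'.rank, h'.pow (k - 1) (by omega)]
  · intro x hx σ' hA h30 _ _
    have h' := h.of_agree hA rfl
    have hxmod : x % b ^ (k - 1) ≤ b ^ m := (Nat.mod_lt _ hLpos).le.trans
      (Nat.pow_le_pow_right hbpos (by omega))
    refine Spec.seq (R := fun σ'' => σ'' = σ'.setNat 32 (yOf x)) (Spec.setNat ?_)
      fun σ₁ h₁ hA₁ => ?_
    · simp only [NExp.eval_mod, NExp.eval_mul, NExp.eval_div, NExp.eval_reg, NExp.eval_arr,
        NExp.eval_sub, NExp.eval_ofNat, h30, h'.rank, show k + 1 - 2 = k - 1 by omega,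
        h'.pow (k - 1) (by omega), h'.gen _ hxmod, h'.modulus, hyOf]
      congr 1
      exact Nat.ModEq.mul_left _ ((Nat.mod_modEq _ _).of_dvd hMN)
    have h₁' := h'.of_agree hA₁ rfl
    have h30₁ : σ₁.natReg 30 = x := by rw [hA₁.natReg 30 rfl, h30]
    have h32₁ : σ₁.natReg 32 = yOf x := by rw [h₁]; simp
    refine Spec.seq (directCmd_spec hb h₁' hk (g := foldedEta b m α w γ z d)
      (fun i hi => by rw [hA₁.realArr 3 rfl, hA.realArr 3 rfl, hg i hi]) h32₁) fun σ₂ h₂ hA₂ => ?_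
    have h₂' := h₁'.of_agree hA₂ rfl
    refine Spec.conseq (correlationSumCmd_spec hb h₂' hk
      (v := blockValue b m α (b ^ w d) k (foldedEta b m α w γ z d))
      (fun B hB a' ha' => by
        rw [hA₂.realArr 5 rfl, hA₁.realArr 5 rfl, hA.realArr 5 rfl, hv B hB a' ha'])
      (x := x) (by rw [hA₂.natReg 30 rfl, h30₁]) hx) le_rfl fun σ₃ h₃ hA₃ => ?_
    have h₃' := h₂'.of_agree hA₃ rfl
    have h32₃ : σ₃.natReg 32 = yOf x := by rw [hA₃.natReg 32 rfl, hA₂.natReg 32 rfl, h32₁]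
    have h1₃ := (hA₃.realReg 1 rfl).trans h₂
    refine ⟨by simp [h₃'.index, h₃'.size, h32₃], ?_⟩
    rw [RExp.eval_add, RExp.eval_reg, RExp.eval_reg, h1₃, h₃, hyOf]
    change _ = T b m α w γ z d ((x / b ^ (k - 1) * (1 + b ^ 2) ^ (x % b ^ (k - 1))) % b ^ (k + 1))
    rw [T_eq_sum_correlations hb hk]
    congr 1
    rw [sum_range_mul_add]
    have hb2 : 0 < b ^ 2 := pow_pos hbpos _
    have hq : x / b ^ (k - 1) < b ^ 2 := Nat.div_lt_of_lt_mul (by rwa [mul_comm])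
    refine sum_congr rfl fun j _ => sum_congr rfl fun c hc => ?_
    have hc' := mem_range.mp hc
    have e1 : (j * b ^ 2 + c) % b ^ 2 = c := by
      rw [mul_comm, Nat.mul_add_mod, Nat.mod_eq_of_lt hc']
    have e2 : (j * b ^ 2 + c) / b ^ 2 = j := by
      rw [mul_comm, Nat.mul_add_div hb2, Nat.div_eq_of_lt hc', add_zero]
    have e3 : ((j * b ^ 2 + c) * b ^ 2 + x / b ^ (k - 1)) % b ^ 2 = x / b ^ (k - 1) := by
      rw [mul_comm _ (b ^ 2), Nat.mul_add_mod, Nat.mod_eq_of_lt hq]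
    have e4 : ((j * b ^ 2 + c) * b ^ 2 + x / b ^ (k - 1)) / b ^ 2 = j * b ^ 2 + c := by
      rw [mul_comm _ (b ^ 2), Nat.mul_add_div hb2, Nat.div_eq_of_lt hq, add_zero]
    rw [blockValue, ← Nat.div_div_eq_div_mul, e3, e4, e1, e2]
  · have h1 : directCmd.size + correlationSumCmd.size + (Cmd.setNat 32 ((.reg 30 /
        .arr 2 (.reg 6 - 2) * .arr 3 (.reg 30 % .arr 2 (.reg 6 - 2))) % .reg 7)).size ≤
        gatherCmd.size := by
      simp only [gatherCmd, mapLoop, forNat, Cmd.size]; omega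
    change _ * (_ + 2 * gatherCmd.size) ≤ _
    generalize gatherCmd.size = S at *
    generalize directCmd.size = D at *
    generalize correlationSumCmd.size = E at *
    rw [mul_left_comm S]
    refine Nat.mul_le_mul_left _ ?_
    have h2 : (b + 1) * (2 * D) ≤ (b + 1) * (2 * S) := Nat.mul_le_mul_left _ (by omega)
    have h3 : (k * b ^ 2 + 1) * (2 * E) ≤ (k * b ^ 2 + 1) * (2 * S) :=
      Nat.mul_le_mul_left _ (by omega)
    have h4 : S ≤ (b + 1) * S := Nat.le_mul_of_pos_left _ (by omega)
    have h5 : S ≤ (k * b ^ 2 + 1) * S := Nat.le_mul_of_pos_left _ (by omega)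
    calc _ ≤ S + ((b + 1) * (2 * S) + (k * b ^ 2 + 1) * (2 * S)) + 2 * S := by omega
      _ = 2 * ((b + 1) * S) + 2 * ((k * b ^ 2 + 1) * S) + 3 * S := by ring
      _ ≤ 4 * ((b + 1) * S) + 4 * ((k * b ^ 2 + 1) * S) := by omega
      _ = _ := by ring
  · rintro σ' ⟨hnew, hold⟩ _
    constructor
    · intro y hy
      rw [mem_searchSet hb (by omega), hk] at hy
      -- Every unit is met. For k = 0 truncation makes b^(k-1) = 1, so a = 0 is the only exponent.
      obtain ⟨c, hc, a, ha, rfl⟩ := exists_eq_mul_pow_mod hb (by omega) hy.1 hy.2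
      rw [show k + 1 - 2 = k - 1 by omega] at ha
      have hlt : c * b ^ (k - 1) + a < b ^ 2 * b ^ (k - 1) := by
        calc _ < (c + 1) * b ^ (k - 1) := by rw [add_mul c 1, one_mul]; omega
          _ ≤ _ := Nat.mul_le_mul_right _ hc
      have hy2 : yOf (c * b ^ (k - 1) + a) = c * (1 + b ^ 2) ^ a % b ^ (k + 1) := by
        simp only [hyOf]
        rw [mul_comm c, Nat.mul_add_mod, Nat.mod_eq_of_lt ha, Nat.mul_add_div hLpos,
          Nat.div_eq_of_lt ha, add_zero]
      rw [← hy2]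
      exact hnew _ hlt
    · intro c hc
      refine hold c fun x _ => hc _ ?_
      exact (Nat.mod_lt _ hMpos).trans_le (Nat.le_of_dvd (pow_pos hbpos _) hMN)

/-! ### Minimization and the update of η -/

/-- Leaves a minimizer of `T_d` in register `33`. -/
def argminCmd : Cmd :=
  .seq (.setNat 33 1) <| forNat 30 (.reg 7) <|
    .ite (.and (.not (.natLe (.reg 30 % .reg 0) 0))
        (.realLe (.arr 4 (.reg 5 * .reg 4 + .reg 30)) (.arr 4 (.reg 5 * .reg 4 + .reg 33))))
      (.setNat 33 (.reg 30)) .skip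

theorem argminCmd_spec (hb : b.Prime) (h : DimEnv b m s α w γ d k σ) (hk : m - w d = k + 1)
    {v : ℕ → ℝ} (hv : ∀ y ∈ searchSet b m (w d), σ.realArr 4 (d * b ^ m + y) = v y) :
    Spec argminCmd σ (fun σ' => σ'.natReg 33 ∈ searchSet b m (w d) ∧
      ∀ y ∈ searchSet b m (w d), v (σ'.natReg 33) ≤ v y)
      (argminCmd.size * (2 * (b ^ (k + 1) + 1))) := by
  have hm : m ≠ 0 := by omega
  -- The search starts at an admissible element and moves only to admissible ones, so the cell of
  -- the current candidate always has known content.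
  have hone : 1 ∈ searchSet b m (w d) := by
    rw [mem_searchSet hb hm, hk]
    exact ⟨Nat.one_lt_pow (by omega) hb.one_lt, fun h => hb.one_lt.ne' (Nat.dvd_one.mp h)⟩
  refine (Spec.seq (R := fun σ' => σ' = σ.setNat 33 1) (Spec.setNat (by simp))
    fun σ₁ h₁ hA₁ => Spec.conseq (Spec.forNat (b ^ (k + 1)) (fun n σ' =>
      σ'.natReg 33 ∈ searchSet b m (w d) ∧
        ∀ y ∈ searchSet b m (w d), y < n → v (σ'.natReg 33) ≤ v y)
      (fun _ => (BExp.and (.not (.natLe (.reg 30 % .reg 0) 0))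
        (.realLe (.arr 4 (.reg 5 * .reg 4 + .reg 30)) (.arr 4 (.reg 5 * .reg 4 + .reg 33)))).cost
        + 1 + (Cmd.setNat 33 (.reg 30)).size) rfl ?_ ?_ ?_) le_rfl ?_).mono ?_
  · intro σ' hA
    exact ((h.of_agree hA₁ rfl).of_agree hA rfl).modulus
  · simpa [h₁] using hone
  · rintro y hy σ' ⟨hmem, hmin⟩ hA h30
    have h' := (h.of_agree hA₁ rfl).of_agree hA rfl
    have h4 : σ'.realArr 4 = σ.realArr 4 := by rw [hA.realArr 4 rfl, hA₁.realArr 4 rfl]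
    have hby : y ∈ searchSet b m (w d) ↔ ¬ y % b ≤ 0 := by
      rw [mem_searchSet hb hm, hk, Nat.dvd_iff_mod_eq_zero]
      simp [hy]
    refine Spec.ite (fun hc => ?_) (fun hc => Spec.conseq (Spec.skip (Q := fun σ'' => σ'' = σ') rfl)
      ?_ ?_)
    · refine Spec.setNat ?_
      simp only [BExp.Holds, NExp.eval_mod, NExp.eval_reg, h30, h'.base, NExp.eval_zero,
        RExp.eval_arr, NExp.eval_add, NExp.eval_mul, h'.index, h'.size, h4] at hc
      have hyS := hby.mpr hc.1
      have hle : v y ≤ v (σ'.natReg 33) := by rw [← hv _ hyS, ← hv _ hmem]; exact hc.2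
      simp only [NExp.eval_reg, h30, State.setNat_natReg, reduceIte]
      refine ⟨hyS, fun y' hy' hlt => ?_⟩
      rcases Nat.lt_succ_iff_lt_or_eq.mp hlt with hlt' | rfl
      · exact hle.trans (hmin y' hy' hlt')
      · exact le_rfl
    · simp only [Cmd.size]; omega
    · rintro _ rfl _
      simp only [State.setNat_natReg]
      refine ⟨hmem, fun y' hy' hlt => ?_⟩
      rcases Nat.lt_succ_iff_lt_or_eq.mp hlt with hlt' | rfl
      · exact hmin y' hy' hlt'
      · simp only [BExp.Holds, NExp.eval_mod, NExp.eval_reg, h30, h'.base, NExp.eval_zero,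
          RExp.eval_arr, NExp.eval_add, NExp.eval_mul, h'.index, h'.size, h4, not_and] at hc
        have := hc (hby.mp hy')
        rw [hv _ hy', hv _ hmem, not_le] at this
        exact this.le
  · rintro σ' ⟨⟨hmem, hmin⟩, -⟩ _
    refine ⟨hmem, fun y hy => hmin y hy ?_⟩
    rw [mem_searchSet hb hm, hk] at hy
    exact hy.1
  · simp only [sum_const, card_range, smul_eq_mul, argminCmd, forNat, Cmd.size]
    generalize b ^ (k + 1) = M
    ring_nf
    nlinarith

/-- Computes `η_d` from `η_{d-1}`, where `z_d` is in register `33`. -/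
def etaCmd : Cmd :=
  mapLoop 30 (.reg 4) .skip 2 (.reg 5 * .reg 4 + .reg 30)
    (.arr 2 ((.reg 5 - 1) * .reg 4 + .reg 30) *
      (1 + .arr 0 (.reg 5) * .arr 1 ((.reg 30 * .reg 8 * .reg 33) % .reg 4)))

theorem etaCmd_spec (hb : b.Prime) (h : Env b m s α w γ σ) {Y y : ℕ} (h5 : σ.natReg 5 = d + 1)
    (h8 : σ.natReg 8 = Y) (h33 : σ.natReg 33 = y) {e : ℕ → ℝ}
    (he : ∀ n < b ^ m, σ.realArr 2 (d * b ^ m + n) = e n) :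
    Spec etaCmd σ (fun σ' =>
      (∀ n < b ^ m, σ'.realArr 2 ((d + 1) * b ^ m + n) =
        e n * (1 + γ (d + 1) * phiTab (b ^ m) α (n * Y * y))) ∧
      ∀ c, (∀ n < b ^ m, (d + 1) * b ^ m + n ≠ c) → σ'.realArr 2 c = σ.realArr 2 c)
      (etaCmd.size * (3 * (b ^ m + 1))) := by
  refine (Spec.mapLoop (b ^ m) (fun n => (d + 1) * b ^ m + n)
    (fun n => e n * (1 + γ (d + 1) * phiTab (b ^ m) α (n * Y * y))) (Cmd.size .skip)
    rfl rfl ?_ ?_ ?_).mono ?_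
  · intro i _ i' _ h; rw [Nat.add_left_cancel h]
  · intro σ' hA
    exact (h.of_agree hA rfl).size
  · intro n hn σ' hA h30 _ hold
    have h' := h.of_agree hA rfl
    have h5' : σ'.natReg 5 = d + 1 := by rw [hA.natReg 5 rfl, h5]
    have h8' : σ'.natReg 8 = Y := by rw [hA.natReg 8 rfl, h8]
    have h33' : σ'.natReg 33 = y := by rw [hA.natReg 33 rfl, h33]
    have hprev : σ'.realArr 2 (d * b ^ m + n) = e n := by
      rw [hold, he n hn]
      intro i _ heq
      rw [add_mul d 1, one_mul] at heq
      omega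
    have htab := h'.table _ (Nat.mod_lt (n * Y * y) (pow_pos hb.pos m))
    rw [phiTab_congr (Nat.mod_modEq _ _)] at htab
    refine Spec.skip ?_
    simp [h5', h8', h33', h30, h'.size, hprev, htab, h'.gamma]
  · change _ * (_ + 2 * etaCmd.size) ≤ _
    have := Cmd.size_pos etaCmd
    rw [Cmd.size]
    generalize etaCmd.size = S at *
    nlinarith [Nat.zero_le (b ^ m * S)]

end

/-! ### Bounds for the number of operations in one step -/

/-- The least power of two above 2 b^n is less than 4 b^n, and 4 ≤ b². -/
theorem two_pow_clog_le {b n : ℕ} (hb : 2 ≤ b) : 2 ^ Nat.clog 2 (2 * b ^ n) ≤ b ^ (n + 2) := by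
  have hpos : 0 < b ^ n := pow_pos (by omega) n
  have h := Nat.pow_pred_clog_lt_self one_lt_two (x := 2 * b ^ n) (by omega)
  have hc : 0 < Nat.clog 2 (2 * b ^ n) := Nat.clog_pos one_lt_two (by omega)
  calc 2 ^ Nat.clog 2 (2 * b ^ n) = 2 ^ (Nat.clog 2 (2 * b ^ n) - 1) * 2 := by
        rw [← pow_succ]; congr 1; omega
    _ ≤ 2 * b ^ n * 2 := Nat.mul_le_mul_right _ h.le
    _ = b ^ n * 2 ^ 2 := by ring
    _ ≤ b ^ n * b ^ 2 := Nat.mul_le_mul_left _ (Nat.pow_le_pow_left hb 2)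
    _ = b ^ (n + 2) := by rw [pow_add]

/-- The crude b ≤ 2^b bounds the logarithm of b; the constant may depend on b. -/
theorem clog_le_mul {b n k : ℕ} (hb : 2 ≤ b) (hn : n + 2 ≤ k) :
    Nat.clog 2 (2 * b ^ n) ≤ b * k := by
  apply (Nat.pow_le_pow_iff_right one_lt_two).mp
  calc 2 ^ Nat.clog 2 (2 * b ^ n) ≤ b ^ (n + 2) := two_pow_clog_le hb
    _ ≤ b ^ k := Nat.pow_le_pow_right (by omega) hn
    _ ≤ (2 ^ b) ^ k := Nat.pow_le_pow_left Nat.lt_two_pow_self.le k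
    _ = 2 ^ (b * k) := by rw [pow_mul]

/-- A geometric sum of ratio at least 2. It keeps the k levels from costing a second factor k. -/
theorem sum_pow_sub_le {b : ℕ} (hb : 2 ≤ b) (k : ℕ) :
    ∑ j ∈ range k, b ^ (k + 1 - j) ≤ 2 * b ^ (k + 1) := by
  induction k with
  | zero => simp
  | succ k ih =>
    rw [sum_range_succ']
    have h1 : ∑ j ∈ range k, b ^ (k + 1 + 1 - (j + 1)) = ∑ j ∈ range k, b ^ (k + 1 - j) :=
      sum_congr rfl fun j _ => by rw [Nat.add_sub_add_right]
    have h2 : 2 * b ^ (k + 1) ≤ b ^ (k + 2) := by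
      rw [pow_succ' b (k + 1)]; exact Nat.mul_le_mul_right _ hb
    rw [h1, Nat.sub_zero]
    change _ ≤ 2 * b ^ (k + 2)
    change _ + b ^ (k + 2) ≤ _
    omega

/-- There are b⁴ correlations per level; a further b comes from the logarithm. Here 17 = 4 · 2 · 2 +
1, and 35 = 2 · 17 + 1 after the geometric sum. -/
theorem blocks_cost_le {b : ℕ} (hb : 2 ≤ b) (k : ℕ) :
    ∑ B ∈ range (k * (b ^ 2 * b ^ 2)),
        (4 * ((Nat.clog 2 (2 * b ^ (k - 1 - B / (b ^ 2 * b ^ 2))) + 1) *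
          (2 ^ Nat.clog 2 (2 * b ^ (k - 1 - B / (b ^ 2 * b ^ 2))) + 1)) + 1) + 1 ≤
      35 * b ^ 5 * ((k + 1) * b ^ (k + 1)) := by
  have hb4 : 0 < b ^ 2 * b ^ 2 := by positivity
  have hterm : ∀ j ∈ range k, (4 * ((Nat.clog 2 (2 * b ^ (k - 1 - j)) + 1) *
      (2 ^ Nat.clog 2 (2 * b ^ (k - 1 - j)) + 1)) + 1) ≤ 17 * b * (k + 1) * b ^ (k + 1 - j) := by
    intro j hj
    have hj' := mem_range.mp hj
    have h1 := two_pow_clog_le hb (n := k - 1 - j)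
    rw [show k - 1 - j + 2 = k + 1 - j by omega] at h1
    have h2 := clog_le_mul hb (show k - 1 - j + 2 ≤ k + 1 by omega)
    generalize Nat.clog 2 (2 * b ^ (k - 1 - j)) = l at *
    have h3 : 1 ≤ 2 ^ l := Nat.one_le_two_pow
    generalize 2 ^ l = P at *
    generalize b ^ (k + 1 - j) = R at *
    have h4 : 1 ≤ b * (k + 1) := Nat.mul_pos (by omega) (by omega)
    generalize hU : b * (k + 1) = U at *
    have h5 : (l + 1) * (P + 1) ≤ (2 * U) * (2 * R) :=
      Nat.mul_le_mul (by omega) (by omega)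
    have h6 : 1 ≤ U * R := Nat.mul_pos h4 (by omega)
    calc _ ≤ 4 * (2 * U * (2 * R)) + U * R := by omega
      _ = 17 * U * R := by ring
      _ = _ := by rw [← hU]; ring
  have hsum : ∑ B ∈ range (k * (b ^ 2 * b ^ 2)),
      (4 * ((Nat.clog 2 (2 * b ^ (k - 1 - B / (b ^ 2 * b ^ 2))) + 1) *
        (2 ^ Nat.clog 2 (2 * b ^ (k - 1 - B / (b ^ 2 * b ^ 2))) + 1)) + 1) =
      (b ^ 2 * b ^ 2) * ∑ j ∈ range k, (4 * ((Nat.clog 2 (2 * b ^ (k - 1 - j)) + 1) *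
        (2 ^ Nat.clog 2 (2 * b ^ (k - 1 - j)) + 1)) + 1) := by
    rw [sum_range_mul_add, mul_sum]
    refine sum_congr rfl fun j _ => ?_
    rw [sum_congr rfl (g := fun _ => 4 * ((Nat.clog 2 (2 * b ^ (k - 1 - j)) + 1) *
        (2 ^ Nat.clog 2 (2 * b ^ (k - 1 - j)) + 1)) + 1), sum_const, card_range, smul_eq_mul]
    intro i hi
    rw [mul_comm j, Nat.mul_add_div hb4, Nat.div_eq_of_lt (mem_range.mp hi), add_zero]
  rw [hsum]
  have h1 := (sum_le_sum hterm).trans_eq (mul_sum _ _ _).symm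
  have h2 := h1.trans (Nat.mul_le_mul_left _ (sum_pow_sub_le hb k))
  have h3 : 1 ≤ b ^ 5 * ((k + 1) * b ^ (k + 1)) := Nat.mul_pos (by positivity)
    (Nat.mul_pos (by omega) (by positivity))
  calc _ ≤ (b ^ 2 * b ^ 2) * (17 * b * (k + 1) * (2 * b ^ (k + 1))) +
        b ^ 5 * ((k + 1) * b ^ (k + 1)) := Nat.add_le_add (Nat.mul_le_mul_left _ h2) h3
    _ = _ := by ring

theorem gather_cost_le {b : ℕ} (hb : 2 ≤ b) (k : ℕ) :
    (b ^ 2 * b ^ (k - 1) + 1) * (4 * (b + 1) + 4 * (k * b ^ 2 + 1)) ≤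
      35 * b ^ 5 * ((k + 1) * b ^ (k + 1)) := by
  -- The extra factor b is needed for k = 0 only, where k - 1 is truncated.
  have h1 : b ^ 2 * b ^ (k - 1) ≤ b * b ^ (k + 1) := by
    rw [← pow_add, ← pow_succ']
    exact Nat.pow_le_pow_right (by omega) (by omega)
  have hM : 0 < b ^ (k + 1) := by positivity
  generalize b ^ (k + 1) = M at *
  have h2 : 1 ≤ b * M := Nat.mul_pos (by omega) hM
  have h3 : 4 * (b + 1) + 4 * (k * b ^ 2 + 1) ≤ 16 * (b ^ 2 * (k + 1)) := by
    nlinarith [Nat.zero_le (k * b ^ 2)]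
  have h4 : b ^ 3 ≤ b ^ 5 := Nat.pow_le_pow_right (by omega) (by omega)
  calc _ ≤ (2 * (b * M)) * (16 * (b ^ 2 * (k + 1))) := Nat.mul_le_mul (by omega) h3
    _ = 32 * b ^ 3 * ((k + 1) * M) := by ring
    _ ≤ _ := Nat.mul_le_mul_right _ (by omega)

/-! ### The step for one dimension -/

/-- Chooses `z_d` and leaves it in register `33`. -/
def chooseCmd : Cmd :=
  .ite (.natLe (.reg 5) 1) (.setNat 33 1)
    (.seq foldCmd <| .seq blocksCmd <| .seq gatherCmd argminCmd)

/-- The bound, up to a factor, for the number of operations in one step. -/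
def stepCost (b m k : ℕ) : ℕ := 35 * b ^ 5 * (b ^ m + (k + 1) * b ^ (k + 1))

section

variable {b m s α : ℕ} {w : ℕ → ℕ} {γ : ℕ → ℝ} {D k : ℕ} {σ : State}

theorem chooseCmd_spec (hb : b.Prime) (h : DimEnv b m s α w γ (D + 1) k σ)
    (hk : m - w (D + 1) = k + 1) {z : ℕ → ℕ}
    (he : ∀ n < b ^ m, σ.realArr 2 (D * b ^ m + n) = eta b m α w γ z D n) :
    Spec chooseCmd σ (fun σ' => (D = 0 → σ'.natReg 33 = 1) ∧
      (1 ≤ D → (∀ i < b ^ (k + 1),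
          σ'.realArr 3 ((D + 1) * b ^ m + i) = foldedEta b m α w γ z (D + 1) i) ∧
        (∀ y ∈ searchSet b m (w (D + 1)),
          σ'.realArr 4 ((D + 1) * b ^ m + y) = T b m α w γ z (D + 1) y) ∧
        σ'.natReg 33 ∈ searchSet b m (w (D + 1)) ∧
        ∀ y ∈ searchSet b m (w (D + 1)),
          T b m α w γ z (D + 1) (σ'.natReg 33) ≤ T b m α w γ z (D + 1) y) ∧
      ∀ c < (D + 1) * b ^ m, σ'.realArr 3 c = σ.realArr 3 c ∧ σ'.realArr 4 c = σ.realArr 4 c)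
      (chooseCmd.size * stepCost b m k) := by
  have hb2 := hb.two_le
  have hM : 1 ≤ b ^ (k + 1) := Nat.one_le_pow _ _ hb.pos
  have hY : 1 ≤ b ^ w (D + 1) := Nat.one_le_pow _ _ hb.pos
  have hN : b ^ m = b ^ w (D + 1) * b ^ (k + 1) := by rw [← pow_add]; congr 1; omega
  have hb5 : 1 ≤ b ^ 5 := Nat.one_le_pow _ _ hb.pos
  have hle1 : b ^ (k + 1) ≤ (k + 1) * b ^ (k + 1) := Nat.le_mul_of_pos_left _ (by omega)
  have hstep : ∀ x, x ≤ 35 * (b ^ m + (k + 1) * b ^ (k + 1)) → x ≤ stepCost b m k := by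
    intro x hx
    refine hx.trans ?_
    rw [stepCost]
    exact Nat.mul_le_mul_right _ (by omega)
  have hstep' : ∀ x, x ≤ 35 * b ^ 5 * ((k + 1) * b ^ (k + 1)) → x ≤ stepCost b m k :=
    fun x hx => hx.trans (Nat.mul_le_mul_left _ (Nat.le_add_left _ _))
  have hX1 : 1 ≤ stepCost b m k := hstep _ (by omega)
  refine Spec.iteSize hX1 (fun hc => ?_) (fun hc => ?_)
  · simp only [BExp.Holds, NExp.eval_reg, h.index, NExp.eval_one] at hc
    refine (Spec.setNat ?_).mono (Nat.le_mul_of_pos_right _ hX1)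
    refine ⟨fun _ => by simp, fun h1 => by omega, fun c _ => ⟨rfl, rfl⟩⟩
  · simp only [BExp.Holds, NExp.eval_reg, h.index, NExp.eval_one] at hc
    refine Spec.seqSize ((foldCmd_spec h hk (e := fun n => eta b m α w γ z D n) he).mono
      (Nat.mul_le_mul_left _ (hstep _ ?_))) fun σ₁ h₁ hA₁ => ?_
    -- With M = b^(k+1), Y = b^(w_d) and M Y = b^m, the product (M + 1)(Y + 1) is at most 4 b^m.
    · rw [hN]
      generalize b ^ w (D + 1) = Y at *
      generalize b ^ (k + 1) = M at *
      nlinarith [Nat.mul_le_mul hM hY]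
    have e₁ := h.of_agree hA₁ rfl
    have hfold : ∀ i < b ^ (k + 1),
        σ₁.realArr 3 ((D + 1) * b ^ m + i) = foldedEta b m α w γ z (D + 1) i := fun i hi => by
      rw [h₁.1 i hi, foldedEta, hk, Nat.add_sub_cancel]
    refine Spec.seqSize ((blocksCmd_spec hb e₁ hk hfold).mono
      (Nat.mul_le_mul_left _ (hstep' _ (blocks_cost_le hb2 k)))) fun σ₂ h₂ hA₂ => ?_
    have e₂ := e₁.of_agree hA₂ rfl
    refine Spec.seqSize ((gatherCmd_spec hb e₂ hk
      (fun i hi => (congrFun (hA₂.realArr 3 rfl) _).trans (hfold i hi)) h₂).mono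
      (Nat.mul_le_mul_left _ (hstep' _ (gather_cost_le hb2 k)))) fun σ₃ h₃ hA₃ => ?_
    have e₃ := e₂.of_agree hA₃ rfl
    refine Spec.conseq (argminCmd_spec hb e₃ hk h₃.1)
      (Nat.mul_le_mul_left _ (hstep _ (by omega))) ?_
    rintro σ' ⟨hmem, hmin⟩ hA'
    have r3 : σ'.realArr 3 = σ₁.realArr 3 := by
      rw [hA'.realArr 3 rfl, hA₃.realArr 3 rfl, hA₂.realArr 3 rfl]
    have r4 : σ'.realArr 4 = σ₃.realArr 4 := hA'.realArr 4 rfl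
    refine ⟨fun h0 => by omega, fun _ => ⟨?_, ?_, hmem, hmin⟩, fun c hc => ⟨?_, ?_⟩⟩
    · rw [r3]; exact hfold
    · rw [r4]; exact h₃.1
    · rw [r3, h₁.2 c fun i _ => by omega]
    · rw [r4, h₃.2 c fun i _ => by omega, hA₂.realArr 4 rfl, hA₁.realArr 4 rfl]

/-- The memory holds all results for the dimensions up to `D`. -/
structure Partial (b m s α : ℕ) (w : ℕ → ℕ) (γ : ℕ → ℝ) (D : ℕ) (σ : State) : Prop
    extends Env b m s α w γ σ where
  index : σ.natReg 5 = D + 1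
  first : 1 ≤ D → σ.natArr 1 1 = 1
  folded : ∀ d ∈ Icc 2 D, ∀ i < b ^ (m - w d),
    σ.realArr 3 (d * b ^ m + i) = foldedEta b m α w γ (σ.natArr 1) d i
  product : ∀ d ∈ Icc 2 D, ∀ y ∈ searchSet b m (w d),
    σ.realArr 4 (d * b ^ m + y) = T b m α w γ (σ.natArr 1) d y
  argmin : ∀ d ∈ Icc 2 D, σ.natArr 1 d ∈ searchSet b m (w d) ∧
    ∀ y ∈ searchSet b m (w d),
      T b m α w γ (σ.natArr 1) d (σ.natArr 1 d) ≤ T b m α w γ (σ.natArr 1) d y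
  etas : ∀ d ≤ D, ∀ n < b ^ m,
    σ.realArr 2 (d * b ^ m + n) = eta b m α w γ (σ.natArr 1) d n
  tail : ∀ d, D < d → σ.natArr 1 d = 0

/-- One step of the main loop. -/
def stepCmd : Cmd :=
  .seq (.setNat 6 (.reg 1 - .arr 0 (.reg 5))) <| .seq (.setNat 7 (.arr 2 (.reg 6))) <|
  .seq (.setNat 8 (.arr 2 (.arr 0 (.reg 5)))) <| .seq chooseCmd <|
  .seq (.storeNat 1 (.reg 5) (.reg 33)) <| .seq etaCmd (.setNat 5 (.reg 5 + 1))

theorem stepCmd_spec (hb : b.Prime) (h : Partial b m s α w γ D σ)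
    (hk : m - w (D + 1) = k + 1) :
    Spec stepCmd σ (Partial b m s α w γ (D + 1)) (stepCmd.size * stepCost b m k) := by
  have hNpos : 0 < b ^ m := pow_pos hb.pos _
  have hb5 : 1 ≤ b ^ 5 := Nat.one_le_pow _ _ hb.pos
  have hX : 35 * b ^ m ≤ stepCost b m k := by
    rw [stepCost]
    exact Nat.mul_le_mul (by omega) (Nat.le_add_right _ _)
  have hX1 : ∀ S, S ≤ S * stepCost b m k := fun S => Nat.le_mul_of_pos_right _ (by omega)
  refine Spec.seqSize (R := fun σ' => σ' = σ.setNat 6 (k + 1)) ((Spec.setNat ?_).mono (hX1 _))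
    fun σ₁ h₁ hA₁ => ?_
  · simp [h.expo, h.weight, h.index, hk]
  have e₁ := h.toEnv.of_agree hA₁ rfl
  refine Spec.seqSize (R := fun σ' => σ' = σ₁.setNat 7 (b ^ (k + 1)))
    ((Spec.setNat ?_).mono (hX1 _)) fun σ₂ h₂ hA₂ => ?_
  · rw [NExp.eval_arr, e₁.pow]
    · simp [h₁]
    · simp [h₁]; omega
  have e₂ := e₁.of_agree hA₂ rfl
  refine Spec.seqSize (R := fun σ' => σ' = σ₂.setNat 8 (b ^ w (D + 1)))
    ((Spec.setNat ?_).mono (hX1 _)) fun σ₃ h₃ hA₃ => ?_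
  · have h5 : σ₂.natReg 5 = D + 1 := by simp [h₂, h₁, h.index]
    simp only [NExp.eval_arr, NExp.eval_reg, h5, e₂.weight]
    rw [e₂.pow _ (by omega)]
  have e₃ : DimEnv b m s α w γ (D + 1) k σ₃ :=
    ⟨e₂.of_agree hA₃ rfl, by simp [h₃, h₂, h₁, h.index], by simp [h₃, h₂, h₁],
      by simp [h₃, h₂], by simp [h₃]⟩
  have ra3 : σ₃.realArr = σ.realArr := by simp [h₃, h₂, h₁]
  have na3 : σ₃.natArr = σ.natArr := by simp [h₃, h₂, h₁]
  refine Spec.seqSize (chooseCmd_spec hb e₃ hk (z := σ.natArr 1)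
    (by rw [ra3]; exact h.etas D le_rfl)) fun σ₄ h₄ hA₄ => ?_
  have e₄ := e₃.of_agree hA₄ rfl
  obtain ⟨hfirst, hrest, hold⟩ := h₄
  obtain ⟨y, hy⟩ : ∃ y, y = σ₄.natReg 33 := ⟨_, rfl⟩
  rw [← hy] at hfirst hrest
  refine Spec.seqSize (R := fun σ' => σ' = σ₄.storeNat 1 (D + 1) y)
    ((Spec.storeNat ?_).mono (hX1 _)) fun σ₅ h₅ hA₅ => ?_
  · simp [e₄.index, hy]
  have e₅ : DimEnv b m s α w γ (D + 1) k σ₅ := e₄.of_agree hA₅ rfl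
  have r2 : σ₅.realArr 2 = σ.realArr 2 := by rw [hA₅.realArr 2 rfl, hA₄.realArr 2 rfl, ra3]
  refine Spec.seqSize ((etaCmd_spec hb e₅.toEnv e₅.index e₅.step (y := y) (by simp [h₅, hy])
    (by rw [r2]; exact h.etas D le_rfl)).mono
      (Nat.mul_le_mul_left _ (by omega))) fun σ₆ h₆ hA₆ => ?_
  have e₆ := e₅.of_agree hA₆ rfl
  refine (Spec.setNat ?_).mono (hX1 _)
  have r3 : ∀ c, σ₆.realArr 3 c = σ₄.realArr 3 c := fun c => by
    rw [hA₆.realArr 3 rfl, hA₅.realArr 3 rfl]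
  have r4 : ∀ c, σ₆.realArr 4 c = σ₄.realArr 4 c := fun c => by
    rw [hA₆.realArr 4 rfl, hA₅.realArr 4 rfl]
  have hz : ∀ j, σ₆.natArr 1 j = if j = D + 1 then y else σ.natArr 1 j := by
    intro j
    rw [hA₆.natArr 1 rfl, h₅, State.storeNat_natArr, hA₄.natArr 1 rfl, na3]
    simp
  -- Only component D + 1 of z changes, while the folded vector and `T_d` for d ≤ D + 1 involve
  -- components below d; hence both old and new results refer to the final z.
  have hzlt : ∀ d, d ≤ D + 1 → ∀ j, 1 ≤ j → j < d → σ.natArr 1 j = σ₆.natArr 1 j := by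
    intro d hd j _ hj
    rw [hz, if_neg (by omega)]
  have hrow : ∀ d ≤ D, ∀ i < b ^ m, d * b ^ m + i < (D + 1) * b ^ m := by
    intro d hd i hi
    have : (d + 1) * b ^ m ≤ (D + 1) * b ^ m := Nat.mul_le_mul_right _ (by omega)
    rw [add_mul d 1, one_mul] at this
    omega
  have hpow : ∀ d, b ^ (m - w d) ≤ b ^ m := fun d => Nat.pow_le_pow_right hb.pos (Nat.sub_le _ _)
  have hsearch : ∀ d, ∀ y' ∈ searchSet b m (w d), y' < b ^ m := fun d y' hy' =>
    ((mem_searchSet hb (by omega)).mp hy').1.trans_le (hpow d)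
  refine
    { toEnv := (e₆.toEnv).of_agree (Exec.setNat σ₆ 5 (.reg 5 + 1)).agree rfl
      index := by simp [e₆.index]
      first := fun _ => ?_
      folded := fun d hd i hi => ?_
      product := fun d hd y' hy' => ?_
      argmin := fun d hd => ?_
      etas := fun d hd n hn => ?_
      tail := fun d hd => ?_ }
  · rw [State.setNat_natArr, hz]
    split_ifs with h1
    · exact hfirst (by omega)
    · exact h.first (by omega)
  · rw [State.setNat_natArr, State.setNat_realArr, r3]
    have hd' := mem_Icc.mp hd
    rw [← foldedEta_congr (hzlt d hd'.2)]
    rcases Nat.lt_or_ge d (D + 1) with hlt | hge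
    · rw [(hold _ (hrow d (by omega) i (hi.trans_le (hpow d)))).1, ra3,
        h.folded d (mem_Icc.mpr ⟨hd'.1, by omega⟩) i hi]
    · obtain rfl : d = D + 1 := by omega
      rw [hk] at hi
      exact (hrest (by omega)).1 i hi
  · rw [State.setNat_natArr, State.setNat_realArr, r4]
    have hd' := mem_Icc.mp hd
    rw [← T_congr (hzlt d hd'.2)]
    rcases Nat.lt_or_ge d (D + 1) with hlt | hge
    · rw [(hold _ (hrow d (by omega) y' (hsearch d y' hy'))).2, ra3,
        h.product d (mem_Icc.mpr ⟨hd'.1, by omega⟩) y' hy']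
    · obtain rfl : d = D + 1 := by omega
      exact (hrest (by omega)).2.1 y' hy'
  · rw [State.setNat_natArr]
    have hd' := mem_Icc.mp hd
    have hT : ∀ y', T b m α w γ (σ₆.natArr 1) d y' = T b m α w γ (σ.natArr 1) d y' :=
      fun y' => (T_congr (hzlt d hd'.2) y').symm
    simp only [hT]
    rcases Nat.lt_or_ge d (D + 1) with hlt | hge
    · rw [hz, if_neg (by omega)]
      exact h.argmin d (mem_Icc.mpr ⟨hd'.1, by omega⟩)
    · obtain rfl : d = D + 1 := by omega
      rw [hz, if_pos rfl]
      exact (hrest (by omega)).2.2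
  · rw [State.setNat_natArr, State.setNat_realArr]
    rcases Nat.lt_or_ge d (D + 1) with hlt | hge
    · rw [h₆.2, r2, h.etas d (by omega) n hn]
      · exact eta_congr (fun j h1 h2 => hzlt (D + 1) le_rfl j h1 (by omega)) n
      · intro i _
        have := hrow d (by omega) n hn
        omega
    · obtain rfl : d = D + 1 := by omega
      rw [h₆.1 n hn, eta_succ, hz (D + 1), if_pos rfl]
      rw [eta_congr (fun j h1 h2 => hzlt (D + 1) le_rfl j h1 (by omega))]
  · rw [State.setNat_natArr, hz, if_neg (by omega)]
    exact h.tail d (by omega)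

end

/-! ### Tables -/

/-- Tabulates the powers of `b` and of `1 + b²`. -/
def powersCmd : Cmd :=
  .seq (.setNat 9 (.reg 0 * .reg 0)) <|
  .seq (.storeNat 2 0 1) <| .seq (natLoop 30 (.reg 1) 2 (.reg 30 + 1) (.arr 2 (.reg 30) * .reg 0)) <|
  .seq (.setNat 4 (.arr 2 (.reg 1))) <|
  .seq (.storeNat 3 0 1) <|
    natLoop 30 (.reg 4) 3 (.reg 30 + 1) ((.arr 3 (.reg 30) * (1 + .reg 9)) % .reg 4)

theorem powersCmd_spec {b m : ℕ} (hb : b.Prime) (hm : 1 ≤ m) {σ : State} (h0 : σ.natReg 0 = b)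
    (h1 : σ.natReg 1 = m) :
    Spec powersCmd σ (fun σ' => σ'.natReg 9 = b ^ 2 ∧ σ'.natReg 4 = b ^ m ∧
      (∀ j ≤ m, σ'.natArr 2 j = b ^ j) ∧
      ∀ a ≤ b ^ m, σ'.natArr 3 a = (1 + b ^ 2) ^ a % b ^ m)
      (powersCmd.size * (4 * b ^ m)) := by
  have hmN : m + 1 ≤ b ^ m :=
    (Nat.lt_two_pow_self (n := m)).trans_le (Nat.pow_le_pow_left hb.two_le m)
  have hX : ∀ S, S ≤ S * (4 * b ^ m) := fun S => Nat.le_mul_of_pos_right _ (by omega)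
  have hloop : ∀ n S, n ≤ b ^ m → (n + 1) * (2 * S) ≤ S * (4 * b ^ m) := fun n S hn => by
    calc (n + 1) * (2 * S) ≤ (2 * b ^ m) * (2 * S) := Nat.mul_le_mul_right _ (by omega)
      _ = _ := by ring
  refine Spec.seqSize (R := fun σ' => σ' = σ.setNat 9 (b ^ 2)) ((Spec.setNat ?_).mono (hX _))
    fun σ₁ e₁ hA₁ => ?_
  · simp [h0, sq]
  refine Spec.seqSize (R := fun σ' => σ' = σ₁.storeNat 2 0 1) ((Spec.storeNat ?_).mono (hX _))
    fun σ₂ e₂ hA₂ => ?_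
  · simp
  have h0₂ : σ₂.natReg 0 = b := by simp [e₂, e₁, h0]
  have h1₂ : σ₂.natReg 1 = m := by simp [e₂, e₁, h1]
  refine Spec.seqSize ((Spec.natLoop m (fun j => b ^ j) (by simp [e₂]) ?_).mono
    (hloop _ _ (by omega))) fun σ₃ h₃ hA₃ => ?_
  · intro σ' hA
    refine ⟨by rw [NExp.eval_reg, hA.natReg 1 rfl, h1₂], fun k _ h30 hk => ?_⟩
    have := hA.natReg 0 rfl
    simp [h30, hk, this, h0₂, pow_succ]
  refine Spec.seqSize (R := fun σ' => σ' = σ₃.setNat 4 (b ^ m)) ((Spec.setNat ?_).mono (hX _))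
    fun σ₄ e₄ hA₄ => ?_
  · simp [hA₃.natReg 1 rfl, h1₂, h₃ m le_rfl]
  refine Spec.seqSize (R := fun σ' => σ' = σ₄.storeNat 3 0 1) ((Spec.storeNat ?_).mono (hX _))
    fun σ₅ e₅ hA₅ => ?_
  · simp
  have h4₅ : σ₅.natReg 4 = b ^ m := by simp [e₅, e₄]
  have h9₅ : σ₅.natReg 9 = b ^ 2 := by
    rw [hA₅.natReg 9 rfl, hA₄.natReg 9 rfl, hA₃.natReg 9 rfl, hA₂.natReg 9 rfl, e₁]; simp
  refine Spec.conseq (Spec.natLoop (b ^ m) (fun a => (1 + b ^ 2) ^ a % b ^ m) ?_ ?_)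
    (hloop _ _ le_rfl) ?_
  -- Here m ≥ 1 matters: modulo b^0 the initial entry would have to be 0.
  · simp [e₅, Nat.mod_eq_of_lt (Nat.one_lt_pow (by omega : m ≠ 0) hb.one_lt)]
  · intro σ' hA
    refine ⟨by rw [NExp.eval_reg, hA.natReg 4 rfl, h4₅], fun k _ h30 hk => ?_⟩
    have g9 := hA.natReg 9 rfl
    have g4 := hA.natReg 4 rfl
    simp [h30, hk, g9, g4, h9₅, h4₅, pow_succ, Nat.mod_mul_mod]
  · intro σ' h hA
    refine ⟨by rw [hA.natReg 9 rfl, h9₅], by rw [hA.natReg 4 rfl, h4₅], fun j hj => ?_, h⟩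
    rw [hA.natArr 2 rfl, hA₅.natArr 2 rfl, hA₄.natArr 2 rfl]
    exact h₃ j hj

/-- Tabulates `1 / i!` and `B_i / i!` and computes the constant factor of `φ_α`. -/
def bernoulliCmd : Cmd :=
  .seq (.storeReal 6 0 1) <|
  .seq (mapLoop 30 (.reg 3 + 1) .skip 6 (.reg 30 + 1) (.arr 6 (.reg 30) / .ofNat (.reg 30 + 1))) <|
  .seq (mapLoop 30 (.reg 3 + 1)
    (recLoop 1 31 (.reg 30) 0 (.reg 1 + .arr 7 (.reg 31) * .arr 6 (.reg 30 + 1 - .reg 31)))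
    7 (.reg 30) (.ofNat (1 - .reg 30) - .reg 1)) <|
  recLoop 3 31 (.reg 3 / 2) (0 - 1) (.reg 3 * (0 - 4 * (.pi * .pi)))

theorem bernoulliCmd_spec {α : ℕ} {σ : State} (h3 : σ.natReg 3 = α) :
    Spec bernoulliCmd σ (fun σ' =>
      (∀ i ≤ α + 1, σ'.realArr 6 i = 1 / (i.factorial : ℝ)) ∧
      (∀ i ≤ α, σ'.realArr 7 i = bernoulliCoeff i) ∧
      σ'.realReg 3 = -(-(4 * Real.pi ^ 2)) ^ (α / 2))
      (bernoulliCmd.size * (6 * (α + 2) ^ 2)) := by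
  have hX : ∀ S, S ≤ S * (6 * (α + 2) ^ 2) := fun S => Nat.le_mul_of_pos_right _ (by positivity)
  refine Spec.seqSize (R := fun σ' => σ' = σ.storeReal 6 0 1) ((Spec.storeReal ?_).mono (hX _))
    fun σ₁ e₁ hA₁ => ?_
  · simp
  have g3₁ : σ₁.natReg 3 = α := by simp [e₁, h3]
  refine Spec.seqSize ((Spec.mapLoop (α + 1) (fun k => k + 1)
    (fun k => 1 / ((k + 1).factorial : ℝ)) (Cmd.size .skip) rfl rfl ?_ ?_ ?_).mono ?_)
    fun σ₂ h₂ hA₂ => ?_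
  · intro k _ k' _ h; rw [Nat.succ_injective h]
  · intro σ' hA
    rw [NExp.eval_add, NExp.eval_reg, NExp.eval_one, hA.natReg 3 rfl, g3₁]
  · intro k _ σ' hA h30 hprev hold
    refine Spec.skip ⟨by simp [h30], ?_⟩
    have hk : σ'.realArr 6 k = 1 / (k.factorial : ℝ) := by
      cases k with
      | zero => rw [hold 0 (fun _ _ => Nat.succ_ne_zero _), e₁]; simp
      | succ k => exact hprev k (Nat.lt_succ_self k)
    simp only [RExp.eval_div, RExp.eval_arr, NExp.eval_reg, h30, hk, RExp.eval_ofNat,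
      NExp.eval_add, NExp.eval_one, Nat.factorial_succ]
    push_cast
    rw [div_div, mul_comm]
  · generalize hS : (mapLoop 30 (.reg 3 + 1) .skip 6 (.reg 30 + 1)
      (.arr 6 (.reg 30) / .ofNat (.reg 30 + 1))).size = S
    have hS1 : 1 ≤ S := by rw [← hS]; exact Cmd.size_pos _
    rw [Cmd.size]
    nlinarith [Nat.zero_le (α * S), Nat.zero_le (α * α * S)]
  have g3₂ : σ₂.natReg 3 = α := by rw [hA₂.natReg 3 rfl, g3₁]
  have h6₂ : ∀ i ≤ α + 1, σ₂.realArr 6 i = 1 / (i.factorial : ℝ) := by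
    intro i hi
    cases i with
    | zero => rw [h₂.2 0 (fun _ _ => Nat.succ_ne_zero _), e₁]; simp
    | succ i => exact h₂.1 i (by omega)
  refine Spec.seqSize ((Spec.mapLoop (α + 1) (fun k => k) bernoulliCoeff
    ((α + 2) * (2 * (recLoop 1 31 (.reg 30) 0
      (.reg 1 + .arr 7 (.reg 31) * .arr 6 (.reg 30 + 1 - .reg 31))).size))
    rfl rfl ?_ ?_ ?_).mono ?_) fun σ₃ h₃ hA₃ => ?_
  · intro k _ k' _ h; rw [h]
  · intro σ' hA
    rw [NExp.eval_add, NExp.eval_reg, NExp.eval_one, hA.natReg 3 rfl, g3₂]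
  · intro n hn σ' hA h30 hprev _
    refine Spec.conseq (Spec.recLoop n (fun k => ∑ i ∈ range k,
      bernoulliCoeff i * (1 / ((n + 1 - i).factorial : ℝ))) (by simp) ?_)
      (Nat.mul_le_mul_right _ (by omega)) ?_
    · intro σ'' hA'
      have h30' : σ''.natReg 30 = n := by rw [hA'.natReg 30 rfl, h30]
      refine ⟨h30', fun k hk h31 h1 => ?_⟩
      have g7 := hprev k hk
      have g6 := h6₂ (n + 1 - k) (by omega)
      rw [← hA'.realArr 7 rfl] at g7
      rw [← hA.realArr 6 rfl, ← hA'.realArr 6 rfl] at g6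
      rw [sum_range_succ]
      simp [h1, h31, h30', g7, g6]
    · intro σ'' h1 hA'
      have h30' : σ''.natReg 30 = n := by rw [hA'.natReg 30 rfl, h30]
      rw [bernoulliCoeff_rec]
      simp [h1, h30']
  · have hs : (recLoop 1 31 (.reg 30) 0
        (.reg 1 + .arr 7 (.reg 31) * .arr 6 (.reg 30 + 1 - .reg 31))).size ≤
      (mapLoop 30 (.reg 3 + 1)
        (recLoop 1 31 (.reg 30) 0 (.reg 1 + .arr 7 (.reg 31) * .arr 6 (.reg 30 + 1 - .reg 31)))
        7 (.reg 30) (.ofNat (1 - .reg 30) - .reg 1)).size := by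
      conv_rhs => rw [mapLoop, forNat]
      simp only [Cmd.size]; omega
    calc _ ≤ (α + 2) * ((α + 2) * (2 * (mapLoop 30 (.reg 3 + 1)
        (recLoop 1 31 (.reg 30) 0 (.reg 1 + .arr 7 (.reg 31) * .arr 6 (.reg 30 + 1 - .reg 31)))
        7 (.reg 30) (.ofNat (1 - .reg 30) - .reg 1)).size) + 2 * (mapLoop 30 (.reg 3 + 1)
        (recLoop 1 31 (.reg 30) 0 (.reg 1 + .arr 7 (.reg 31) * .arr 6 (.reg 30 + 1 - .reg 31)))
        7 (.reg 30) (.ofNat (1 - .reg 30) - .reg 1)).size) := by gcongr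
      _ ≤ _ := by
        generalize (mapLoop 30 _ _ 7 _ _).size = S
        nlinarith [Nat.zero_le (α * S), Nat.zero_le (α * α * S)]
  have g3₃ : σ₃.natReg 3 = α := by rw [hA₃.natReg 3 rfl, g3₂]
  refine Spec.conseq (Spec.recLoop (α / 2) (fun k => -(-(4 * Real.pi ^ 2)) ^ k) (by simp) ?_)
    ?_ ?_
  · intro σ' hA
    refine ⟨by simp [hA.natReg 3 rfl, g3₃], fun k _ _ hr => ?_⟩
    simp only [RExp.eval_mul, RExp.eval_reg, hr, RExp.eval_sub, RExp.eval_zero, RExp.eval_natLit,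
      RExp.eval_pi]
    ring
  · generalize (recLoop 3 31 _ _ _).size = S
    have : α / 2 ≤ α := Nat.div_le_self _ _
    calc _ ≤ (α + 1) * (2 * S) := Nat.mul_le_mul_right _ (by omega)
      _ ≤ _ := by nlinarith [Nat.zero_le (α * S), Nat.zero_le (α * α * S)]
  · intro σ' h hA
    refine ⟨fun i hi => ?_, fun i hi => ?_, h⟩
    · rw [hA.realArr 6 rfl, hA₃.realArr 6 rfl, h6₂ i hi]
    · rw [hA.realArr 7 rfl, h₃.1 i (by omega)]

/-- Tabulates `φ_α` by means of the Bernoulli polynomial. -/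
def tableCmd : Cmd :=
  mapLoop 30 (.reg 4)
    (.seq (.setReal 4 (.ofNat (.reg 30) / .ofNat (.reg 4))) <|
      recLoop 1 31 (.reg 3 + 1) 0
        (.reg 1 * .reg 4 + .arr 7 (.reg 31) * .arr 6 (.reg 3 - .reg 31)))
    1 (.reg 30) (.reg 3 * .reg 1)

theorem tableCmd_spec {b m α : ℕ} (hb : b.Prime) (h0 : 0 < α) (hα : Even α) {σ : State}
    (g3 : σ.natReg 3 = α) (g4 : σ.natReg 4 = b ^ m)
    (h6 : ∀ i ≤ α + 1, σ.realArr 6 i = 1 / (i.factorial : ℝ))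
    (h7 : ∀ i ≤ α, σ.realArr 7 i = bernoulliCoeff i)
    (h3 : σ.realReg 3 = -(-(4 * Real.pi ^ 2)) ^ (α / 2)) :
    Spec tableCmd σ (fun σ' => ∀ n < b ^ m, σ'.realArr 1 n = phiTab (b ^ m) α n)
      (tableCmd.size * (10 * ((α + 2) * b ^ m))) := by
  have hNpos : 0 < b ^ m := pow_pos hb.pos _
  refine Spec.conseq (Spec.mapLoop (b ^ m) (fun n => n) (phiTab (b ^ m) α)
    ((Cmd.setReal 4 (.ofNat (.reg 30) / .ofNat (.reg 4))).size +
      (α + 1 + 1) * (2 * (recLoop 1 31 (.reg 3 + 1) 0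
        (.reg 1 * .reg 4 + .arr 7 (.reg 31) * .arr 6 (.reg 3 - .reg 31))).size))
    rfl rfl ?_ ?_ ?_) ?_ fun σ' h _ => h.1
  · intro k _ k' _ h; rw [h]
  · intro σ' hA
    rw [NExp.eval_reg, hA.natReg 4 rfl, g4]
  · intro n hn σ' hA h30 _ _
    obtain ⟨x, hx⟩ : ∃ x : ℝ, x = (n : ℝ) / ((b ^ m : ℕ) : ℝ) := ⟨_, rfl⟩
    refine Spec.seq (R := fun σ'' => σ'' = σ'.setReal 4 x) (Spec.setReal ?_) fun σ₁ e₁ hA₁ => ?_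
    · simp only [RExp.eval_div, RExp.eval_ofNat, NExp.eval_reg, h30, hA.natReg 4 rfl, g4, hx]
    have k3 : σ₁.natReg 3 = α := by rw [hA₁.natReg 3 rfl, hA.natReg 3 rfl, g3]
    -- Horner's scheme: after j rounds the accumulator holds the leading j coefficients as a
    -- polynomial of degree at most j - 1. For j = 0 the sum is empty, so the truncated exponent
    -- does no harm.
    refine Spec.conseq (Spec.recLoop (α + 1) (fun j => ∑ i ∈ range j,
      bernoulliCoeff i * (1 / ((α - i).factorial : ℝ)) * x ^ (j - 1 - i)) (by simp) ?_) le_rfl ?_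
    · intro σ'' hA'
      have k3' : σ''.natReg 3 = α := by rw [hA'.natReg 3 rfl, k3]
      refine ⟨by simp [k3'], fun k hk h31 h1 => ?_⟩
      have q4 : σ''.realReg 4 = x := by rw [hA'.realReg 4 rfl, e₁]; simp
      have q7 := h7 k (by omega)
      rw [← hA.realArr 7 rfl, ← hA₁.realArr 7 rfl, ← hA'.realArr 7 rfl] at q7
      have q6 := h6 (α - k) (by omega)
      rw [← hA.realArr 6 rfl, ← hA₁.realArr 6 rfl, ← hA'.realArr 6 rfl] at q6
      simp only [RExp.eval_add, RExp.eval_mul, RExp.eval_reg, RExp.eval_arr, NExp.eval_reg,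
        NExp.eval_sub, h31, k3', q4, q6, q7, h1]
      rw [sum_range_succ, sum_mul, Nat.add_sub_cancel, Nat.sub_self, pow_zero, mul_one]
      congr 1
      refine sum_congr rfl fun i hi => ?_
      have := mem_range.mp hi
      rw [mul_assoc, ← pow_succ, show k - 1 - i + 1 = k - i by omega]
    · intro σ'' h1 hA'
      have h30' : σ''.natReg 30 = n := by
        rw [hA'.natReg 30 rfl, hA₁.natReg 30 rfl, h30]
      refine ⟨h30', ?_⟩
      have q3 : σ''.realReg 3 = -(-(4 * Real.pi ^ 2)) ^ (α / 2) := by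
        rw [hA'.realReg 3 rfl, hA₁.realReg 3 rfl, hA.realReg 3 rfl, h3]
      have hNR : (0 : ℝ) < ((b ^ m : ℕ) : ℝ) := by exact_mod_cast hNpos
      have hx01 : x ∈ Set.Icc (0 : ℝ) 1 := by
        rw [hx]
        refine ⟨by positivity, (div_le_one hNR).mpr ?_⟩
        exact_mod_cast hn.le
      rw [RExp.eval_mul, RExp.eval_reg, RExp.eval_reg, q3, h1, Nat.add_sub_cancel,
        ← bernoulliFun_div_factorial, phiTab, Nat.mod_eq_of_lt hn, ← hx,
        phi_eq_bernoulliFun h0 hα hx01]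
      ring
  · change _ * (_ + 2 * tableCmd.size) ≤ _
    have hs : (Cmd.setReal 4 (.ofNat (.reg 30) / .ofNat (.reg 4))).size +
        (recLoop 1 31 (.reg 3 + 1) 0
          (.reg 1 * .reg 4 + .arr 7 (.reg 31) * .arr 6 (.reg 3 - .reg 31))).size ≤
        tableCmd.size := by
      simp only [tableCmd, mapLoop, forNat, Cmd.size]; omega
    generalize tableCmd.size = S at *
    generalize (recLoop 1 31 _ _ _).size = A at *
    generalize (Cmd.setReal 4 _).size = B at *
    have h1 : (α + 1 + 1) * (2 * A) ≤ (α + 2) * (2 * S) := Nat.mul_le_mul_left _ (by omega)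
    calc _ ≤ (2 * b ^ m) * (S + (α + 2) * (2 * S) + 2 * S) :=
          Nat.mul_le_mul (by omega) (by omega)
      _ ≤ _ := by nlinarith [Nat.zero_le (α * b ^ m * S), Nat.zero_le (b ^ m * S)]

/-- All tables, and `η_0 = 1`. -/
def setupCmd : Cmd :=
  .seq powersCmd <| .seq bernoulliCmd <| .seq tableCmd <|
  .seq (mapLoop 30 (.reg 4) .skip 2 (.reg 30) 1) (.setNat 5 1)

theorem setupCmd_spec {b m s α : ℕ} (hb : b.Prime) (hm : 1 ≤ m) (h0 : 0 < α) (hα : Even α)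
    (w : ℕ → ℕ) (γ : ℕ → ℝ) :
    Spec setupCmd (initialState b m s α w γ) (Partial b m s α w γ 0)
      (setupCmd.size * (10 * (α + 2) ^ 2 * b ^ m)) := by
  have hNpos : 0 < b ^ m := pow_pos hb.pos _
  refine Spec.seqSize ((powersCmd_spec hb hm rfl rfl).mono (Nat.mul_le_mul_left _ ?_))
    fun σ₁ h₁ hA₁ => ?_
  · nlinarith [Nat.zero_le (α * b ^ m), Nat.zero_le (α * α * b ^ m)]
  refine Spec.seqSize ((bernoulliCmd_spec (α := α) ((hA₁.natReg 3 rfl).trans rfl)).mono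
    (Nat.mul_le_mul_left _ ?_)) fun σ₂ h₂ hA₂ => ?_
  · generalize (α + 2) ^ 2 = A
    nlinarith
  refine Spec.seqSize ((tableCmd_spec (b := b) (m := m) hb h0 hα
    ((hA₂.natReg 3 rfl).trans ((hA₁.natReg 3 rfl).trans rfl))
    ((hA₂.natReg 4 rfl).trans h₁.2.1) h₂.1 h₂.2.1 h₂.2.2).mono
    (Nat.mul_le_mul_left _ ?_)) fun σ₃ h₃ hA₃ => ?_
  · nlinarith [Nat.zero_le (α * b ^ m), Nat.zero_le (α * α * b ^ m)]
  have g4 : σ₃.natReg 4 = b ^ m := by rw [hA₃.natReg 4 rfl, hA₂.natReg 4 rfl, h₁.2.1]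
  refine Spec.seqSize ((Spec.mapLoop (b ^ m) (fun n => n) (fun _ => 1) (Cmd.size .skip) rfl rfl
    (fun _ _ _ _ _ => rfl) ?_ ?_).mono ?_) fun σ₄ h₄ hA₄ => ?_
  · intro σ' hA
    rw [NExp.eval_reg, hA.natReg 4 rfl, g4]
  · intro n _ σ' _ h30 _ _
    exact Spec.skip ⟨h30, by simp⟩
  · have hS : 0 < (mapLoop 30 (.reg 4) .skip 2 (.reg 30) 1).size := Cmd.size_pos _
    generalize (mapLoop 30 (.reg 4) .skip 2 (.reg 30) 1).size = S at *
    rw [Cmd.size]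
    calc (b ^ m + 1) * (1 + 2 * S) ≤ (2 * b ^ m) * (3 * S) :=
          Nat.mul_le_mul (by omega) (by omega)
      _ ≤ _ := by
        nlinarith [Nat.zero_le (α * b ^ m * S), Nat.zero_le (α * α * b ^ m * S),
          Nat.zero_le (b ^ m * S)]
  refine (Spec.setNat ?_).mono (Nat.le_mul_of_pos_right _ (by positivity))
  -- The setup does not touch array 1, which is zero initially; this is the source of z_d = 0 for
  -- the inactive d.
  have hz : ∀ j, (σ₄.setNat 5 1).natArr 1 j = 0 := by
    intro j
    rw [State.setNat_natArr, hA₄.natArr 1 rfl, hA₃.natArr 1 rfl, hA₂.natArr 1 rfl,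
      hA₁.natArr 1 rfl]
    rfl
  have hreg : ∀ i, i < 4 → (σ₄.setNat 5 1).natReg i = (initialState b m s α w γ).natReg i := by
    intro i hi
    interval_cases i
    · exact (hA₄.natReg 0 rfl).trans ((hA₃.natReg 0 rfl).trans
        ((hA₂.natReg 0 rfl).trans (hA₁.natReg 0 rfl)))
    · exact (hA₄.natReg 1 rfl).trans ((hA₃.natReg 1 rfl).trans
        ((hA₂.natReg 1 rfl).trans (hA₁.natReg 1 rfl)))
    · exact (hA₄.natReg 2 rfl).trans ((hA₃.natReg 2 rfl).trans
        ((hA₂.natReg 2 rfl).trans (hA₁.natReg 2 rfl)))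
    · exact (hA₄.natReg 3 rfl).trans ((hA₃.natReg 3 rfl).trans
        ((hA₂.natReg 3 rfl).trans (hA₁.natReg 3 rfl)))
  refine
    { base := (hreg 0 (by norm_num)).trans rfl
      expo := (hreg 1 (by norm_num)).trans rfl
      dim := (hreg 2 (by norm_num)).trans rfl
      size := ?_
      sq := ?_
      weight := fun j => ?_
      gamma := fun j => ?_
      pow := fun j hj => ?_
      gen := fun a ha => ?_
      table := fun n hn => ?_
      index := by simp
      first := fun h => by omega
      folded := fun d hd => by simp at hd
      product := fun d hd => by simp at hd
      argmin := fun d hd => by simp at hd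
      etas := fun d hd n hn => ?_
      tail := fun d _ => hz d }
  · simp [hA₄.natReg 4 rfl, g4]
  · rw [State.setNat_natReg, if_neg (by norm_num), hA₄.natReg 9 rfl, hA₃.natReg 9 rfl,
      hA₂.natReg 9 rfl, h₁.1]
  · rw [State.setNat_natArr, hA₄.natArr 0 rfl, hA₃.natArr 0 rfl, hA₂.natArr 0 rfl,
      hA₁.natArr 0 rfl]
    simp [initialState]
  · rw [State.setNat_realArr, hA₄.realArr 0 rfl, hA₃.realArr 0 rfl, hA₂.realArr 0 rfl,
      hA₁.realArr 0 rfl]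
    simp [initialState]
  · rw [State.setNat_natArr, hA₄.natArr 2 rfl, hA₃.natArr 2 rfl, hA₂.natArr 2 rfl,
      h₁.2.2.1 j hj]
  · rw [State.setNat_natArr, hA₄.natArr 3 rfl, hA₃.natArr 3 rfl, hA₂.natArr 3 rfl,
      h₁.2.2.2 a ha]
  · rw [State.setNat_realArr, hA₄.realArr 1 rfl, h₃ n hn]
  · obtain rfl : d = 0 := by omega
    rw [State.setNat_realArr, zero_mul, zero_add, h₄.1 n hn, eta]
    simp

/-! ### The whole algorithm -/

/-- The steps for all `d ≤ min {s, s*}`. -/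
def mainLoop : Cmd :=
  .while (.and (.natLe (.reg 5) (.reg 2)) (.not (.natLe (.reg 1) (.arr 0 (.reg 5))))) stepCmd

theorem activeDim_le (m s : ℕ) (w : ℕ → ℕ) : activeDim m s w ≤ s := Nat.findGreatest_le s

/-- Monotonicity of w makes the active dimensions an initial segment, so the main loop may stop at
the first w_d ≥ m. -/
theorem lt_of_le_activeDim {m s : ℕ} {w : ℕ → ℕ}
    (hw : ∀ i j, 1 ≤ i → i ≤ j → j ≤ s → w i ≤ w j) {d : ℕ} (h1 : 1 ≤ d)
    (hd : d ≤ activeDim m s w) : w d < m := by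
  have h := Nat.findGreatest_of_ne_zero (P := fun d => w d < m) (n := s) (m := activeDim m s w)
    rfl (by omega)
  exact (hw d _ h1 hd (activeDim_le m s w)).trans_lt h

theorem le_of_activeDim_lt {m s : ℕ} {w : ℕ → ℕ} {d : ℕ} (h : activeDim m s w < d) (hd : d ≤ s) :
    m ≤ w d :=
  not_lt.mp (Nat.findGreatest_is_greatest (P := fun d => w d < m) h hd)

theorem mainLoop_spec {b m s α : ℕ} (hb : b.Prime) {w : ℕ → ℕ}
    (hw : ∀ i j, 1 ≤ i → i ≤ j → j ≤ s → w i ≤ w j) {γ : ℕ → ℝ} {σ : State}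
    (h : Partial b m s α w γ 0 σ) :
    Spec mainLoop σ (Partial b m s α w γ (activeDim m s w))
      (mainLoop.size * (35 * b ^ 5 + 2) * costBound b m s w) := by
  refine (Spec.whileLoop (activeDim m s w) (Partial b m s α w γ)
    (fun D => stepCmd.size * stepCost b m (m - w (D + 1) - 1)) h ?_ ?_).mono ?_
  · intro D hD σ' h' _
    have hlt : w (D + 1) < m := lt_of_le_activeDim hw (Nat.succ_pos D) hD
    have hs := activeDim_le m s w
    refine ⟨?_, stepCmd_spec hb h' (by omega)⟩
    simp [BExp.Holds, h'.index, h'.dim, h'.expo, h'.weight]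
    omega
  · intro σ' h' _
    simp only [BExp.Holds, NExp.eval_reg, NExp.eval_arr, h'.index, h'.dim, h'.expo, h'.weight,
      not_and, not_not]
    intro hs
    exact le_of_activeDim_lt (Nat.lt_succ_self _) hs
  · generalize hr : activeDim m s w = r
    rw [costBound, hr]
    have hstep : ∀ D ∈ range r, stepCost b m (m - w (D + 1) - 1) =
        35 * b ^ 5 * (b ^ m + (m - w (D + 1)) * b ^ (m - w (D + 1))) := by
      intro D hD
      have hlt : w (D + 1) < m := lt_of_le_activeDim hw (Nat.succ_pos D) (by rw [hr]; exact mem_range.mp hD)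
      rw [stepCost, show m - w (D + 1) - 1 + 1 = m - w (D + 1) by omega]
    have hIcc : ∑ d ∈ Icc 1 r, (m - w d) * b ^ (m - w d) =
        ∑ D ∈ range r, (m - w (D + 1)) * b ^ (m - w (D + 1)) := by
      rw [range_eq_Ico, sum_Ico_add' (fun d => (m - w d) * b ^ (m - w d)) 0 r 1]
      rfl
    have hsum : ∑ D ∈ range r, stepCost b m (m - w (D + 1) - 1) =
        35 * b ^ 5 * (r * b ^ m + ∑ d ∈ Icc 1 r, (m - w d) * b ^ (m - w d)) := by
      rw [sum_congr rfl hstep, ← mul_sum, sum_add_distrib, sum_const, card_range, smul_eq_mul, hIcc]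
    generalize ∑ d ∈ Icc 1 r, (m - w d) * b ^ (m - w d) = U at *
    simp only [add_assoc, sum_add_distrib (f := fun D => stepCmd.size * _), ← mul_sum, hsum,
      sum_const, card_range, smul_eq_mul]
    have hsize : mainLoop.size = (BExp.and (.natLe (.reg 5) (.reg 2))
      (.not (.natLe (.reg 1) (.arr 0 (.reg 5))))).cost + 1 + stepCmd.size := rfl
    have hN : 1 ≤ b ^ m := Nat.one_le_pow _ _ hb.pos
    -- The r successful loop tests are absorbed by the term r b^m of the bound.
    have hrN : r ≤ r * b ^ m := Nat.le_mul_of_pos_right _ hN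
    rw [hsize]
    generalize (BExp.and _ _).cost + 1 = A
    generalize stepCmd.size = B
    generalize r * b ^ m = V at *
    generalize b ^ m = N at *
    generalize 35 * b ^ 5 = K
    have h1 : B * (K * (V + U)) ≤ (A + B) * (K * (N + (V + U))) :=
      Nat.mul_le_mul (by omega) (Nat.mul_le_mul_left _ (by omega))
    have h2 : r * A ≤ (A + B) * (N + (V + U)) := by
      rw [mul_comm]; exact Nat.mul_le_mul (by omega) (by omega)
    have h3 : A ≤ (A + B) * (N + (V + U)) := by
      calc A = A * 1 := (mul_one A).symm
        _ ≤ _ := Nat.mul_le_mul (by omega) (by omega)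
    calc _ ≤ (A + B) * (K * (N + (V + U))) + (A + B) * (N + (V + U)) +
          (A + B) * (N + (V + U)) := by omega
      _ = _ := by ring

/-- Computes `η_1` if no dimension is active. -/
def firstEtaCmd : Cmd :=
  .ite (.natLe (.reg 5) 1) (.seq (.setNat 33 0) etaCmd) .skip

/-- Computes `-1 + N⁻¹ ∑ η_r(n)`. -/
def errorCmd : Cmd :=
  .seq (recLoop 1 31 (.reg 4) 0 (.reg 1 + .arr 2 ((.reg 5 - 1) * .reg 4 + .reg 31)))
    (.setReal 0 ((0 - 1) + 1 / .ofNat (.reg 4) * .reg 1))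

/-- The reduced fast component-by-component algorithm. -/
def algorithm : Cmd :=
  .seq setupCmd <| .seq mainLoop <| .seq firstEtaCmd errorCmd

section

variable {b m s α r : ℕ} {w : ℕ → ℕ} {γ : ℕ → ℝ} {σ : State}

theorem firstEtaCmd_spec (hb : b.Prime) (h : Partial b m s α w γ r σ) :
    Spec firstEtaCmd σ (fun σ' => Partial b m s α w γ r σ' ∧
      ∀ d ∈ Icc 1 (max 1 r), ∀ n < b ^ m,
        σ'.realArr 2 (d * b ^ m + n) = eta b m α w γ (σ'.natArr 1) d n)
      (firstEtaCmd.size * (6 * b ^ m)) := by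
  have hN : 0 < b ^ m := pow_pos hb.pos _
  refine Spec.iteSize (by omega) (fun hc => ?_) (fun hc => ?_)
  · simp only [BExp.Holds, NExp.eval_reg, h.index, NExp.eval_one] at hc
    obtain rfl : r = 0 := by omega
    refine Spec.seqSize (R := fun σ' => σ' = σ.setNat 33 0) ((Spec.setNat (by simp)).mono
      (Nat.le_mul_of_pos_right _ (by omega))) fun σ₁ e₁ hA₁ => ?_
    have env₁ := h.toEnv.of_agree hA₁ rfl
    refine Spec.conseq (etaCmd_spec (d := 0) hb env₁ (by rw [hA₁.natReg 5 rfl, h.index]) rfl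
      (y := 0) (by simp [e₁]) (e := fun n => eta b m α w γ (σ.natArr 1) 0 n) fun n hn => ?_)
      (Nat.mul_le_mul_left _ (by omega)) ?_
    · rw [hA₁.realArr 2 rfl]; exact h.etas 0 le_rfl n hn
    · rintro σ' ⟨hnew, hold⟩ hA
      have r1 : σ'.natArr 1 = σ.natArr 1 := by rw [hA.natArr 1 rfl, hA₁.natArr 1 rfl]
      refine ⟨⟨env₁.of_agree hA rfl, ?_, fun h => by omega, fun d hd => by simp at hd,
        fun d hd => by simp at hd, fun d hd => by simp at hd, fun d hd n hn => ?_, ?_⟩, ?_⟩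
      · rw [hA.natReg 5 rfl, hA₁.natReg 5 rfl, h.index]
      · obtain rfl : d = 0 := by omega
        rw [hold, hA₁.realArr 2 rfl, r1, h.etas 0 le_rfl n hn]
        intro i _
        omega
      · rw [r1]; exact h.tail
      · intro d hd n hn
        obtain rfl : d = 1 := by simpa using hd
        -- Since z_1 = 0, the argument of φ_α is 0 whatever step is in register 8, which has not
        -- been set in this case.
        rw [show (1 : ℕ) = 0 + 1 from rfl, hnew n hn, eta_succ, r1, h.tail (0 + 1) (by omega)]
        simp
  · simp only [BExp.Holds, NExp.eval_reg, h.index, NExp.eval_one] at hc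
    refine (Spec.skip ⟨h, fun d hd n hn => h.etas d ?_ n hn⟩).mono
      (Nat.le_mul_of_pos_right _ (by omega))
    have := mem_Icc.mp hd
    omega

theorem errorCmd_spec (hb : b.Prime) (h : Partial b m s α w γ r σ) :
    Spec errorCmd σ (fun σ' => σ'.realReg 0 = -1 + (1 / ((b ^ m : ℕ) : ℝ)) *
      ∑ n ∈ range (b ^ m), eta b m α w γ (σ.natArr 1) r n)
      (errorCmd.size * (4 * b ^ m)) := by
  have hN : 0 < b ^ m := pow_pos hb.pos _
  refine Spec.seqSize ((Spec.recLoop (b ^ m) (fun k => ∑ n ∈ range k,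
    eta b m α w γ (σ.natArr 1) r n) (by simp) fun σ' hA => ?_).mono ?_) fun σ₁ h₁ hA₁ => ?_
  · have h' := h.toEnv.of_agree hA rfl
    refine ⟨h'.size, fun n hn h31 h1 => ?_⟩
    have g5 : σ'.natReg 5 = r + 1 := by rw [hA.natReg 5 rfl, h.index]
    have he := h.etas r le_rfl n hn
    rw [← hA.realArr 2 rfl] at he
    rw [sum_range_succ]
    simp [h31, h1, g5, h'.size, he]
  · generalize (recLoop 1 31 _ _ _).size = S
    calc _ ≤ (2 * b ^ m) * (2 * S) := Nat.mul_le_mul_right _ (by omega)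
      _ = _ := by ring
  · have h' := h.toEnv.of_agree hA₁ rfl
    refine (Spec.setReal ?_).mono (Nat.le_mul_of_pos_right _ (by omega))
    simp [h₁, h'.size]

end

/-- The program sizes are fixed numbers, so the factor in front of `costBound` depends on b and α
only. Setup, first η and error value are paid by the term b^m. -/
theorem algorithm_spec {b m s α : ℕ} (hb : b.Prime) (hm : 1 ≤ m) (h0 : 0 < α)
    (hα : Even α) {w : ℕ → ℕ} (hw : ∀ i j, 1 ≤ i → i ≤ j → j ≤ s → w i ≤ w j) (γ : ℕ → ℝ) :
    Spec algorithm (initialState b m s α w γ) (Computed b m s α w γ)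
      ((setupCmd.size * (10 * (α + 2) ^ 2) + mainLoop.size * (35 * b ^ 5 + 2) +
        firstEtaCmd.size * 6 + errorCmd.size * 4) * costBound b m s w) := by
  have hN : b ^ m ≤ costBound b m s w := by rw [costBound]; omega
  refine (Spec.seq (setupCmd_spec hb hm h0 hα w γ) fun σ₁ h₁ _ =>
    Spec.seq (mainLoop_spec hb hw h₁) fun σ₂ h₂ _ =>
    Spec.seq (firstEtaCmd_spec hb h₂) fun σ₃ h₃ _ =>
    Spec.conseq (errorCmd_spec hb h₃.1) le_rfl fun σ' herr hA => ?_).mono ?_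
  · obtain ⟨h₃, hetas⟩ := h₃
    have r1 : σ'.natArr 1 = σ₃.natArr 1 := hA.natArr 1 rfl
    have r2 : σ'.realArr 2 = σ₃.realArr 2 := hA.realArr 2 rfl
    have r3 : σ'.realArr 3 = σ₃.realArr 3 := hA.realArr 3 rfl
    have r4 : σ'.realArr 4 = σ₃.realArr 4 := hA.realArr 4 rfl
    constructor
    · intro n hn
      rw [hA.realArr 1 rfl, h₃.table n hn, phiTab, Nat.mod_eq_of_lt hn]
    · rw [r1]; exact h₃.first
    · rw [r1, r3]; exact h₃.folded
    · rw [r1, r4]; exact h₃.product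
    · rw [r1]; exact h₃.argmin
    · rw [r1, r2]; exact hetas
    · rw [r1]; exact fun d hd _ => h₃.tail d hd
    · rw [r1]; exact herr
  · have h1 := Nat.mul_le_mul_left (setupCmd.size * (10 * (α + 2) ^ 2)) hN
    have h2 := Nat.mul_le_mul_left (firstEtaCmd.size * 6) hN
    have h3 := Nat.mul_le_mul_left (errorCmd.size * 4) hN
    rw [add_mul, add_mul, add_mul]
    simp only [← mul_assoc] at h1 h2 h3 ⊢
    omega

end ReducedCBC

theorem theorem2 :
    ∃ P : RealRAM.Cmd, ∀ b : ℕ, b.Prime → ∀ α : ℕ, 0 < α → Even α →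
      ∃ C : ℕ, ∀ m s : ℕ, 1 ≤ m → 1 ≤ s →
        ∀ w : ℕ → ℕ, (∀ i j, 1 ≤ i → i ≤ j → j ≤ s → w i ≤ w j) →
          ∀ γ : ℕ → ℝ, (∀ j, 1 ≤ j → j ≤ s → 0 < γ j) →
            ∃ (σ : RealRAM.State) (t : ℕ),
              RealRAM.Exec P (ReducedCBC.initialState b m s α w γ) σ t ∧
                ReducedCBC.Computed b m s α w γ σ ∧
                t ≤ C * ReducedCBC.costBound b m s w :=
  ⟨ReducedCBC.algorithm, fun _ hb _ h0 hα => ⟨_, fun _ _ hm _ _ hw γ _ =>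
    ReducedCBC.algorithm_spec hb hm h0 hα hw γ⟩⟩
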